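/- **Notation.** Let $q$ be a power of an odd prime, and for a matrix $M$ over $\mathbb F_{q^2}$ put $M^*=(M^{[q]})^T$, where $M^{[q]}$ is obtained by raising all entries to the power $q$. Let $J_m$ be the $m\times m$ matrix with ones on the second diagonal and zeros elsewhere, $U(m)=\{g\in GL(m,\mathbb F_{q^2}) : g^*J_mg=J_m\}$, $\mathfrak u(m)=\{X\in\mathfrak{gl}(m,\mathbb F_{q^2}) : X^*J_m+J_mX=0\}$. The groups $GL(n,\mathbb F_{q^2})$ and $U(2n)$ act by conjugation on $\mathfrak{gl}(n)=\mathfrak{gl}(n,\mathbb F_{q^2})$ and $\mathfrak u(2n)$. For a Lie algebra $\mathfrak g$ of this kind (or a product of two of them) let $\mathcal C(\mathfrak g)$ be the space of real functions constant on orbits, and identify $\mathcal C(\mathfrak g_1\oplus\mathfrak g_2)=\mathcal C(\mathfrak g_1)\otimes\mathcal C(\mathfrak g_2)$. Consider the graded real vector spaces $$A=A_{q^2}=\bigoplus_{n\ge0}\mathcal C(\mathfrak{gl}(n)),\qquad B=B_{q^2}=\bigoplus_{n\ge0}\mathcal C(\mathfrak u(2n)),$$ where $\mathcal C(\mathfrak{gl}(n))$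 and $\mathcal C(\mathfrak u(2n))$ have degree $n$. For $i+j=n$ let $P_{i,j}\subset GL(n,\mathbb F_{q^2})$ (resp. $\widetilde P_{i,j}\subset U(2n)$) be the subgroup of block upper triangular matrices with respect to $n=i+j$ (resp. $2n=i+2j+i$). Its Levi subalgebra consists of the block diagonal matrices and is identified with $\mathfrak{gl}(i)\oplus\mathfrak{gl}(j)$ (resp. with $\mathfrak{gl}(i)\oplus\mathfrak u(2j)$ by $(X,Y)\mapsto\operatorname{diag}(X,Y,-J_iX^*J_i)$). Let $\mathcal U_{i,j}\subset\mathfrak u(2n)$ be the set of strictly block upper triangular matrices. The parabolic induction of an invariant function $\Phi$ on the Levi subalgebra is $$X\mapsto\sum_{g\in[G/P]}\Phi'(g^{-1}Xg),$$ where $G$ is $GL(n,\mathbb F_{q^2})$ (resp. $U(2n)$), $P$ is $P_{i,j}$ (resp. $\widetilde P_{i,j}$), $[G/P]$ is a set of representatives of the left cosets, and $\Phi'(W)$ is the value of $\Phi$ at the block diagonal part of $W$ if $W$ is block upper triangular, and $0$ otherwise. Summing over all $i,j\ge0$ one obtains linear maps $\nabla:A\otimes A\to A$ and $\widetilde\nabla:A\otimes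 B\to B$. The parabolic restrictions $$\Psi\mapsto\Big((X,Y)\mapsto\frac1{|\mathcal U_{i,j}|}\sum_{Z\in\mathcal U_{i,j}}\Psi\big(\operatorname{diag}(X,Y,-J_iX^*J_i)+Z\big)\Big),\qquad \Psi\in\mathcal C(\mathfrak u(2n)),$$ summed over all $i+j=n$, define a graded linear map $\widetilde\Delta:B\to A\otimes B$. Let $x_1\in A$ be the indicator function of the zero matrix in $\mathfrak{gl}(1)$. Let $\mathcal F(A)$ be the set of linear functionals $\varphi:A\to\mathbb R$ that are nonnegative on the indicator function of every orbit and satisfy $\varphi(a)=\varphi(\nabla(x_1\otimes a))$ for all $a\in A$. Let $\widetilde{\mathcal F}(B)$ be the set of linear functionals $\psi:B\to\mathbb R$ that are nonnegative on the indicator function of every orbit and satisfy $\psi(b)=\psi(\widetilde\nabla(x_1\otimes b))$ for all $b\in B$. Let $\mathcal F_0(A)\subset\mathcal F(A)$ and $\widetilde{\mathcal F}_0(B)\subset\widetilde{\mathcal F}(B)$ be the subsets of those functionals that vanish on the indicator functions of all non-nilpotent orbits. For linear functionals $\varphi:A\to\mathbb R$, $\psi:B\to\mathbb R$ and $s\in\mathbb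 R$ let $\varphi\star_s\psi:B\to\mathbb R$ be the linear functional $$(\varphi\star_s\psi)(b')=\sum s^{\deg a}(1-2s)^{\deg b}\,\varphi(a)\,\psi(b),$$ where $\widetilde\Delta(b')=\sum a\otimes b$ is any expansion with homogeneous $a\in A$, $b\in B$, and $0^0=1$. **Theorem.** Let $0\le s\le\frac12$. If $\varphi\in\mathcal F(A)$ and $\psi\in\widetilde{\mathcal F}(B)$, then $\varphi\star_s\psi\in\widetilde{\mathcal F}(B)$. If moreover $\varphi\in\mathcal F_0(A)$ and $\psi\in\widetilde{\mathcal F}_0(B)$, then $\varphi\star_s\psi\in\widetilde{\mathcal F}_0(B)$. -/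

import Mathlib

open scoped TensorProduct DirectSum

noncomputable section

namespace Mixing

/-! ### Invariant functions and their indicator basis -/

/-- Real functions on `X` that are constant on the classes of `r`. Below, the classes of `r` are
the orbits of a group acting on a finite Lie algebra. -/
def InvFun {X : Type*} (r : Setoid X) : Submodule ℝ (X → ℝ) where
  carrier := {f | ∀ x y, r x y → f x = f y}
  add_mem' := fun {f g} hf hg x y h => by simp [hf x y h, hg x y h]
  zero_mem' := fun _ _ _ => rfl
  smul_mem' := fun t f hf x y h => by simp [hf x y h]

open Classical in
/-- The indicator function `χ_c` of the class (orbit) `c`. -/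
def orbInd {X : Type*} (r : Setoid X) (c : Quotient r) : InvFun r :=
  ⟨fun x => if Quotient.mk r x = c then 1 else 0, fun x y h => by
    have : Quotient.mk r x = Quotient.mk r y := Quotient.sound h
    simp [this]⟩

/-- The external product `f ⊗ g ↦ ((x, y) ↦ f x * g y)`. -/
def extMul {X Y : Type*} (r : Setoid X) (s : Setoid Y) :
    InvFun r ⊗[ℝ] InvFun s →ₗ[ℝ] InvFun (r.prod s) :=
  TensorProduct.lift (LinearMap.mk₂ ℝ
    (fun f g => ⟨fun p => f.1 p.1 * g.1 p.2, fun p p' h => by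
      show f.1 p.1 * g.1 p.2 = f.1 p'.1 * g.1 p'.2
      rw [f.2 _ _ h.1, g.2 _ _ h.2]⟩)
    (fun f f' g => Subtype.ext (funext fun p => by simp [add_mul]))
    (fun t f g => Subtype.ext (funext fun p => by simp [mul_assoc]))
    (fun f g g' => Subtype.ext (funext fun p => by simp [mul_add]))
    (fun t f g => Subtype.ext (funext fun p => by simp [mul_left_comm])))

theorem extMul_tmul {X Y : Type*} (r : Setoid X) (s : Setoid Y) (f : InvFun r) (g : InvFun s)
    (p : X × Y) : (extMul r s (f ⊗ₜ g)).1 p = f.1 p.1 * g.1 p.2 := rfl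

/-- Invariant functions are the functions on the set of classes. -/
def invFunEquiv {X : Type*} (r : Setoid X) : InvFun r ≃ₗ[ℝ] (Quotient r → ℝ) where
  toFun f := Quotient.lift f.1 f.2
  map_add' f g := by ext c; induction c using Quotient.inductionOn; rfl
  map_smul' t f := by ext c; induction c using Quotient.inductionOn; rfl
  invFun F := ⟨fun x => F (Quotient.mk r x), fun x y h => by
    have : Quotient.mk r x = Quotient.mk r y := Quotient.sound h
    simp [this]⟩
  left_inv f := rfl
  right_inv F := by ext c; induction c using Quotient.inductionOn; rfl

instance {X : Type*} [Finite X] (r : Setoid X) : FiniteDimensional ℝ (InvFun r) :=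
  Module.Finite.equiv (invFunEquiv r).symm

theorem extMul_bijective {X Y : Type*} [Finite X] [Finite Y] (r : Setoid X) (s : Setoid Y) :
    Function.Bijective (extMul r s) := by
  classical
  have hsurj : Function.Surjective (extMul r s) := by
    intro F
    have := Fintype.ofFinite (Quotient r)
    have := Fintype.ofFinite (Quotient s)
    refine ⟨∑ c : Quotient r, ∑ d : Quotient s,
      (F.1 (c.out, d.out)) • (orbInd r c ⊗ₜ[ℝ] orbInd s d), ?_⟩
    refine Subtype.ext (funext fun p => ?_)
    obtain ⟨x, y⟩ := p
    have key : F.1 (x, y) = F.1 ((Quotient.mk r x).out, (Quotient.mk s y).out) :=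
      F.2 _ _ ⟨r.symm (Quotient.mk_out x), s.symm (Quotient.mk_out y)⟩
    simp only [map_sum, map_smul, Submodule.coe_sum, Finset.sum_apply, Submodule.coe_smul,
      Pi.smul_apply, extMul_tmul, smul_eq_mul, orbInd]
    rw [Finset.sum_eq_single (Quotient.mk r x), Finset.sum_eq_single (Quotient.mk s y)]
    · simp [key]
    · intro d _ hd
      simp [Ne.symm hd]
    · simp
    · intro c _ hc
      simp [Ne.symm hc]
    · simp
  refine ⟨?_, hsurj⟩
  have hdim : Module.finrank ℝ (InvFun r ⊗[ℝ] InvFun s) =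
      Module.finrank ℝ (InvFun (r.prod s)) := ?_
  · exact (LinearMap.injective_iff_surjective_of_finrank_eq_finrank
      (V := InvFun r ⊗[ℝ] InvFun s) (V₂ := InvFun (r.prod s)) hdim (f := extMul r s)).2 hsurj
  have := Fintype.ofFinite (Quotient r)
  have := Fintype.ofFinite (Quotient s)
  have := Fintype.ofFinite (Quotient (r.prod s))
  rw [Module.finrank_tensorProduct, (invFunEquiv r).finrank_eq, (invFunEquiv s).finrank_eq,
    (invFunEquiv (r.prod s)).finrank_eq]
  simp only [Module.finrank_fintype_fun_eq_card]
  rw [← Fintype.card_prod, Fintype.card_congr (Setoid.prodQuotientEquiv r s)]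

/-- The identification of `𝒞(X) ⊗ 𝒞(Y)` with the invariant functions on `X × Y`. -/
def extMulEquiv {X Y : Type*} [Finite X] [Finite Y] (r : Setoid X) (s : Setoid Y) :
    (InvFun r ⊗[ℝ] InvFun s) ≃ₗ[ℝ] InvFun (r.prod s) :=
  LinearEquiv.ofBijective (extMul r s) (extMul_bijective r s)

/-! ### Sums over coset representatives -/

/-- `∑ f(g)`, where `g` runs over representatives of the left cosets of `P`. -/
def cosetSum {G : Type*} [Group G] (P : Subgroup G) (f : G → ℝ) : ℝ :=
  ∑ᶠ x : G ⧸ P, f x.out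

theorem cosetSum_translate {G : Type*} [Group G] (P : Subgroup G) (f : G → ℝ)
    (hf : ∀ g, ∀ p ∈ P, f (g * p) = f g) (h : G) :
    cosetSum P (fun g => f (h * g)) = cosetSum P f := by
  have hrep : ∀ g : G, f (Quotient.out (g : G ⧸ P)) = f g := by
    intro g
    obtain ⟨p, hp⟩ := QuotientGroup.mk_out_eq_mul P g
    rw [hp, hf _ _ p.2]
  unfold cosetSum
  rw [← finsum_comp_equiv (MulAction.toPerm h : Equiv.Perm (G ⧸ P)) (f := fun x => f x.out)]
  refine finsum_congr fun x => ?_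
  have : (MulAction.toPerm h : Equiv.Perm (G ⧸ P)) x = ((h * x.out : G) : G ⧸ P) := by
    conv_lhs => rw [← QuotientGroup.out_eq' x]
    rfl
  rw [this, hrep]

theorem finsum_lin_add {α : Type*} [Finite α] (f g : α → ℝ) :
    ∑ᶠ x, (f x + g x) = ∑ᶠ x, f x + ∑ᶠ x, g x :=
  finsum_add_distrib (Set.toFinite _) (Set.toFinite _)

theorem finsum_lin_smul {α : Type*} (t : ℝ) (f : α → ℝ) :
    ∑ᶠ x, t * f x = t * ∑ᶠ x, f x :=
  (mul_finsum f t).symm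

theorem cosetSum_add {G : Type*} [Group G] [Finite G] (P : Subgroup G) (f f' : G → ℝ) :
    cosetSum P (fun g => f g + f' g) = cosetSum P f + cosetSum P f' :=
  finsum_lin_add _ _

theorem cosetSum_smul {G : Type*} [Group G] (P : Subgroup G) (t : ℝ) (f : G → ℝ) :
    cosetSum P (fun g => t * f g) = t * cosetSum P f :=
  finsum_lin_smul _ _

/-! ### Block triangular matrices -/

/-- For block triangular matrices, passing to a diagonal block is multiplicative. -/
theorem submatrix_mul_of_blockTriangular {F ι κ : Type*} [CommRing F] [Fintype ι] [Fintype κ]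
    {b : ι → ℕ} {k : ℕ} {f : κ → ι} (hf : Function.Injective f) (hk : ∀ a, b (f a) = k)
    (hr : ∀ x, b x = k → x ∈ Set.range f) {M N : Matrix ι ι F} (hM : M.BlockTriangular b)
    (hN : N.BlockTriangular b) :
    (M * N).submatrix f f = M.submatrix f f * N.submatrix f f := by
  ext a c
  simp only [Matrix.submatrix_apply, Matrix.mul_apply]
  symm
  refine Fintype.sum_of_injective f hf _ _ (fun x hx => ?_) (fun _ => rfl)
  have hne : b x ≠ k := fun h => hx (hr x h)
  rcases lt_or_gt_of_ne hne with h | h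
  · rw [hM (show b x < b (f a) by rw [hk]; exact h), zero_mul]
  · rw [hN (show b (f c) < b x by rw [hk]; exact h), mul_zero]

/-- The subgroup of the block upper triangular matrices in `GL`. -/
def blockUpper (F : Type*) [CommRing F] {m : ℕ} (b : Fin m → ℕ) : Subgroup (GL (Fin m) F) where
  carrier := {g | (g : Matrix (Fin m) (Fin m) F).BlockTriangular b}
  one_mem' := Matrix.blockTriangular_one
  mul_mem' := fun hg hh => Matrix.BlockTriangular.mul hg hh
  inv_mem' := fun {g} hg => by
    have : Invertible (g : Matrix (Fin m) (Fin m) F) := g.invertible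
    have h := Matrix.blockTriangular_inv_of_blockTriangular (b := b) hg
    simpa using h

/-! ### General linear groups and the algebra `A` -/

/-- Conjugacy under `GL(n, F)` of `n × n` matrices. -/
def glConj (F : Type*) [Field F] (n : ℕ) : Setoid (Matrix (Fin n) (Fin n) F) where
  r X Y := ∃ g : GL (Fin n) F, (g : Matrix (Fin n) (Fin n) F) * X * (g⁻¹ : GL (Fin n) F) = Y
  iseqv :=
    { refl := fun X => ⟨1, by simp⟩
      symm := by
        rintro X _ ⟨g, rfl⟩
        refine ⟨g⁻¹, ?_⟩
        rw [inv_inv]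
        simp only [Matrix.mul_assoc, Units.inv_mul, Matrix.mul_one]
        simp only [← Matrix.mul_assoc, Units.inv_mul, Matrix.one_mul]
      trans := by
        rintro X _ _ ⟨g, rfl⟩ ⟨h, rfl⟩
        refine ⟨h * g, ?_⟩
        rw [mul_inv_rev]
        simp only [Units.val_mul, Matrix.mul_assoc] }

/-- `𝒞(𝔤𝔩(n, F))`. -/
abbrev CGl (F : Type*) [Field F] (n : ℕ) : Submodule ℝ (Matrix (Fin n) (Fin n) F → ℝ) :=
  InvFun (glConj F n)

/-- The graded space `A = ⨁ₙ 𝒞(𝔤𝔩(n, F))`. -/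
abbrev A (F : Type*) [Field F] : Type _ := ⨁ n : ℕ, CGl F n

/-- The blocks of `{1, …, i + j}`: label `0` for the first `i` indices, `1` for the last `j`. -/
def lab2 (i j : ℕ) (x : Fin (i + j)) : ℕ :=
  Sum.elim (fun _ => 0) (fun _ => 1) (finSumFinEquiv.symm x)

/-- Inclusion of the first block. -/
def fst2 (i j : ℕ) (a : Fin i) : Fin (i + j) := finSumFinEquiv (Sum.inl a)

/-- Inclusion of the second block. -/
def snd2 (i j : ℕ) (a : Fin j) : Fin (i + j) := finSumFinEquiv (Sum.inr a)

/-- The maximal parabolic subgroup `P_{i,j}` of `GL(i + j, F)`. -/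
def parGl (F : Type*) [Field F] (i j : ℕ) : Subgroup (GL (Fin (i + j)) F) :=
  blockUpper F (lab2 i j)

theorem mul_fst2 {F : Type*} [Field F] {i j : ℕ} {M N : Matrix (Fin (i + j)) (Fin (i + j)) F}
    (hM : M.BlockTriangular (lab2 i j)) (hN : N.BlockTriangular (lab2 i j)) :
    (M * N).submatrix (fst2 i j) (fst2 i j) =
      M.submatrix (fst2 i j) (fst2 i j) * N.submatrix (fst2 i j) (fst2 i j) := by
  refine submatrix_mul_of_blockTriangular (k := 0)
    (finSumFinEquiv.injective.comp Sum.inl_injective) (fun a => by simp [lab2]) ?_ hM hN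
  intro x hx
  obtain ⟨y, rfl⟩ := finSumFinEquiv.surjective x
  rcases y with a | a
  · exact ⟨a, rfl⟩
  · rw [lab2, Equiv.symm_apply_apply] at hx
    simp at hx

theorem mul_snd2 {F : Type*} [Field F] {i j : ℕ} {M N : Matrix (Fin (i + j)) (Fin (i + j)) F}
    (hM : M.BlockTriangular (lab2 i j)) (hN : N.BlockTriangular (lab2 i j)) :
    (M * N).submatrix (snd2 i j) (snd2 i j) =
      M.submatrix (snd2 i j) (snd2 i j) * N.submatrix (snd2 i j) (snd2 i j) := by
  refine submatrix_mul_of_blockTriangular (k := 1)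
    (finSumFinEquiv.injective.comp Sum.inr_injective) (fun a => by simp [lab2]) ?_ hM hN
  intro x hx
  obtain ⟨y, rfl⟩ := finSumFinEquiv.surjective x
  rcases y with a | a
  · rw [lab2, Equiv.symm_apply_apply] at hx
    simp at hx
  · exact ⟨a, rfl⟩

open Classical in
/-- The extension `Φ'` of a function `Φ` on the Levi subalgebra `𝔤𝔩(i) ⊕ 𝔤𝔩(j)` to
`𝔤𝔩(i + j)`: compose with the projection from the parabolic subalgebra, and extend by zero. -/
def extGl (F : Type*) [Field F] (i j : ℕ)
    (Φ : Matrix (Fin i) (Fin i) F × Matrix (Fin j) (Fin j) F → ℝ)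
    (W : Matrix (Fin (i + j)) (Fin (i + j)) F) : ℝ :=
  if W.BlockTriangular (lab2 i j) then
    Φ (W.submatrix (fst2 i j) (fst2 i j), W.submatrix (snd2 i j) (snd2 i j))
  else 0

/-- A diagonal block of a block triangular invertible matrix, as an invertible matrix. -/
def blockUnit {F ι κ : Type*} [CommRing F] [Fintype ι] [Fintype κ] [DecidableEq ι] [DecidableEq κ]
    (f : κ → ι) (hf : Function.Injective f) (g : GL ι F)
    (h1 : ((g : Matrix ι ι F) * (g⁻¹ : GL ι F)).submatrix f f =
      (g : Matrix ι ι F).submatrix f f * ((g⁻¹ : GL ι F) : Matrix ι ι F).submatrix f f)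
    (h2 : (((g⁻¹ : GL ι F) : Matrix ι ι F) * g).submatrix f f =
      ((g⁻¹ : GL ι F) : Matrix ι ι F).submatrix f f * (g : Matrix ι ι F).submatrix f f) :
    GL κ F where
  val := (g : Matrix ι ι F).submatrix f f
  inv := ((g⁻¹ : GL ι F) : Matrix ι ι F).submatrix f f
  val_inv := by rw [← h1, Units.mul_inv, Matrix.submatrix_one f hf]
  inv_val := by rw [← h2, Units.inv_mul, Matrix.submatrix_one f hf]

theorem conj_blockTriangular_iff {F : Type*} [CommRing F] {m : ℕ} {b : Fin m → ℕ}
    {p : GL (Fin m) F} (hp : p ∈ blockUpper F b) (W : Matrix (Fin m) (Fin m) F) :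
    (((p⁻¹ : GL (Fin m) F) : Matrix (Fin m) (Fin m) F) * W * p).BlockTriangular b ↔
      W.BlockTriangular b := by
  have hp' : p⁻¹ ∈ blockUpper F b := inv_mem hp
  constructor
  · intro h
    have := (Matrix.BlockTriangular.mul (Matrix.BlockTriangular.mul hp h) hp')
    have e : (p : Matrix (Fin m) (Fin m) F) * (((p⁻¹ : GL (Fin m) F) :
        Matrix (Fin m) (Fin m) F) * W * p) * (p⁻¹ : GL (Fin m) F) = W := by
      simp only [Matrix.mul_assoc, Units.mul_inv, Matrix.mul_one]
      simp only [← Matrix.mul_assoc, Units.mul_inv, Matrix.one_mul]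
    rwa [e] at this
  · intro h
    exact Matrix.BlockTriangular.mul (Matrix.BlockTriangular.mul hp' h) hp

theorem extGl_conj (F : Type*) [Field F] (i j : ℕ)
    (Φ : InvFun ((glConj F i).prod (glConj F j))) (p : GL (Fin (i + j)) F)
    (hp : p ∈ parGl F i j) (W : Matrix (Fin (i + j)) (Fin (i + j)) F) :
    extGl F i j Φ.1 (((p⁻¹ : GL (Fin (i + j)) F) : Matrix (Fin (i + j)) (Fin (i + j)) F) * W * p)
      = extGl F i j Φ.1 W := by
  have hp' : p⁻¹ ∈ parGl F i j := inv_mem hp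
  unfold extGl
  by_cases hW : W.BlockTriangular (lab2 i j)
  · rw [if_pos hW, if_pos ((conj_blockTriangular_iff hp W).2 hW)]
    refine Φ.2 _ _ ⟨?_, ?_⟩
    · refine ⟨blockUnit (fst2 i j) (finSumFinEquiv.injective.comp Sum.inl_injective) p
        (mul_fst2 hp hp') (mul_fst2 hp' hp), ?_⟩
      show (p : Matrix _ _ F).submatrix (fst2 i j) (fst2 i j) * _ *
        ((p⁻¹ : GL (Fin (i + j)) F) : Matrix _ _ F).submatrix (fst2 i j) (fst2 i j) = _
      rw [← mul_fst2 hp ((conj_blockTriangular_iff hp W).2 hW), ← mul_fst2 _ hp']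
      · simp only [Matrix.mul_assoc, Units.mul_inv, Matrix.mul_one]
        simp only [← Matrix.mul_assoc, Units.mul_inv, Matrix.one_mul]
      · exact Matrix.BlockTriangular.mul hp ((conj_blockTriangular_iff hp W).2 hW)
    · refine ⟨blockUnit (snd2 i j) (finSumFinEquiv.injective.comp Sum.inr_injective) p
        (mul_snd2 hp hp') (mul_snd2 hp' hp), ?_⟩
      show (p : Matrix _ _ F).submatrix (snd2 i j) (snd2 i j) * _ *
        ((p⁻¹ : GL (Fin (i + j)) F) : Matrix _ _ F).submatrix (snd2 i j) (snd2 i j) = _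
      rw [← mul_snd2 hp ((conj_blockTriangular_iff hp W).2 hW), ← mul_snd2 _ hp']
      · simp only [Matrix.mul_assoc, Units.mul_inv, Matrix.mul_one]
        simp only [← Matrix.mul_assoc, Units.mul_inv, Matrix.one_mul]
      · exact Matrix.BlockTriangular.mul hp ((conj_blockTriangular_iff hp W).2 hW)
  · rw [if_neg hW, if_neg (fun h => hW ((conj_blockTriangular_iff hp W).1 h))]

/-- Parabolic induction from `𝔤𝔩(i) ⊕ 𝔤𝔩(j)` to `𝔤𝔩(i + j)`: `X ↦ ∑_{g ∈ [G/P]} Φ'(g⁻¹ X g)`. -/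
def indGlFun (F : Type*) [Field F] (i j : ℕ)
    (Φ : Matrix (Fin i) (Fin i) F × Matrix (Fin j) (Fin j) F → ℝ)
    (X : Matrix (Fin (i + j)) (Fin (i + j)) F) : ℝ :=
  cosetSum (parGl F i j) fun g =>
    extGl F i j Φ (((g⁻¹ : GL (Fin (i + j)) F) : Matrix (Fin (i + j)) (Fin (i + j)) F) * X * g)

/-- Parabolic induction as a linear map `𝒞(𝔤𝔩(i) ⊕ 𝔤𝔩(j)) → 𝒞(𝔤𝔩(i + j))`. -/
def indGl (F : Type*) [Field F] [Finite F] (i j : ℕ) :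
    InvFun ((glConj F i).prod (glConj F j)) →ₗ[ℝ] CGl F (i + j) where
  toFun Φ := ⟨indGlFun F i j Φ.1, by
      rintro X _ ⟨h, rfl⟩
      unfold indGlFun
      rw [← cosetSum_translate (parGl F i j) (fun g => extGl F i j Φ.1
        (((g⁻¹ : GL (Fin (i + j)) F) : Matrix (Fin (i + j)) (Fin (i + j)) F) *
          ((h : Matrix (Fin (i + j)) (Fin (i + j)) F) * X * (h⁻¹ : GL (Fin (i + j)) F)) * g)) ?_ h]
      · congr 1
        funext g
        congr 1
        rw [mul_inv_rev]
        simp only [Units.val_mul, Matrix.mul_assoc, Units.inv_mul_cancel_left]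
      · intro g p hp
        refine Eq.trans ?_ (extGl_conj F i j Φ p hp _)
        congr 1
        rw [mul_inv_rev]
        simp only [Units.val_mul, Matrix.mul_assoc]⟩
  map_add' Φ Ψ := by
    refine Subtype.ext (funext fun X => ?_)
    show indGlFun F i j (Φ.1 + Ψ.1) X = indGlFun F i j Φ.1 X + indGlFun F i j Ψ.1 X
    refine Eq.trans ?_ (cosetSum_add _ _ _)
    refine congrArg (cosetSum (parGl F i j)) (funext fun g => ?_)
    simp only [extGl]
    split_ifs <;> simp
  map_smul' t Φ := by
    refine Subtype.ext (funext fun X => ?_)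
    show indGlFun F i j (t • Φ.1) X = t * indGlFun F i j Φ.1 X
    refine Eq.trans ?_ (cosetSum_smul _ _ _)
    refine congrArg (cosetSum (parGl F i j)) (funext fun g => ?_)
    simp only [extGl]
    split_ifs <;> simp

/-- The multiplication `∇ : A ⊗ A → A`, the sum of all parabolic inductions. -/
def nablaA (F : Type*) [Field F] [Finite F] : A F ⊗[ℝ] A F →ₗ[ℝ] A F :=
  TensorProduct.lift (DirectSum.toModule ℝ ℕ _ fun i => LinearMap.flip
    (DirectSum.toModule ℝ ℕ _ fun j => LinearMap.flip (TensorProduct.curry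
      (DirectSum.lof ℝ ℕ (fun n => CGl F n) (i + j) ∘ₗ indGl F i j ∘ₗ
        extMul (glConj F i) (glConj F j)))))

/-- `x₁ ∈ A`: the indicator function of the `1 × 1` zero matrix. -/
def x1 (F : Type*) [Field F] : A F :=
  DirectSum.lof ℝ ℕ (fun n => CGl F n) 1 (orbInd (glConj F 1) (Quotient.mk _ 0))

/-- The cone of positive harmonic functionals on `A`. -/
def HarmA (F : Type*) [Field F] [Finite F] : Set (A F →ₗ[ℝ] ℝ) :=
  {φ | (∀ (n : ℕ) (c : Quotient (glConj F n)),
      0 ≤ φ (DirectSum.lof ℝ ℕ (fun n => CGl F n) n (orbInd (glConj F n) c))) ∧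
    ∀ a : A F, φ a = φ (nablaA F (x1 F ⊗ₜ[ℝ] a))}

/-- The subcone of nilpotently supported positive harmonic functionals on `A`. -/
def HarmA0 (F : Type*) [Field F] [Finite F] : Set (A F →ₗ[ℝ] ℝ) :=
  {φ | φ ∈ HarmA F ∧ ∀ (n : ℕ) (X : Matrix (Fin n) (Fin n) F), ¬ IsNilpotent X →
      φ (DirectSum.lof ℝ ℕ (fun n => CGl F n) n (orbInd (glConj F n) (Quotient.mk _ X))) = 0}

/-! ### Unitary groups

The field `F` carries an involution `star`, which is `x ↦ x ^ q` in the application, so that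
`Matrix.conjTranspose` is `A ↦ A*`. -/

/-- The matrix `J_m` with ones on the second diagonal. -/
def J (F : Type*) [Field F] (m : ℕ) : Matrix (Fin m) (Fin m) F :=
  Matrix.of fun r c => if c = r.rev then 1 else 0

/-- The unitary group `U(m) = {g | g* J g = J}`. -/
def U (F : Type*) [Field F] [StarRing F] (m : ℕ) : Subgroup (GL (Fin m) F) where
  carrier := {g | (g : Matrix (Fin m) (Fin m) F).conjTranspose * J F m * g = J F m}
  one_mem' := by simp
  mul_mem' := by
    intro g h hg hh
    simp only [Set.mem_ofPred_eq] at *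
    rw [Units.val_mul, Matrix.conjTranspose_mul]
    calc _ = (h : Matrix (Fin m) (Fin m) F).conjTranspose *
          ((g : Matrix (Fin m) (Fin m) F).conjTranspose * J F m * g) * h := by
            simp only [Matrix.mul_assoc]
      _ = _ := by rw [hg, hh]
  inv_mem' := by
    intro g hg
    simp only [Set.mem_ofPred_eq] at *
    conv_lhs => rw [← hg]
    have h1 : ((g⁻¹ : GL (Fin m) F) : Matrix (Fin m) (Fin m) F).conjTranspose *
        (g : Matrix (Fin m) (Fin m) F).conjTranspose = 1 := by
      rw [← Matrix.conjTranspose_mul, Units.mul_inv, Matrix.conjTranspose_one]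
    simp only [← Matrix.mul_assoc, h1, Matrix.one_mul]
    simp only [Matrix.mul_assoc, Units.mul_inv, Matrix.mul_one]

/-- The Lie algebra `𝔲(m) = {X | X* J + J X = 0}`. -/
def uLie (F : Type*) [Field F] [StarRing F] (m : ℕ) : AddSubgroup (Matrix (Fin m) (Fin m) F) where
  carrier := {X | X.conjTranspose * J F m + J F m * X = 0}
  zero_mem' := by simp
  add_mem' := by
    intro X Y hX hY
    simp only [Set.mem_ofPred_eq] at *
    rw [Matrix.conjTranspose_add, Matrix.add_mul, Matrix.mul_add, add_add_add_comm, hX, hY,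
      add_zero]
  neg_mem' := by
    intro X hX
    simp only [Set.mem_ofPred_eq] at *
    rw [Matrix.conjTranspose_neg, Matrix.neg_mul, Matrix.mul_neg, ← neg_add, hX, neg_zero]

theorem J_mul_apply {F : Type*} [Field F] {m : ℕ} (M : Matrix (Fin m) (Fin m) F) (r c : Fin m) :
    (J F m * M) r c = M r.rev c := by
  simp [Matrix.mul_apply, J]

theorem mul_J_apply {F : Type*} [Field F] {m : ℕ} (M : Matrix (Fin m) (Fin m) F) (r c : Fin m) :
    (M * J F m) r c = M r c.rev := by
  simp only [Matrix.mul_apply, J, Matrix.of_apply, mul_ite, mul_one, mul_zero]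
  rw [Finset.sum_eq_single c.rev]
  · simp
  · intro b _ hb
    rw [if_neg]
    rintro rfl
    simp at hb
  · simp

theorem J_mul_J (F : Type*) [Field F] (m : ℕ) : J F m * J F m = 1 := by
  ext r c
  rw [J_mul_apply]
  simp [J, Matrix.one_apply, eq_comm]

theorem conjTranspose_J (F : Type*) [Field F] [StarRing F] (m : ℕ) :
    (J F m).conjTranspose = J F m := by
  ext r c
  simp only [Matrix.conjTranspose_apply, J, Matrix.of_apply]
  have : (r = c.rev) ↔ (c = r.rev) := by
    constructor <;> rintro rfl <;> simp
  by_cases h : c = r.rev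
  · rw [if_pos h, if_pos (this.2 h), star_one]
  · rw [if_neg h, if_neg (fun h' => h (this.1 h')), star_zero]

theorem mem_uLie_iff {F : Type*} [Field F] [StarRing F] {m : ℕ} (X : Matrix (Fin m) (Fin m) F) :
    X ∈ uLie F m ↔ ∀ r c, star (X c.rev r) + X r.rev c = 0 := by
  show X.conjTranspose * J F m + J F m * X = 0 ↔ _
  rw [← Matrix.ext_iff]
  simp only [Matrix.add_apply, mul_J_apply, J_mul_apply, Matrix.conjTranspose_apply,
    Matrix.zero_apply]

/-- The adjoint action of `U(m)` on `𝔲(m)` by conjugation. -/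
def adU {F : Type*} [Field F] [StarRing F] {m : ℕ} (g : U F m) (X : uLie F m) : uLie F m :=
  ⟨(g : GL (Fin m) F) * (X : Matrix (Fin m) (Fin m) F) * ((g : GL (Fin m) F)⁻¹ : GL (Fin m) F), by
    obtain ⟨g, hg⟩ := g
    obtain ⟨X, hX⟩ := X
    have hgi : g⁻¹ ∈ U F m := inv_mem hg
    change (g : Matrix (Fin m) (Fin m) F).conjTranspose * J F m * g = J F m at hg
    change ((g⁻¹ : GL (Fin m) F) : Matrix (Fin m) (Fin m) F).conjTranspose * J F m *
      (g⁻¹ : GL (Fin m) F) = J F m at hgi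
    change X.conjTranspose * J F m + J F m * X = 0 at hX
    show ((g : Matrix (Fin m) (Fin m) F) * X * (g⁻¹ : GL (Fin m) F)).conjTranspose * J F m +
      J F m * ((g : Matrix (Fin m) (Fin m) F) * X * (g⁻¹ : GL (Fin m) F)) = 0
    have e1 : (g : Matrix (Fin m) (Fin m) F).conjTranspose * J F m =
        J F m * (g⁻¹ : GL (Fin m) F) := by
      conv_rhs => rw [← hg]
      simp only [Matrix.mul_assoc, Units.mul_inv, Matrix.mul_one]
    have e2 : J F m * (g : Matrix (Fin m) (Fin m) F) =
        ((g⁻¹ : GL (Fin m) F) : Matrix (Fin m) (Fin m) F).conjTranspose * J F m := by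
      conv_lhs => rw [← hgi]
      simp only [Matrix.mul_assoc, Units.inv_mul, Matrix.mul_one]
    rw [Matrix.conjTranspose_mul, Matrix.conjTranspose_mul]
    calc _ = ((g⁻¹ : GL (Fin m) F) : Matrix (Fin m) (Fin m) F).conjTranspose * (X.conjTranspose *
          ((g : Matrix (Fin m) (Fin m) F).conjTranspose * J F m)) +
          (J F m * (g : Matrix (Fin m) (Fin m) F)) * X * (g⁻¹ : GL (Fin m) F) := by
            simp only [Matrix.mul_assoc]
      _ = ((g⁻¹ : GL (Fin m) F) : Matrix (Fin m) (Fin m) F).conjTranspose *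
          (X.conjTranspose * J F m + J F m * X) * (g⁻¹ : GL (Fin m) F) := by
            rw [e1, e2]
            simp only [Matrix.mul_assoc, Matrix.mul_add, Matrix.add_mul]
      _ = 0 := by rw [hX]; simp⟩

theorem adU_one {F : Type*} [Field F] [StarRing F] {m : ℕ} (X : uLie F m) : adU 1 X = X :=
  Subtype.ext (by simp [adU])

theorem adU_mul {F : Type*} [Field F] [StarRing F] {m : ℕ} (g h : U F m) (X : uLie F m) :
    adU (g * h) X = adU g (adU h X) :=
  Subtype.ext (by simp [adU, Matrix.mul_assoc])

theorem adU_add {F : Type*} [Field F] [StarRing F] {m : ℕ} (g : U F m) (X Y : uLie F m) :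
    adU g (X + Y) = adU g X + adU g Y :=
  Subtype.ext (by simp [adU, Matrix.mul_add, Matrix.add_mul])

/-- Conjugacy under `U(m)` in `𝔲(m)`. -/
def uConj (F : Type*) [Field F] [StarRing F] (m : ℕ) : Setoid (uLie F m) where
  r X Y := ∃ g : U F m, adU g X = Y
  iseqv :=
    { refl := fun X => ⟨1, adU_one X⟩
      symm := by
        rintro X _ ⟨g, rfl⟩
        exact ⟨g⁻¹, by rw [← adU_mul, inv_mul_cancel, adU_one]⟩
      trans := by
        rintro X _ _ ⟨g, rfl⟩ ⟨h, rfl⟩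
        exact ⟨h * g, adU_mul h g X⟩ }

/-- `𝒞(𝔲(m))`. -/
abbrev CU (F : Type*) [Field F] [StarRing F] (m : ℕ) : Submodule ℝ (uLie F m → ℝ) :=
  InvFun (uConj F m)

/-- The graded space `B = ⨁ₙ 𝒞(𝔲(2n))`, with `𝒞(𝔲(2n))` in degree `n`. -/
abbrev B (F : Type*) [Field F] [StarRing F] : Type _ := ⨁ n : ℕ, CU F (2 * n)

/-! ### Parabolic subgroups of `U(2n)` and the `A`-module and comodule structure of `B` -/

/-- The partition of the `2n` rows and columns into blocks of sizes `i, 2j, i`. -/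
def eqv3 {n i j : ℕ} (h : i + j = n) : Fin i ⊕ (Fin (2 * j) ⊕ Fin i) ≃ Fin (2 * n) :=
  ((Equiv.sumCongr (Equiv.refl _) finSumFinEquiv).trans finSumFinEquiv).trans
    (finCongr (by omega))

/-- Block labels `0, 1, 2`. -/
def lab3 {n i j : ℕ} (h : i + j = n) (x : Fin (2 * n)) : ℕ :=
  Sum.elim (fun _ => 0) (Sum.elim (fun _ => 1) (fun _ => 2)) ((eqv3 h).symm x)

/-- Inclusion of the first block. -/
def fst3 {n i j : ℕ} (h : i + j = n) (a : Fin i) : Fin (2 * n) := eqv3 h (Sum.inl a)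

/-- Inclusion of the middle block. -/
def mid3 {n i j : ℕ} (h : i + j = n) (a : Fin (2 * j)) : Fin (2 * n) :=
  eqv3 h (Sum.inr (Sum.inl a))

/-- Inclusion of the last block. -/
def lst3 {n i j : ℕ} (h : i + j = n) (a : Fin i) : Fin (2 * n) :=
  eqv3 h (Sum.inr (Sum.inr a))

theorem rev_fst3 {n i j : ℕ} (h : i + j = n) (a : Fin i) :
    (fst3 h a).rev = lst3 h a.rev := by
  ext
  simp [fst3, lst3, eqv3]
  omega

theorem rev_mid3 {n i j : ℕ} (h : i + j = n) (a : Fin (2 * j)) :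
    (mid3 h a).rev = mid3 h a.rev := by
  ext
  simp [mid3, eqv3]
  omega

theorem rev_lst3 {n i j : ℕ} (h : i + j = n) (a : Fin i) :
    (lst3 h a).rev = fst3 h a.rev := by
  ext
  simp [fst3, lst3, eqv3]
  omega

theorem cases3 {n i j : ℕ} (h : i + j = n) (x : Fin (2 * n)) :
    (∃ a, x = fst3 h a) ∨ (∃ a, x = mid3 h a) ∨ (∃ a, x = lst3 h a) := by
  obtain ⟨y, rfl⟩ := (eqv3 h).surjective x
  rcases y with a | a | a
  · exact Or.inl ⟨a, rfl⟩
  · exact Or.inr (Or.inl ⟨a, rfl⟩)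
  · exact Or.inr (Or.inr ⟨a, rfl⟩)

theorem lab3_fst3 {n i j : ℕ} (h : i + j = n) (a : Fin i) : lab3 h (fst3 h a) = 0 := by
  simp [lab3, fst3]

theorem lab3_mid3 {n i j : ℕ} (h : i + j = n) (a : Fin (2 * j)) : lab3 h (mid3 h a) = 1 := by
  simp [lab3, mid3]

theorem lab3_lst3 {n i j : ℕ} (h : i + j = n) (a : Fin i) : lab3 h (lst3 h a) = 2 := by
  simp [lab3, lst3]

theorem fst3_injective {n i j : ℕ} (h : i + j = n) : Function.Injective (fst3 h) :=
  (eqv3 h).injective.comp Sum.inl_injective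

theorem mid3_injective {n i j : ℕ} (h : i + j = n) : Function.Injective (mid3 h) :=
  (eqv3 h).injective.comp (Sum.inr_injective.comp Sum.inl_injective)

theorem mul_fst3 {F : Type*} [Field F] {n i j : ℕ} (h : i + j = n)
    {M N : Matrix (Fin (2 * n)) (Fin (2 * n)) F}
    (hM : M.BlockTriangular (lab3 h)) (hN : N.BlockTriangular (lab3 h)) :
    (M * N).submatrix (fst3 h) (fst3 h) =
      M.submatrix (fst3 h) (fst3 h) * N.submatrix (fst3 h) (fst3 h) := by
  refine submatrix_mul_of_blockTriangular (k := 0) (fst3_injective h) (lab3_fst3 h) ?_ hM hN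
  intro x hx
  rcases cases3 h x with ⟨a, rfl⟩ | ⟨a, rfl⟩ | ⟨a, rfl⟩
  · exact ⟨a, rfl⟩
  · simp [lab3_mid3] at hx
  · simp [lab3_lst3] at hx

theorem mul_mid3 {F : Type*} [Field F] {n i j : ℕ} (h : i + j = n)
    {M N : Matrix (Fin (2 * n)) (Fin (2 * n)) F}
    (hM : M.BlockTriangular (lab3 h)) (hN : N.BlockTriangular (lab3 h)) :
    (M * N).submatrix (mid3 h) (mid3 h) =
      M.submatrix (mid3 h) (mid3 h) * N.submatrix (mid3 h) (mid3 h) := by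
  refine submatrix_mul_of_blockTriangular (k := 1) (mid3_injective h) (lab3_mid3 h) ?_ hM hN
  intro x hx
  rcases cases3 h x with ⟨a, rfl⟩ | ⟨a, rfl⟩ | ⟨a, rfl⟩
  · simp [lab3_fst3] at hx
  · exact ⟨a, rfl⟩
  · simp [lab3_lst3] at hx

/-- The maximal parabolic subgroup `P̃_{i,j}` of `U(2n)`, `n = i + j`: its block upper triangular
matrices with respect to `2n = i + 2j + i`. -/
def parU (F : Type*) [Field F] [StarRing F] {n i j : ℕ} (h : i + j = n) : Subgroup (U F (2 * n)) :=
  (blockUpper F (lab3 h)).subgroupOf (U F (2 * n))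

/-- The Lie algebra of the unipotent radical `Ũ_{i,j}`: the strictly block upper triangular
matrices in `𝔲(2n)`. -/
def nilU (F : Type*) [Field F] [StarRing F] {n i j : ℕ} (h : i + j = n) :
    AddSubgroup (uLie F (2 * n)) where
  carrier := {Z | ∀ r c, lab3 h c ≤ lab3 h r → (Z : Matrix (Fin (2 * n)) (Fin (2 * n)) F) r c = 0}
  zero_mem' := fun _ _ _ => rfl
  add_mem' := fun {X Y} hX hY r c hrc => by simp [hX r c hrc, hY r c hrc]
  neg_mem' := fun {X} hX r c hrc => by simp [hX r c hrc]

/-- Block diagonal matrices with blocks of sizes `i, 2j, i`. -/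
def diag3 {F : Type*} [Field F] {n i j : ℕ} (h : i + j = n) (X : Matrix (Fin i) (Fin i) F)
    (Y : Matrix (Fin (2 * j)) (Fin (2 * j)) F) (Z : Matrix (Fin i) (Fin i) F) :
    Matrix (Fin (2 * n)) (Fin (2 * n)) F :=
  Matrix.reindex (eqv3 h) (eqv3 h)
    (Matrix.fromBlocks X 0 0 (Matrix.fromBlocks Y 0 0 Z))

theorem diag3_mul {F : Type*} [Field F] {n i j : ℕ} (h : i + j = n)
    (X X' : Matrix (Fin i) (Fin i) F) (Y Y' : Matrix (Fin (2 * j)) (Fin (2 * j)) F)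
    (Z Z' : Matrix (Fin i) (Fin i) F) :
    diag3 h X Y Z * diag3 h X' Y' Z' = diag3 h (X * X') (Y * Y') (Z * Z') := by
  simp [diag3, Matrix.submatrix_mul_equiv, Matrix.fromBlocks_multiply]

theorem diag3_one {F : Type*} [Field F] {n i j : ℕ} (h : i + j = n) :
    diag3 h (1 : Matrix (Fin i) (Fin i) F) 1 1 = 1 := by
  simp [diag3]

theorem diag3_blockTriangular {F : Type*} [Field F] {n i j : ℕ} (h : i + j = n)
    (X : Matrix (Fin i) (Fin i) F) (Y : Matrix (Fin (2 * j)) (Fin (2 * j)) F)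
    (Z : Matrix (Fin i) (Fin i) F) : (diag3 h X Y Z).BlockTriangular (lab3 h) := by
  intro r c hrc
  rcases cases3 h r with ⟨a, rfl⟩ | ⟨a, rfl⟩ | ⟨a, rfl⟩ <;>
  rcases cases3 h c with ⟨b, rfl⟩ | ⟨b, rfl⟩ | ⟨b, rfl⟩ <;>
  simp [lab3_fst3, lab3_mid3, lab3_lst3] at hrc <;>
  simp [diag3, fst3, mid3, lst3]

theorem J_eq_apply3 {F : Type*} [Field F] [StarRing F] {n i j : ℕ} (h : i + j = n)
    (X : Matrix (Fin i) (Fin i) F) (Y : Matrix (Fin (2 * j)) (Fin (2 * j)) F)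
    (Z : Matrix (Fin i) (Fin i) F) :
    (J F (2 * n) * (diag3 h X Y Z).conjTranspose * J F (2 * n)) =
      diag3 h (J F i * Z.conjTranspose * J F i) (J F (2 * j) * Y.conjTranspose * J F (2 * j))
        (J F i * X.conjTranspose * J F i) := by
  ext r c
  rw [mul_J_apply, J_mul_apply, Matrix.conjTranspose_apply]
  rcases cases3 h r with ⟨a, rfl⟩ | ⟨a, rfl⟩ | ⟨a, rfl⟩ <;>
  rcases cases3 h c with ⟨b, rfl⟩ | ⟨b, rfl⟩ | ⟨b, rfl⟩ <;>
  simp only [rev_fst3, rev_mid3, rev_lst3] <;>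
  simp [diag3, fst3, mid3, lst3, mul_J_apply, J_mul_apply]

theorem mem_U_iff {F : Type*} [Field F] [StarRing F] {m : ℕ} (g : GL (Fin m) F) :
    g ∈ U F m ↔ J F m * (g : Matrix (Fin m) (Fin m) F).conjTranspose * J F m =
      ((g⁻¹ : GL (Fin m) F) : Matrix (Fin m) (Fin m) F) := by
  show (g : Matrix (Fin m) (Fin m) F).conjTranspose * J F m * g = J F m ↔ _
  constructor
  · intro hg
    calc _ = J F m * ((g : Matrix (Fin m) (Fin m) F).conjTranspose * J F m * g) *
          (g⁻¹ : GL (Fin m) F) := by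
            simp only [Matrix.mul_assoc, Units.mul_inv, Matrix.mul_one]
      _ = _ := by rw [hg, J_mul_J, Matrix.one_mul]
  · intro hg
    calc _ = J F m * (J F m * (g : Matrix (Fin m) (Fin m) F).conjTranspose * J F m) * g := by
            simp only [← Matrix.mul_assoc, J_mul_J, Matrix.one_mul]
      _ = _ := by rw [hg, Matrix.mul_assoc, Units.inv_mul, Matrix.mul_one]

theorem mem_uLie_iff' {F : Type*} [Field F] [StarRing F] {m : ℕ} (X : Matrix (Fin m) (Fin m) F) :
    X ∈ uLie F m ↔ J F m * X.conjTranspose * J F m = -X := by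
  show X.conjTranspose * J F m + J F m * X = 0 ↔ _
  constructor
  · intro hX
    rw [Matrix.mul_assoc, eq_neg_of_add_eq_zero_left hX, Matrix.mul_neg, ← Matrix.mul_assoc,
      J_mul_J, Matrix.one_mul]
  · intro hX
    have : J F m * (J F m * X.conjTranspose * J F m) = J F m * (-X) := by rw [hX]
    rw [← Matrix.mul_assoc, ← Matrix.mul_assoc, J_mul_J, Matrix.one_mul] at this
    rw [this, Matrix.mul_neg, neg_add_cancel]

theorem J_conj_J {F : Type*} [Field F] [StarRing F] {m : ℕ} (X : Matrix (Fin m) (Fin m) F) :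
    J F m * (J F m * X.conjTranspose * J F m).conjTranspose * J F m = X := by
  rw [Matrix.conjTranspose_mul, Matrix.conjTranspose_mul, Matrix.conjTranspose_conjTranspose,
    conjTranspose_J]
  simp only [← Matrix.mul_assoc, J_mul_J, Matrix.one_mul]
  simp only [Matrix.mul_assoc, J_mul_J, Matrix.mul_one]

/-- The embedding of `𝔤𝔩(i) ⊕ 𝔲(2j)` as the Levi subalgebra of `𝔲(2n)`:
`(X, Y) ↦ diag(X, Y, -J X* J)`. -/
def levi {F : Type*} [Field F] [StarRing F] {n i j : ℕ} (h : i + j = n)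
    (X : Matrix (Fin i) (Fin i) F) (Y : uLie F (2 * j)) : uLie F (2 * n) :=
  ⟨diag3 h X Y (-(J F i * X.conjTranspose * J F i)), by
    rw [mem_uLie_iff', J_eq_apply3, (mem_uLie_iff' _).1 Y.2, Matrix.conjTranspose_neg,
      Matrix.mul_neg, Matrix.neg_mul, J_conj_J]
    ext r c
    rcases cases3 h r with ⟨a, rfl⟩ | ⟨a, rfl⟩ | ⟨a, rfl⟩ <;>
    rcases cases3 h c with ⟨b, rfl⟩ | ⟨b, rfl⟩ | ⟨b, rfl⟩ <;>
    simp [diag3, fst3, mid3, lst3]⟩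

/-- The embedding of `GL(i) × U(2j)` as the Levi subgroup of `U(2n)`:
`(a, b) ↦ diag(a, b, J (a*)⁻¹ J)`. -/
def leviGrp {F : Type*} [Field F] [StarRing F] {n i j : ℕ} (h : i + j = n)
    (a : GL (Fin i) F) (b : U F (2 * j)) : U F (2 * n) :=
  ⟨{ val := diag3 h (a : Matrix (Fin i) (Fin i) F) ((b : GL (Fin (2 * j)) F) : Matrix _ _ F)
        (J F i * ((a⁻¹ : GL (Fin i) F) : Matrix (Fin i) (Fin i) F).conjTranspose * J F i)
     inv := diag3 h ((a⁻¹ : GL (Fin i) F) : Matrix (Fin i) (Fin i) F)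
        (((b : GL (Fin (2 * j)) F)⁻¹ : GL (Fin (2 * j)) F) : Matrix _ _ F)
        (J F i * (a : Matrix (Fin i) (Fin i) F).conjTranspose * J F i)
     val_inv := by
       have : J F i * ((a⁻¹ : GL (Fin i) F) : Matrix (Fin i) (Fin i) F).conjTranspose * J F i *
          (J F i * (a : Matrix (Fin i) (Fin i) F).conjTranspose * J F i) = 1 := by
         calc _ = J F i * ((a⁻¹ : GL (Fin i) F) : Matrix (Fin i) (Fin i) F).conjTranspose *
                (J F i * J F i) * (a : Matrix (Fin i) (Fin i) F).conjTranspose * J F i := by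
                  simp only [Matrix.mul_assoc]
           _ = J F i * ((a : Matrix (Fin i) (Fin i) F) *
                (a⁻¹ : GL (Fin i) F)).conjTranspose * J F i := by
                  rw [J_mul_J, Matrix.mul_one, Matrix.conjTranspose_mul]
                  simp only [Matrix.mul_assoc]
           _ = 1 := by rw [Units.mul_inv, Matrix.conjTranspose_one, Matrix.mul_one, J_mul_J]
       rw [diag3_mul, this, Units.mul_inv, Units.mul_inv, diag3_one]
     inv_val := by
       have : J F i * (a : Matrix (Fin i) (Fin i) F).conjTranspose * J F i *
          (J F i * ((a⁻¹ : GL (Fin i) F) : Matrix (Fin i) (Fin i) F).conjTranspose * J F i) =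
            1 := by
         calc _ = J F i * (a : Matrix (Fin i) (Fin i) F).conjTranspose * (J F i * J F i) *
                ((a⁻¹ : GL (Fin i) F) : Matrix (Fin i) (Fin i) F).conjTranspose * J F i := by
                  simp only [Matrix.mul_assoc]
           _ = J F i * (((a⁻¹ : GL (Fin i) F) : Matrix (Fin i) (Fin i) F) *
                a).conjTranspose * J F i := by
                  rw [J_mul_J, Matrix.mul_one, Matrix.conjTranspose_mul]
                  simp only [Matrix.mul_assoc]
           _ = 1 := by rw [Units.inv_mul, Matrix.conjTranspose_one, Matrix.mul_one, J_mul_J]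
       rw [diag3_mul, this, Units.inv_mul, Units.inv_mul, diag3_one] }, by
    rw [mem_U_iff]
    show J F (2 * n) * (diag3 h _ _ _).conjTranspose * J F (2 * n) = diag3 h _ _ _
    rw [J_eq_apply3, J_conj_J, (mem_U_iff _).1 b.2]⟩

theorem adU_levi {F : Type*} [Field F] [StarRing F] {n i j : ℕ} (h : i + j = n)
    (a : GL (Fin i) F) (b : U F (2 * j)) (X : Matrix (Fin i) (Fin i) F) (Y : uLie F (2 * j)) :
    adU (leviGrp h a b) (levi h X Y) =
      levi h ((a : Matrix (Fin i) (Fin i) F) * X *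
        ((a⁻¹ : GL (Fin i) F) : Matrix (Fin i) (Fin i) F)) (adU b Y) := by
  refine Subtype.ext ?_
  change diag3 h (a : Matrix (Fin i) (Fin i) F) _ _ * diag3 h _ _ _ *
    diag3 h ((a⁻¹ : GL (Fin i) F) : Matrix (Fin i) (Fin i) F) _ _ = diag3 h _ _ _
  rw [diag3_mul, diag3_mul]
  congr 1
  rw [Matrix.mul_neg, Matrix.neg_mul]
  congr 1
  rw [Matrix.conjTranspose_mul, Matrix.conjTranspose_mul]
  calc _ = J F i * ((a⁻¹ : GL (Fin i) F) : Matrix (Fin i) (Fin i) F).conjTranspose *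
        (J F i * J F i) * X.conjTranspose * (J F i * J F i) *
        (a : Matrix (Fin i) (Fin i) F).conjTranspose * J F i := by
          simp only [Matrix.mul_assoc]
    _ = _ := by
      rw [J_mul_J, Matrix.mul_one, Matrix.mul_one]
      simp only [Matrix.mul_assoc]

theorem leviGrp_mem {F : Type*} [Field F] [StarRing F] {n i j : ℕ} (h : i + j = n)
    (a : GL (Fin i) F) (b : U F (2 * j)) : leviGrp h a b ∈ parU F h :=
  diag3_blockTriangular h _ _ _

theorem strict_mul {F : Type*} [Field F] {m : ℕ} {b : Fin m → ℕ} {M N : Matrix (Fin m) (Fin m) F}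
    (hM : M.BlockTriangular b) (hN : ∀ r c, b c ≤ b r → N r c = 0) :
    ∀ r c, b c ≤ b r → (M * N) r c = 0 := by
  intro r c hrc
  rw [Matrix.mul_apply]
  refine Finset.sum_eq_zero fun x _ => ?_
  by_cases hx : b x < b r
  · rw [hM hx, zero_mul]
  · rw [hN x c (by omega), mul_zero]

theorem mul_strict {F : Type*} [Field F] {m : ℕ} {b : Fin m → ℕ} {M N : Matrix (Fin m) (Fin m) F}
    (hM : ∀ r c, b c ≤ b r → M r c = 0) (hN : N.BlockTriangular b) :
    ∀ r c, b c ≤ b r → (M * N) r c = 0 := by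
  intro r c hrc
  rw [Matrix.mul_apply]
  refine Finset.sum_eq_zero fun x _ => ?_
  by_cases hx : b c < b x
  · rw [hN hx, mul_zero]
  · rw [hM r x (by omega), zero_mul]

theorem adU_nilU {F : Type*} [Field F] [StarRing F] {n i j : ℕ} (h : i + j = n)
    {p : U F (2 * n)} (hp : p ∈ parU F h) {Z : uLie F (2 * n)} (hZ : Z ∈ nilU F h) :
    adU p Z ∈ nilU F h := by
  have hp' : p⁻¹ ∈ parU F h := inv_mem hp
  exact mul_strict (strict_mul hp hZ) hp'

/-- `P̃_{i,j}` acts on the nilradical by conjugation. -/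
def nilUPerm {F : Type*} [Field F] [StarRing F] {n i j : ℕ} (h : i + j = n)
    {p : U F (2 * n)} (hp : p ∈ parU F h) : nilU F h ≃ nilU F h where
  toFun Z := ⟨adU p Z.1, adU_nilU h hp Z.2⟩
  invFun Z := ⟨adU p⁻¹ Z.1, adU_nilU h (inv_mem hp) Z.2⟩
  left_inv Z := Subtype.ext (by
    show adU p⁻¹ (adU p Z.1) = Z.1
    rw [← adU_mul, inv_mul_cancel, adU_one])
  right_inv Z := Subtype.ext (by
    show adU p (adU p⁻¹ Z.1) = Z.1
    rw [← adU_mul, mul_inv_cancel, adU_one])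

/-- Parabolic restriction from `𝔲(2n)` to `𝔤𝔩(i) ⊕ 𝔲(2j)`:
`(X, Y) ↦ |𝒰|⁻¹ ∑_{Z ∈ 𝒰} Ψ(diag(X, Y, -J X* J) + Z)`. -/
def resUFun (F : Type*) [Field F] [StarRing F] {n i j : ℕ} (h : i + j = n)
    (Ψ : uLie F (2 * n) → ℝ) (p : Matrix (Fin i) (Fin i) F × uLie F (2 * j)) : ℝ :=
  (Nat.card (nilU F h) : ℝ)⁻¹ * ∑ᶠ Z : nilU F h, Ψ (levi h p.1 p.2 + Z.1)

/-- Parabolic restriction as a linear map `𝒞(𝔲(2n)) → 𝒞(𝔤𝔩(i) ⊕ 𝔲(2j))`. -/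
def resU (F : Type*) [Field F] [Finite F] [StarRing F] {n i j : ℕ} (h : i + j = n) :
    CU F (2 * n) →ₗ[ℝ] InvFun ((glConj F i).prod (uConj F (2 * j))) where
  toFun Ψ := ⟨resUFun F h Ψ.1, by
    rintro ⟨X, Y⟩ ⟨_, _⟩ ⟨⟨a, rfl⟩, ⟨b, rfl⟩⟩
    unfold resUFun
    congr 1
    symm
    rw [← finsum_comp_equiv (nilUPerm h (leviGrp_mem h a b))]
    refine finsum_congr fun Z => ?_
    refine (Ψ.2 _ _ ⟨leviGrp h a b, ?_⟩).symm
    rw [adU_add, adU_levi]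
    rfl⟩
  map_add' Φ Ψ := by
    refine Subtype.ext (funext fun p => ?_)
    show resUFun F h (Φ.1 + Ψ.1) p = resUFun F h Φ.1 p + resUFun F h Ψ.1 p
    unfold resUFun
    rw [← mul_add, ← finsum_lin_add]
    rfl
  map_smul' t Φ := by
    refine Subtype.ext (funext fun p => ?_)
    show resUFun F h (t • Φ.1) p = t * resUFun F h Φ.1 p
    unfold resUFun
    rw [mul_left_comm, ← finsum_lin_smul t]
    rfl

/-- The middle block of a matrix in `𝔲(2n)` lies in `𝔲(2j)`. -/
def midU {F : Type*} [Field F] [StarRing F] {n i j : ℕ} (h : i + j = n) (W : uLie F (2 * n)) :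
    uLie F (2 * j) :=
  ⟨(W : Matrix (Fin (2 * n)) (Fin (2 * n)) F).submatrix (mid3 h) (mid3 h), by
    rw [mem_uLie_iff]
    intro r c
    have := (mem_uLie_iff _).1 W.2 (mid3 h r) (mid3 h c)
    rwa [rev_mid3, rev_mid3] at this⟩

open Classical in
/-- The extension `Φ'` of a function `Φ` on the Levi subalgebra `𝔤𝔩(i) ⊕ 𝔲(2j)` to `𝔲(2n)`:
compose with the projection from the parabolic subalgebra, and extend by zero. -/
def extU (F : Type*) [Field F] [StarRing F] {n i j : ℕ} (h : i + j = n)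
    (Φ : Matrix (Fin i) (Fin i) F × uLie F (2 * j) → ℝ) (W : uLie F (2 * n)) : ℝ :=
  if (W : Matrix (Fin (2 * n)) (Fin (2 * n)) F).BlockTriangular (lab3 h) then
    Φ ((W : Matrix (Fin (2 * n)) (Fin (2 * n)) F).submatrix (fst3 h) (fst3 h), midU h W)
  else 0

/-- The middle block of a matrix in the parabolic subgroup is unitary. -/
def midGrp {F : Type*} [Field F] [StarRing F] {n i j : ℕ} (h : i + j = n) {p : U F (2 * n)}
    (hp : p ∈ parU F h) : U F (2 * j) :=
  ⟨blockUnit (mid3 h) (mid3_injective h) (p : GL (Fin (2 * n)) F)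
    (mul_mid3 h hp (inv_mem hp : p⁻¹ ∈ parU F h)) (mul_mid3 h (inv_mem hp : p⁻¹ ∈ parU F h) hp), by
    rw [mem_U_iff]
    show J F (2 * j) * (((p : GL (Fin (2 * n)) F) : Matrix _ _ F).submatrix (mid3 h)
      (mid3 h)).conjTranspose * J F (2 * j) = (((p : GL (Fin (2 * n)) F)⁻¹ :
        GL (Fin (2 * n)) F) : Matrix _ _ F).submatrix (mid3 h) (mid3 h)
    rw [← (mem_U_iff _).1 p.2]
    ext r c
    simp only [mul_J_apply, J_mul_apply, Matrix.conjTranspose_apply, Matrix.submatrix_apply,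
      rev_mid3]⟩

theorem extU_conj (F : Type*) [Field F] [StarRing F] {n i j : ℕ} (h : i + j = n)
    (Φ : InvFun ((glConj F i).prod (uConj F (2 * j)))) (p : U F (2 * n))
    (hp : p ∈ parU F h) (W : uLie F (2 * n)) :
    extU F h Φ.1 (adU p W) = extU F h Φ.1 W := by
  have hp' : p⁻¹ ∈ parU F h := inv_mem hp
  have key := conj_blockTriangular_iff (b := lab3 h) (p := (p : GL (Fin (2 * n)) F)⁻¹) hp' W
  rw [inv_inv] at key
  change (adU p W : Matrix (Fin (2 * n)) (Fin (2 * n)) F).BlockTriangular (lab3 h) ↔ _ at key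
  unfold extU
  by_cases hW : (W : Matrix (Fin (2 * n)) (Fin (2 * n)) F).BlockTriangular (lab3 h)
  · rw [if_pos hW, if_pos (key.2 hW)]
    symm
    refine Φ.2 _ _ ⟨?_, ?_⟩
    · refine ⟨blockUnit (fst3 h) (fst3_injective h) (p : GL (Fin (2 * n)) F)
        (mul_fst3 h hp hp') (mul_fst3 h hp' hp), ?_⟩
      show ((p : GL (Fin (2 * n)) F) : Matrix _ _ F).submatrix (fst3 h) (fst3 h) * _ *
        (((p : GL (Fin (2 * n)) F)⁻¹ : GL (Fin (2 * n)) F) : Matrix _ _ F).submatrix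
          (fst3 h) (fst3 h) = _
      erw [← mul_fst3 h hp hW, ← mul_fst3 h (Matrix.BlockTriangular.mul hp hW) hp']
      rfl
    · refine ⟨midGrp h hp, Subtype.ext ?_⟩
      show ((p : GL (Fin (2 * n)) F) : Matrix _ _ F).submatrix (mid3 h) (mid3 h) *
        (W : Matrix (Fin (2 * n)) (Fin (2 * n)) F).submatrix (mid3 h) (mid3 h) *
        (((p : GL (Fin (2 * n)) F)⁻¹ : GL (Fin (2 * n)) F) : Matrix _ _ F).submatrix
          (mid3 h) (mid3 h) = _
      erw [← mul_mid3 h hp hW, ← mul_mid3 h (Matrix.BlockTriangular.mul hp hW) hp']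
      rfl
  · rw [if_neg hW, if_neg (fun h => hW (key.1 h))]

/-- Parabolic induction from `𝔤𝔩(i) ⊕ 𝔲(2j)` to `𝔲(2n)`: `X ↦ ∑_{g ∈ [G/P]} Φ'(g⁻¹ X g)`. -/
def indUFun (F : Type*) [Field F] [StarRing F] {n i j : ℕ} (h : i + j = n)
    (Φ : Matrix (Fin i) (Fin i) F × uLie F (2 * j) → ℝ) (X : uLie F (2 * n)) : ℝ :=
  cosetSum (parU F h) fun g => extU F h Φ (adU g⁻¹ X)

/-- Parabolic induction as a linear map `𝒞(𝔤𝔩(i) ⊕ 𝔲(2j)) → 𝒞(𝔲(2n))`. -/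
def indU (F : Type*) [Field F] [Finite F] [StarRing F] {n i j : ℕ} (h : i + j = n) :
    InvFun ((glConj F i).prod (uConj F (2 * j))) →ₗ[ℝ] CU F (2 * n) where
  toFun Φ := ⟨indUFun F h Φ.1, by
      rintro X _ ⟨k, rfl⟩
      unfold indUFun
      rw [← cosetSum_translate (parU F h) (fun g => extU F h Φ.1 (adU g⁻¹ (adU k X))) ?_ k]
      · congr 1
        funext g
        rw [← adU_mul, mul_inv_rev, inv_mul_cancel_right]
      · intro g p hp
        rw [mul_inv_rev, adU_mul, extU_conj F h Φ p⁻¹ (inv_mem hp)]⟩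
  map_add' Φ Ψ := by
    refine Subtype.ext (funext fun X => ?_)
    show indUFun F h (Φ.1 + Ψ.1) X = indUFun F h Φ.1 X + indUFun F h Ψ.1 X
    refine Eq.trans ?_ (cosetSum_add _ _ _)
    refine congrArg (cosetSum (parU F h)) (funext fun g => ?_)
    simp only [extU]
    split_ifs <;> simp
  map_smul' t Φ := by
    refine Subtype.ext (funext fun X => ?_)
    show indUFun F h (t • Φ.1) X = t * indUFun F h Φ.1 X
    refine Eq.trans ?_ (cosetSum_smul _ _ _)
    refine congrArg (cosetSum (parU F h)) (funext fun g => ?_)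
    simp only [extU]
    split_ifs <;> simp

/-- The action `∇̃ : A ⊗ B → B`, the sum of all parabolic inductions. -/
def nablaB (F : Type*) [Field F] [Finite F] [StarRing F] : A F ⊗[ℝ] B F →ₗ[ℝ] B F :=
  TensorProduct.lift (DirectSum.toModule ℝ ℕ _ fun i => LinearMap.flip
    (DirectSum.toModule ℝ ℕ _ fun j => LinearMap.flip (TensorProduct.curry
      (DirectSum.lof ℝ ℕ (fun n => CU F (2 * n)) (i + j) ∘ₗ indU F (rfl : i + j = i + j) ∘ₗ
        extMul (glConj F i) (uConj F (2 * j))))))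

/-- The coaction `Δ̃ : B → A ⊗ B`; in degree `n` it is the sum of the parabolic restrictions over
all `i + j = n`. -/
def deltaB (F : Type*) [Field F] [Finite F] [StarRing F] : B F →ₗ[ℝ] A F ⊗[ℝ] B F :=
  DirectSum.toModule ℝ ℕ _ fun n => ∑ p ∈ (Finset.HasAntidiagonal.antidiagonal n).attach,
    TensorProduct.map (DirectSum.lof ℝ ℕ (fun n => CGl F n) p.1.1)
        (DirectSum.lof ℝ ℕ (fun n => CU F (2 * n)) p.1.2) ∘ₗ
      (extMulEquiv (glConj F p.1.1) (uConj F (2 * p.1.2))).symm.toLinearMap ∘ₗ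
        resU F (Finset.HasAntidiagonal.mem_antidiagonal.1 p.2)

/-- The cone of positive harmonic functionals on `B`. -/
def HarmB (F : Type*) [Field F] [Finite F] [StarRing F] : Set (B F →ₗ[ℝ] ℝ) :=
  {ψ | (∀ (n : ℕ) (c : Quotient (uConj F (2 * n))),
      0 ≤ ψ (DirectSum.lof ℝ ℕ (fun n => CU F (2 * n)) n (orbInd (uConj F (2 * n)) c))) ∧
    ∀ b : B F, ψ b = ψ (nablaB F (x1 F ⊗ₜ[ℝ] b))}

/-- The subcone of nilpotently supported positive harmonic functionals on `B`. -/
def HarmB0 (F : Type*) [Field F] [Finite F] [StarRing F] : Set (B F →ₗ[ℝ] ℝ) :=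
  {ψ | ψ ∈ HarmB F ∧ ∀ (n : ℕ) (X : uLie F (2 * n)),
      ¬ IsNilpotent (X : Matrix (Fin (2 * n)) (Fin (2 * n)) F) →
      ψ (DirectSum.lof ℝ ℕ (fun n => CU F (2 * n)) n
        (orbInd (uConj F (2 * n)) (Quotient.mk _ X))) = 0}

/-! ### The mixing construction -/

/-- Multiplication by `s ^ n` in degree `n` (with `0 ^ 0 = 1`). -/
def degScale {M : ℕ → Type*} [∀ n, AddCommGroup (M n)] [∀ n, Module ℝ (M n)] (s : ℝ) :
    (⨁ n, M n) →ₗ[ℝ] ⨁ n, M n :=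
  DirectSum.lmap fun n => (s ^ n) • (LinearMap.id : M n →ₗ[ℝ] M n)

/-- The functional `φ ⋆_s ψ` on `B`: apply `Δ̃`, then send `a ⊗ b` to
`s ^ deg a * (1 - 2 s) ^ deg b * φ a * ψ b` for homogeneous `a` and `b`. -/
def mix {F : Type*} [Field F] [Finite F] [StarRing F] (s : ℝ) (φ : A F →ₗ[ℝ] ℝ)
    (ψ : B F →ₗ[ℝ] ℝ) : B F →ₗ[ℝ] ℝ :=
  LinearMap.mul' ℝ ℝ ∘ₗ
    TensorProduct.map (φ ∘ₗ degScale s) (ψ ∘ₗ degScale (1 - 2 * s)) ∘ₗ deltaB F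

/-- The defining formula of `φ ⋆_s ψ`, for any expansion of `Δ̃ b'` into homogeneous elements. -/
theorem mix_eq_sum {F : Type*} [Field F] [Finite F] [StarRing F] (s : ℝ) (φ : A F →ₗ[ℝ] ℝ)
    (ψ : B F →ₗ[ℝ] ℝ) (b' : B F) {κ : Type*} (t : Finset κ) (d e : κ → ℕ)
    (a : ∀ k, CGl F (d k)) (b : ∀ k, CU F (2 * e k))
    (hb : deltaB F b' = ∑ k ∈ t, DirectSum.lof ℝ ℕ (fun n => CGl F n) (d k) (a k) ⊗ₜ[ℝ]
      DirectSum.lof ℝ ℕ (fun n => CU F (2 * n)) (e k) (b k)) :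
    mix s φ ψ b' = ∑ k ∈ t, s ^ d k * (1 - 2 * s) ^ e k *
      φ (DirectSum.lof ℝ ℕ (fun n => CGl F n) (d k) (a k)) *
      ψ (DirectSum.lof ℝ ℕ (fun n => CU F (2 * n)) (e k) (b k)) := by
  simp only [mix, LinearMap.comp_apply, hb, map_sum, TensorProduct.map_tmul,
    LinearMap.mul'_apply, degScale, DirectSum.lmap_lof, LinearMap.smul_apply, LinearMap.id_apply,
    map_smul, smul_eq_mul]
  exact Finset.sum_congr rfl fun k _ => by ring

end Mixing

end

noncomputable section

namespace Mixing

/-! ### A matrix is conjugate to its transpose -/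

/-! On `f` of degree n, φ ⋆_s ψ is the sum over i + j = n of s^i (1 - 2s)^j times the pairing of φ ⊗
ψ with the restriction of `f` in bidegree (i, j) (`mix_lof`). For 0 ≤ s ≤ 1/2 all coefficients are
nonnegative and restriction preserves nonnegativity, which gives positivity. Nilpotent support is
inherited because a Levi element with nilpotent blocks stays nilpotent after adding an element of
the nilradical (`isNilpotent_levi_add`).

Harmonicity rests on a Mackey formula (`mackey`): paired with φ ⊗ ψ in bidegree (i, j), the product
x₁ · f gives twice the pairing of f in bidegree (i - 1, j) plus its pairing in bidegree (i, j - 1).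
Summed with the weights s^i (1 - 2s)^j this multiplies the total by 2s + (1 - 2s) = 1
(`sum_antidiagonal_shift`).

For the Mackey formula, functionals are written as sums against invariant densities, and the cosets
of the parabolic that defines multiplication by x₁ become isotropic lines. Let V be the span of the
first i basis vectors. The stabiliser of V has at most three orbits on nonzero isotropic vectors:
those in V, those in V^⊥ outside V, and those outside V^⊥. Inducing from x₁ asks that the matrix
kill the line. In the first cell this makes a column of the linear block X vanish, and harmonicity
of φ applies; in the second it makes a column of the unitary block Y vanish, and harmonicity of ψ
applies; in the third it makes a column of -J X* J vanish, that is, a row of X. Since every matrix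
is conjugate to its transpose (`glConj_transpose`), harmonicity of φ also holds with rows
(`weightA_harm_row`), so the first and third cells contribute equally. This is the factor 2.

The normalisations cancel uniformly: the size of a cell is the number of admissible vectors in its
block times the order of `colImage`, and the nilradical has order `colImage` times `colKer`. Only
the count outside V^⊥ needs 2 to be invertible. -/

open Polynomial in
/-- A quotient `F[X] / (p ^ e)` with `p` irreducible carries a functional whose associated trace
form is nondegenerate. -/
theorem exists_frobenius_functional {F : Type*} [Field F] {p : F[X]} (hp : Irreducible p) (e : ℕ) :
    ∃ l : (F[X] ⧸ Ideal.span {p ^ e}) →ₗ[F] F, ∀ a, (∀ b, l (a * b) = 0) → a = 0 := by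
  classical
  cases e with
  | zero =>
    refine ⟨0, fun a _ => ?_⟩
    obtain ⟨a, rfl⟩ := Ideal.Quotient.mk_surjective a
    rw [Ideal.Quotient.eq_zero_iff_mem, Ideal.mem_span_singleton]
    simp
  | succ k =>
    -- Every nonzero ideal of the quotient contains the class of p^k, so any functional that is
    -- nonzero on this class has a nondegenerate trace form.
    have hne : (Ideal.Quotient.mk (Ideal.span {p ^ (k + 1)}) (p ^ k)) ≠ 0 := by
      rw [Ne, Ideal.Quotient.eq_zero_iff_mem, Ideal.mem_span_singleton,
        pow_dvd_pow_iff hp.ne_zero hp.not_isUnit]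
      omega
    have : ¬ ∀ l : Module.Dual F (F[X] ⧸ Ideal.span {p ^ (k + 1)}),
        l (Ideal.Quotient.mk _ (p ^ k)) = 0 := by
      rw [Module.forall_dual_apply_eq_zero_iff]
      exact hne
    push Not at this
    obtain ⟨l, hl⟩ := this
    refine ⟨l, fun a ha => ?_⟩
    obtain ⟨a, rfl⟩ := Ideal.Quotient.mk_surjective a
    by_contra hane
    rw [Ideal.Quotient.eq_zero_iff_mem, Ideal.mem_span_singleton] at hane
    -- If a is nonzero in the quotient, its gcd with p^(k+1) is p^m up to a unit, with m ≤ k; Bézout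
    -- then exhibits p^k as a multiple of a modulo p^(k+1).
    obtain ⟨m, hm, hass⟩ := (dvd_prime_pow hp.prime (k + 1)).1
      (EuclideanDomain.gcd_dvd_right a (p ^ (k + 1)))
    have hmk : m ≤ k := by
      by_contra hlt
      have : m = k + 1 := by omega
      subst this
      exact hane (hass.symm.dvd.trans (EuclideanDomain.gcd_dvd_left _ _))
    have hdvd : EuclideanDomain.gcd a (p ^ (k + 1)) ∣ p ^ k := hass.dvd.trans (pow_dvd_pow p hmk)
    obtain ⟨c, hc⟩ := hdvd
    have hb := EuclideanDomain.gcd_eq_gcd_ab a (p ^ (k + 1))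
    refine hl ?_
    rw [← ha (Ideal.Quotient.mk _ (EuclideanDomain.gcdA a (p ^ (k + 1)) * c)), ← map_mul]
    congr 1
    rw [Ideal.Quotient.eq, Ideal.mem_span_singleton]
    refine ⟨EuclideanDomain.gcdB a (p ^ (k + 1)) * c, ?_⟩
    rw [hc, hb]
    ring

open Polynomial in
/-- An endomorphism of a finite dimensional space is self-adjoint for some bilinear form with
trivial left kernel. -/
theorem exists_selfAdjoint_form {F V : Type*} [Field F] [AddCommGroup V] [Module F V]
    [FiniteDimensional F V] (φ : V →ₗ[F] V) :
    ∃ β : V →ₗ[F] V →ₗ[F] F, (∀ v, (∀ w, β v w = 0) → v = 0) ∧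
      ∀ v w, β (φ v) w = β v (φ w) := by
  classical
  -- With X acting as φ, V becomes a sum of cyclic modules F[X]/(p^e). Summing the forms l(ab) over
  -- the summands makes φ self-adjoint, because multiplication in each quotient is commutative.
  obtain ⟨ι, _, p, hp, e, ⟨E⟩⟩ := Module.equiv_directSum_of_isTorsion
    (Module.AEval.isTorsion_of_finiteDimensional F V φ)
  choose l hl using fun i => exists_frobenius_functional (hp i) (e i)
  let c (i : ι) : V →ₗ[F] (F[X] ⧸ Ideal.span {p i ^ e i}) :=
    ((DirectSum.component F[X] ι (fun i => F[X] ⧸ Ideal.span {p i ^ e i}) i ∘ₗ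
      E.toLinearMap).restrictScalars F) ∘ₗ (Module.AEval.of F V φ).toLinearMap
  have hc (i : ι) (v : V) : c i (φ v) = Ideal.Quotient.mk _ X * c i v := by
    show E (Module.AEval'.of φ (φ v)) i = _
    rw [← Module.AEval'.X_smul_of, map_smul]
    show (X : F[X]) • (c i v) = _
    obtain ⟨y, hy⟩ := Ideal.Quotient.mk_surjective (c i v)
    rw [← hy]
    rfl
  let β : V →ₗ[F] V →ₗ[F] F :=
    ∑ i, (((LinearMap.mul F (F[X] ⧸ Ideal.span {p i ^ e i})).compr₂ (l i)).compl₁₂ (c i) (c i))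
  have hβ (v w : V) : β v w = ∑ i, l i (c i v * c i w) := by
    simp [β, LinearMap.sum_apply]
  refine ⟨β, fun v hv => ?_, fun v w => ?_⟩
  · have key (i : ι) : c i v = 0 := by
      refine hl i _ fun b => ?_
      have h := hv ((Module.AEval.of F V φ).symm (E.symm (DirectSum.lof F[X] ι
        (fun i => F[X] ⧸ Ideal.span {p i ^ e i}) i b)))
      rw [hβ, Finset.sum_eq_single i] at h
      · convert h using 3
        simp [c]
      · intro k _ hk
        have : c k ((Module.AEval.of F V φ).symm (E.symm (DirectSum.lof F[X] ι
            (fun i => F[X] ⧸ Ideal.span {p i ^ e i}) i b))) = 0 := by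
          simp [c, DirectSum.component.of, hk.symm]
        rw [this, mul_zero, map_zero]
      · simp
    have : E (Module.AEval.of F V φ v) = 0 := DFinsupp.ext key
    simpa using this
  · rw [hβ, hβ]
    refine Finset.sum_congr rfl fun i _ => ?_
    rw [hc, hc, mul_left_comm, mul_assoc]

/-- Every matrix over a field is conjugate to its transpose. -/
theorem glConj_transpose {F : Type*} [Field F] {n : ℕ} (M : Matrix (Fin n) (Fin n) F) :
    glConj F n M M.transpose := by
  obtain ⟨β, h0, hs⟩ := exists_selfAdjoint_form (Matrix.toLin' M)
  let G : Matrix (Fin n) (Fin n) F := LinearMap.toMatrix₂' F β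
  have hG (v w : Fin n → F) : β v w = v ⬝ᵥ G.mulVec w := by
    conv_lhs => rw [← Matrix.toLinearMap₂'_toMatrix' (R := F) β]
    rw [Matrix.toLinearMap₂'_apply']
  -- Self-adjointness of M for the form with Gram matrix G is this intertwining relation; trivial
  -- left kernel makes G invertible, so G conjugates M to its transpose.
  have hGM : M.transpose * G = G * M := by
    refine (Matrix.toLinearMap₂' (n := Fin n) (m := Fin n) (S₁ := F) (S₂ := F) (N₂ := F)
      F).injective ?_
    refine LinearMap.ext fun v => LinearMap.ext fun w => ?_
    have := hs v w
    simp only [Matrix.toLin'_apply, hG] at this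
    rw [Matrix.toLinearMap₂'_apply', Matrix.toLinearMap₂'_apply', ← Matrix.mulVec_mulVec,
      ← Matrix.mulVec_mulVec, ← this, Matrix.dotProduct_mulVec v, Matrix.vecMul_transpose]
  have hU : IsUnit G := by
    rw [Matrix.isUnit_iff_isUnit_det, isUnit_iff_ne_zero]
    intro hd
    obtain ⟨v, hv, hv0⟩ := Matrix.exists_vecMul_eq_zero_iff.2 hd
    refine hv (h0 v fun w => ?_)
    rw [hG, Matrix.dotProduct_mulVec, hv0, zero_dotProduct]
  obtain ⟨g, hg⟩ := hU
  refine ⟨g, ?_⟩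
  rw [hg, ← hGM, ← hg, Matrix.mul_assoc, Units.mul_inv, Matrix.mul_one]

/-! ### Linear functionals as weights -/

instance {F : Type*} [Field F] [StarRing F] [Fintype F] (m : ℕ) : Fintype (uLie F m) :=
  Fintype.ofFinite _

instance {F : Type*} [Field F] [StarRing F] [Fintype F] (m : ℕ) : Fintype (U F m) :=
  Fintype.ofFinite _

instance {F : Type*} [Field F] [Fintype F] (m : ℕ) : Fintype (GL (Fin m) F) :=
  Fintype.ofFinite _

instance {F : Type*} [Field F] [StarRing F] [Fintype F] {n i j : ℕ} (h : i + j = n) :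
    Fintype (nilU F h) :=
  Fintype.ofFinite _

open Classical in
/-- The invariant density, with respect to the counting measure, of a linear functional on
invariant functions. -/
def weight {X : Type*} [Fintype X] (r : Setoid X) (l : InvFun r →ₗ[ℝ] ℝ) : InvFun r :=
  ⟨fun x => l (orbInd r (Quotient.mk r x)) /
    (Finset.univ.filter fun y => Quotient.mk r y = Quotient.mk r x).card, fun x y h => by
    have : Quotient.mk r x = Quotient.mk r y := Quotient.sound h
    simp only [this]⟩

/-- Summing over points instead of orbits counts each orbit with its size, for which the division in
`weight` compensates. From here on functionals are finite sums against invariant densities. -/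
theorem weight_apply {X : Type*} [Fintype X] (r : Setoid X) (l : InvFun r →ₗ[ℝ] ℝ)
    (f : InvFun r) : l f = ∑ x, (weight r l).1 x * f.1 x := by
  classical
  have hf : f = ∑ x, (f.1 x / (Finset.univ.filter fun y =>
      Quotient.mk r y = Quotient.mk r x).card) • orbInd r (Quotient.mk r x) := by
    refine Subtype.ext (funext fun y => ?_)
    simp only [Submodule.coe_sum, Finset.sum_apply, Submodule.coe_smul, Pi.smul_apply, smul_eq_mul,
      orbInd, mul_ite, mul_one, mul_zero]
    rw [← Finset.sum_filter, Finset.sum_congr rfl (g := fun _ => f.1 y / (Finset.univ.filter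
      fun x => Quotient.mk r x = Quotient.mk r y).card)]
    · rw [Finset.sum_const, nsmul_eq_mul]
      have hcard : ((Finset.univ.filter
          fun x => Quotient.mk r y = Quotient.mk r x).card : ℝ) ≠ 0 := by
        refine Nat.cast_ne_zero.2 (Finset.card_ne_zero.2 ⟨y, by simp⟩)
      simp only [eq_comm (b := Quotient.mk r y)]
      field_simp
    · intro x hx
      have hx : Quotient.mk r y = Quotient.mk r x := (Finset.mem_filter.1 hx).2
      rw [hx, f.2 _ _ (Quotient.exact hx)]
  conv_lhs => rw [hf, map_sum]
  refine Finset.sum_congr rfl fun x _ => ?_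
  rw [map_smul, smul_eq_mul]
  simp only [weight]
  ring

theorem weight_nonneg {X : Type*} [Fintype X] {r : Setoid X} {l : InvFun r →ₗ[ℝ] ℝ}
    (hl : ∀ c, 0 ≤ l (orbInd r c)) (x : X) : 0 ≤ (weight r l).1 x :=
  div_nonneg (hl _) (Nat.cast_nonneg _)

theorem weight_eq_zero {X : Type*} [Fintype X] {r : Setoid X} {l : InvFun r →ₗ[ℝ] ℝ} {x : X}
    (hl : l (orbInd r (Quotient.mk r x)) = 0) : (weight r l).1 x = 0 := by
  simp [weight, hl]

/-- Removes the tensor product: only the function on the product space that corresponds to `T` is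
needed afterwards. -/
theorem mul'_map_eq_sum {X Y : Type*} [Fintype X] [Fintype Y] (r : Setoid X) (s : Setoid Y)
    (l : InvFun r →ₗ[ℝ] ℝ) (m : InvFun s →ₗ[ℝ] ℝ) (T : InvFun r ⊗[ℝ] InvFun s) :
    LinearMap.mul' ℝ ℝ (TensorProduct.map l m T) =
      ∑ x, ∑ y, (weight r l).1 x * (weight s m).1 y * (extMul r s T).1 (x, y) := by
  induction T using TensorProduct.induction_on with
  | zero => simp
  | tmul f g =>
    rw [TensorProduct.map_tmul, LinearMap.mul'_apply, weight_apply, weight_apply,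
      Finset.sum_mul_sum]
    simp only [extMul_tmul]
    refine Finset.sum_congr rfl fun x _ => Finset.sum_congr rfl fun y _ => ?_
    ring
  | add S T hS hT =>
    rw [map_add, map_add, hS, hT, ← Finset.sum_add_distrib]
    refine Finset.sum_congr rfl fun x _ => ?_
    rw [← Finset.sum_add_distrib]
    refine Finset.sum_congr rfl fun y _ => ?_
    simp [mul_add]

/-! ### The mixed functional as a weighted sum -/

/-- The density of `φ : A → ℝ` in degree `n`. -/
def weightA {F : Type*} [Field F] [Fintype F] (φ : A F →ₗ[ℝ] ℝ) (n : ℕ) : CGl F n :=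
  weight _ (φ ∘ₗ DirectSum.lof ℝ ℕ (fun n => CGl F n) n)

/-- The density of `ψ : B → ℝ` in degree `n`. -/
def weightB {F : Type*} [Field F] [StarRing F] [Fintype F] (ψ : B F →ₗ[ℝ] ℝ) (n : ℕ) :
    CU F (2 * n) :=
  weight _ (ψ ∘ₗ DirectSum.lof ℝ ℕ (fun n => CU F (2 * n)) n)

theorem weightA_apply {F : Type*} [Field F] [Fintype F] (φ : A F →ₗ[ℝ] ℝ) {n : ℕ} (f : CGl F n) :
    φ (DirectSum.lof ℝ ℕ (fun n => CGl F n) n f) = ∑ X, (weightA φ n).1 X * f.1 X :=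
  weight_apply _ (φ ∘ₗ DirectSum.lof ℝ ℕ (fun n => CGl F n) n) f

theorem weightB_apply {F : Type*} [Field F] [StarRing F] [Fintype F] (ψ : B F →ₗ[ℝ] ℝ) {n : ℕ}
    (f : CU F (2 * n)) :
    ψ (DirectSum.lof ℝ ℕ (fun n => CU F (2 * n)) n f) = ∑ Y, (weightB ψ n).1 Y * f.1 Y :=
  weight_apply _ (ψ ∘ₗ DirectSum.lof ℝ ℕ (fun n => CU F (2 * n)) n) f

/-- The pairing of the parabolic restriction of `f` with the product of the densities `u`, `v`. -/
def resPair {F : Type*} [Field F] [StarRing F] [Fintype F] {n i j : ℕ} (h : i + j = n)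
    (u : CGl F i) (v : CU F (2 * j)) (f : uLie F (2 * n) → ℝ) : ℝ :=
  ∑ X, ∑ Y, u.1 X * v.1 Y * resUFun F h f (X, Y)

/-- All later work starts from this expansion over bidegrees. The `else` branch never occurs on the
antidiagonal; it only allows a sum without attached membership proofs. -/
theorem mix_lof {F : Type*} [Field F] [Fintype F] [StarRing F] (s : ℝ) (φ : A F →ₗ[ℝ] ℝ)
    (ψ : B F →ₗ[ℝ] ℝ) {n : ℕ} (f : CU F (2 * n)) :
    mix s φ ψ (DirectSum.lof ℝ ℕ (fun n => CU F (2 * n)) n f) =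
      ∑ p ∈ Finset.HasAntidiagonal.antidiagonal n, s ^ p.1 * (1 - 2 * s) ^ p.2 *
        if h : p.1 + p.2 = n then resPair h (weightA φ p.1) (weightB ψ p.2) f.1 else 0 := by
  rw [← Finset.sum_attach]
  simp only [mix, LinearMap.comp_apply, deltaB, DirectSum.toModule_lof, LinearMap.sum_apply,
    map_sum]
  refine Finset.sum_congr rfl fun p _ => ?_
  obtain ⟨⟨i, j⟩, hp⟩ := p
  have h : i + j = n := Finset.HasAntidiagonal.mem_antidiagonal.1 hp
  simp only [dif_pos h, LinearEquiv.coe_coe]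
  set R := resU F h f with hR
  have hR1 : R.1 = resUFun F h f.1 := rfl
  have hT : extMul (glConj F i) (uConj F (2 * j)) ((extMulEquiv (glConj F i)
      (uConj F (2 * j))).symm R) = R :=
    (extMulEquiv (glConj F i) (uConj F (2 * j))).apply_symm_apply R
  set T := (extMulEquiv (glConj F i) (uConj F (2 * j))).symm R
  have e : TensorProduct.map (φ ∘ₗ degScale s) (ψ ∘ₗ degScale (1 - 2 * s))
      (TensorProduct.map (DirectSum.lof ℝ ℕ (fun n => CGl F n) i)
        (DirectSum.lof ℝ ℕ (fun n => CU F (2 * n)) j) T) =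
      TensorProduct.map (s ^ i • (φ ∘ₗ DirectSum.lof ℝ ℕ (fun n => CGl F n) i))
        ((1 - 2 * s) ^ j • (ψ ∘ₗ DirectSum.lof ℝ ℕ (fun n => CU F (2 * n)) j)) T := by
    rw [← LinearMap.comp_apply, ← TensorProduct.map_comp]
    congr 2
    · ext x
      simp [degScale, DirectSum.lmap_lof]
    · ext x
      simp [degScale, DirectSum.lmap_lof]
  refine (congrArg (LinearMap.mul' ℝ ℝ) e).trans ?_
  rw [TensorProduct.map_smul_left, TensorProduct.map_smul_right]
  simp only [LinearMap.smul_apply, map_smul, smul_eq_mul]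
  rw [mul'_map_eq_sum, hT, hR1, ← mul_assoc]
  rfl

theorem resUFun_nonneg {F : Type*} [Field F] [StarRing F] {n i j : ℕ} (h : i + j = n)
    {f : uLie F (2 * n) → ℝ} (hf : ∀ W, 0 ≤ f W)
    (p : Matrix (Fin i) (Fin i) F × uLie F (2 * j)) : 0 ≤ resUFun F h f p :=
  mul_nonneg (by positivity) (finsum_nonneg fun _ => hf _)

theorem resPair_nonneg {F : Type*} [Field F] [StarRing F] [Fintype F] {n i j : ℕ} (h : i + j = n)
    {u : CGl F i} {v : CU F (2 * j)} {f : uLie F (2 * n) → ℝ} (hu : ∀ X, 0 ≤ u.1 X)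
    (hv : ∀ Y, 0 ≤ v.1 Y) (hf : ∀ W, 0 ≤ f W) : 0 ≤ resPair h u v f :=
  Finset.sum_nonneg fun X _ => Finset.sum_nonneg fun Y _ =>
    mul_nonneg (mul_nonneg (hu X) (hv Y)) (resUFun_nonneg h hf _)

theorem orbInd_nonneg {X : Type*} (r : Setoid X) (c : Quotient r) (x : X) :
    0 ≤ (orbInd r c).1 x := by
  simp only [orbInd]
  split_ifs <;> norm_num

/-! ### Nilpotency of block triangular matrices -/

/-- A nonzero term of the triple product would need four strictly increasing labels, but only 0, 1,
2 are available. -/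
theorem strict_cube {F : Type*} [Field F] {m : ℕ} {b : Fin m → ℕ} (hb : ∀ r, b r ≤ 2)
    {N : Matrix (Fin m) (Fin m) F} (hN : ∀ r c, b c ≤ b r → N r c = 0) : N ^ 3 = 0 := by
  ext r c
  rw [pow_succ, pow_two, Matrix.mul_apply]
  refine Finset.sum_eq_zero fun x _ => ?_
  rw [Matrix.mul_apply, Finset.sum_mul]
  refine Finset.sum_eq_zero fun y _ => ?_
  by_cases h1 : b y ≤ b r
  · rw [hN r y h1]
    simp
  by_cases h2 : b x ≤ b y
  · rw [hN y x h2]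
    simp
  · rw [hN x c (by have := hb c; omega)]
    simp

/-- The strictly block triangular matrices form a two-sided ideal in the block triangular ones, and
modulo this ideal D + N equals D. -/
theorem add_strict_pow {F : Type*} [Field F] {m : ℕ} {b : Fin m → ℕ}
    {D N : Matrix (Fin m) (Fin m) F} (hD : D.BlockTriangular b)
    (hN : ∀ r c, b c ≤ b r → N r c = 0) (k : ℕ) :
    ∀ r c, b c ≤ b r → ((D + N) ^ k - D ^ k) r c = 0 := by
  have hNB : N.BlockTriangular b := fun r c hrc => hN r c hrc.le
  induction k with
  | zero => intro r c _; simp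
  | succ k ih =>
    intro r c hrc
    have e : (D + N) ^ (k + 1) - D ^ (k + 1) = ((D + N) ^ k - D ^ k) * (D + N) + D ^ k * N := by
      rw [pow_succ, pow_succ]
      noncomm_ring
    have hDk : (D ^ k).BlockTriangular b := by
      clear ih e
      induction k with
      | zero => exact Matrix.blockTriangular_one
      | succ k ih => rw [pow_succ]; exact ih.mul hD
    rw [e, Matrix.add_apply, mul_strict ih (hD.add hNB) r c hrc, strict_mul hDk hN r c hrc,
      add_zero]

theorem lab3_le_two {n i j : ℕ} (h : i + j = n) (r : Fin (2 * n)) : lab3 h r ≤ 2 := by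
  rcases cases3 h r with ⟨a, rfl⟩ | ⟨a, rfl⟩ | ⟨a, rfl⟩ <;>
  simp [lab3_fst3, lab3_mid3, lab3_lst3]

theorem diag3_pow {F : Type*} [Field F] {n i j : ℕ} (h : i + j = n) (X : Matrix (Fin i) (Fin i) F)
    (Y : Matrix (Fin (2 * j)) (Fin (2 * j)) F) (Z : Matrix (Fin i) (Fin i) F) (k : ℕ) :
    diag3 h X Y Z ^ k = diag3 h (X ^ k) (Y ^ k) (Z ^ k) := by
  induction k with
  | zero => simp [diag3_one]
  | succ k ih => rw [pow_succ, ih, diag3_mul, pow_succ, pow_succ, pow_succ]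

/-- The exponent a + b + c kills all three diagonal blocks, so this power of the sum is strictly
block triangular, and its cube vanishes. -/
theorem isNilpotent_levi_add {F : Type*} [Field F] [StarRing F] {n i j : ℕ} (h : i + j = n)
    {X : Matrix (Fin i) (Fin i) F} {Y : uLie F (2 * j)} (hX : IsNilpotent X)
    (hY : IsNilpotent (Y : Matrix (Fin (2 * j)) (Fin (2 * j)) F)) {Z : uLie F (2 * n)}
    (hZ : Z ∈ nilU F h) :
    IsNilpotent ((levi h X Y + Z : uLie F (2 * n)) : Matrix (Fin (2 * n)) (Fin (2 * n)) F) := by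
  have hX' : IsNilpotent (-(J F i * X.conjTranspose * J F i)) := by
    rw [isNilpotent_neg_iff]
    obtain ⟨k, hk⟩ := hX
    refine ⟨k, ?_⟩
    have : ∀ k : ℕ, (J F i * X.conjTranspose * J F i) ^ k =
        J F i * (X ^ k).conjTranspose * J F i := by
      intro k
      induction k with
      | zero => simp [J_mul_J]
      | succ k ih =>
        rw [pow_succ, ih, pow_succ', Matrix.conjTranspose_mul]
        calc _ = J F i * (X ^ k).conjTranspose * (J F i * J F i) * X.conjTranspose * J F i := by
              simp only [Matrix.mul_assoc]
          _ = _ := by rw [J_mul_J]; simp only [Matrix.mul_one, Matrix.mul_assoc]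
    rw [this, hk]
    simp
  obtain ⟨a, ha⟩ := hX
  obtain ⟨b, hb⟩ := hY
  obtain ⟨c, hc⟩ := hX'
  have hD : (levi h X Y : Matrix (Fin (2 * n)) (Fin (2 * n)) F) ^ (a + b + c) = 0 := by
    show diag3 h X Y (-(J F i * X.conjTranspose * J F i)) ^ (a + b + c) = 0
    rw [diag3_pow, pow_add, pow_add, ha, pow_add, pow_add, hb, pow_add, pow_add, hc]
    simp [diag3]
  have hs := add_strict_pow (diag3_blockTriangular h X Y (-(J F i * X.conjTranspose * J F i)))
    hZ (a + b + c)
  refine ⟨(a + b + c) * 3, ?_⟩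
  rw [pow_mul]
  refine strict_cube (lab3_le_two h) fun r c' hrc => ?_
  have := hs r c' hrc
  rw [show diag3 h X Y (-(J F i * X.conjTranspose * J F i)) ^ (a + b + c) = 0 from hD,
    sub_zero] at this
  exact this

theorem isNilpotent_of_uConj {F : Type*} [Field F] [StarRing F] {m : ℕ} {X Y : uLie F m}
    (h : uConj F m X Y) (hX : IsNilpotent (X : Matrix (Fin m) (Fin m) F)) :
    IsNilpotent (Y : Matrix (Fin m) (Fin m) F) := by
  obtain ⟨g, rfl⟩ := h
  obtain ⟨k, hk⟩ := hX
  refine ⟨k, ?_⟩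
  show ((g : GL (Fin m) F) * (X : Matrix (Fin m) (Fin m) F) *
    ((g : GL (Fin m) F)⁻¹ : GL (Fin m) F)) ^ k = 0
  rw [Units.conj_pow, hk]
  simp

/-! ### Positivity and nilpotent support of the mixed functional. -/

/-- The mixed functional is nonnegative on indicator functions of orbits. -/
theorem mix_orbInd_nonneg {F : Type*} [Field F] [Fintype F] [StarRing F] {s : ℝ} (hs0 : 0 ≤ s)
    (hs1 : s ≤ 1 / 2) {φ : A F →ₗ[ℝ] ℝ} (hφ : φ ∈ HarmA F) {ψ : B F →ₗ[ℝ] ℝ} (hψ : ψ ∈ HarmB F)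
    (n : ℕ) (c : Quotient (uConj F (2 * n))) :
    0 ≤ mix s φ ψ (DirectSum.lof ℝ ℕ (fun n => CU F (2 * n)) n (orbInd (uConj F (2 * n)) c)) := by
  rw [mix_lof]
  refine Finset.sum_nonneg fun p _ => mul_nonneg (mul_nonneg (by positivity)
    (pow_nonneg (by linarith) _)) ?_
  split_ifs with h
  · exact resPair_nonneg h (weight_nonneg fun c => hφ.1 _ c) (weight_nonneg fun c => hψ.1 _ c)
      (orbInd_nonneg _ _)
  · exact le_rfl

/-- The mixed functional of nilpotently supported functionals is nilpotently supported. -/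
theorem mix_orbInd_eq_zero {F : Type*} [Field F] [Fintype F] [StarRing F] (s : ℝ)
    {φ : A F →ₗ[ℝ] ℝ} (hφ : φ ∈ HarmA0 F) {ψ : B F →ₗ[ℝ] ℝ} (hψ : ψ ∈ HarmB0 F)
    (n : ℕ) (W : uLie F (2 * n)) (hW : ¬ IsNilpotent (W : Matrix (Fin (2 * n)) (Fin (2 * n)) F)) :
    mix s φ ψ (DirectSum.lof ℝ ℕ (fun n => CU F (2 * n)) n
      (orbInd (uConj F (2 * n)) (Quotient.mk _ W))) = 0 := by
  rw [mix_lof]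
  refine Finset.sum_eq_zero fun p _ => ?_
  split_ifs with h
  · refine mul_eq_zero_of_right _ (Finset.sum_eq_zero fun X _ => Finset.sum_eq_zero fun Y _ => ?_)
    -- If both blocks are nilpotent, every `levi h X Y + Z` is nilpotent and misses the orbit of
    -- `W`; otherwise one of the two densities vanishes.
    by_cases hX : IsNilpotent X
    · by_cases hY : IsNilpotent (Y : Matrix (Fin (2 * p.2)) (Fin (2 * p.2)) F)
      · refine mul_eq_zero_of_right _ (mul_eq_zero_of_right _ ?_)
        rw [← finsum_zero (α := nilU F h)]
        refine finsum_congr fun Z => if_neg fun hc => hW ?_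
        exact isNilpotent_of_uConj (Quotient.exact hc) (isNilpotent_levi_add h hX hY Z.2)
      · rw [show (weightB ψ p.2).1 Y = 0 from weight_eq_zero (hψ.2 _ Y hY)]
        simp
    · rw [show (weightA φ p.1).1 X = 0 from weight_eq_zero (hφ.2 _ X hX)]
      simp
  · simp

/-! ### The hermitian form and unitary matrices -/

/-- The hermitian form `v* J w`. -/
def herm {F : Type*} [Field F] [StarRing F] {m : ℕ} (v w : Fin m → F) : F :=
  ∑ r, star (v r) * w r.rev

theorem herm_eq_dotProduct {F : Type*} [Field F] [StarRing F] {m : ℕ} (v w : Fin m → F) :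
    herm v w = star v ⬝ᵥ (J F m).mulVec w := by
  simp only [herm, dotProduct]
  refine Finset.sum_congr rfl fun r _ => ?_
  simp [Matrix.mulVec, dotProduct, J]

theorem herm_mulVec {F : Type*} [Field F] [StarRing F] {m : ℕ} (g : U F m) (v w : Fin m → F) :
    herm (((g : GL (Fin m) F) : Matrix (Fin m) (Fin m) F).mulVec v)
      (((g : GL (Fin m) F) : Matrix (Fin m) (Fin m) F).mulVec w) = herm v w := by
  have hg : ((g : GL (Fin m) F) : Matrix (Fin m) (Fin m) F).conjTranspose * J F m *
    ((g : GL (Fin m) F) : Matrix (Fin m) (Fin m) F) = J F m := g.2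
  rw [herm_eq_dotProduct, herm_eq_dotProduct, Matrix.star_mulVec, ← Matrix.dotProduct_mulVec,
    Matrix.mulVec_mulVec, Matrix.mulVec_mulVec, hg]

theorem herm_single_right {F : Type*} [Field F] [StarRing F] {m : ℕ} (v : Fin m → F) (c : Fin m)
    (x : F) : herm v (Pi.single c x) = star (v c.rev) * x := by
  rw [herm, Finset.sum_eq_single c.rev]
  · simp
  · intro r _ hr
    rw [Pi.single_eq_of_ne, mul_zero]
    rintro rfl
    simp at hr
  · simp

theorem herm_single_left {F : Type*} [Field F] [StarRing F] {m : ℕ} (w : Fin m → F) (c : Fin m)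
    (x : F) : herm (Pi.single c x) w = star x * w c.rev := by
  rw [herm, Finset.sum_eq_single c]
  · simp
  · intro r _ hr
    simp [Pi.single_eq_of_ne hr]
  · simp

theorem herm_sub_right {F : Type*} [Field F] [StarRing F] {m : ℕ} (v w w' : Fin m → F) :
    herm v (w - w') = herm v w - herm v w' := by
  simp [herm, mul_sub]

theorem herm_sub_left {F : Type*} [Field F] [StarRing F] {m : ℕ} (v v' w : Fin m → F) :
    herm (v - v') w = herm v w - herm v' w := by
  simp [herm, sub_mul]

theorem conjTranspose_mul_J_mul_apply {F : Type*} [Field F] [StarRing F] {m : ℕ}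
    (E : Matrix (Fin m) (Fin m) F) (r c : Fin m) :
    (E.conjTranspose * J F m * E) r c = herm (E.col r) (E.col c) := by
  rw [Matrix.mul_assoc, Matrix.mul_apply, herm]
  refine Finset.sum_congr rfl fun x _ => ?_
  rw [J_mul_apply]
  rfl

/-- A matrix preserving the hermitian form, as an element of the unitary group. -/
def unitaryOfForm {F : Type*} [Field F] [StarRing F] {m : ℕ} (E : Matrix (Fin m) (Fin m) F)
    (hE : E.conjTranspose * J F m * E = J F m) : U F m :=
  ⟨{ val := E
     inv := J F m * E.conjTranspose * J F m
     val_inv := by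
       rw [mul_eq_one_comm, Matrix.mul_assoc, Matrix.mul_assoc, ← Matrix.mul_assoc _ (J F m), hE,
         J_mul_J]
     inv_val := by
       rw [Matrix.mul_assoc, Matrix.mul_assoc, ← Matrix.mul_assoc _ (J F m), hE, J_mul_J] }, hE⟩

/-- The Eichler transformation sending the basis vector `e_a` to a vector `v` with `v a = 1`. -/
def eichler {F : Type*} [Field F] [StarRing F] {m : ℕ} (a : Fin m) (v : Fin m → F) :
    Matrix (Fin m) (Fin m) F :=
  Matrix.of fun r c => if c = a then v r else
    (Pi.single c 1 - Pi.single a.rev (if c = a.rev then (0 : F) else star (v c.rev)) : Fin m → F) r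

theorem eichler_col_self {F : Type*} [Field F] [StarRing F] {m : ℕ} (a : Fin m) (v : Fin m → F) :
    (eichler a v).col a = v := by
  ext r
  simp [eichler, Matrix.col]

theorem eichler_col_of_ne {F : Type*} [Field F] [StarRing F] {m : ℕ} {a c : Fin m} (h : c ≠ a)
    (v : Fin m → F) : (eichler a v).col c =
      Pi.single c 1 - Pi.single a.rev (if c = a.rev then 0 else star (v c.rev)) := by
  ext r
  simp [eichler, Matrix.col, h]

/-- Since v a = 1, the product of v with e_{a.rev} is 1, so subtracting a multiple of e_{a.rev} from
e_c corrects the product of e_c with v. These corrections leave the remaining products unchanged: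
e_{a.rev} is isotropic because a.rev ≠ a, and it is orthogonal to every e_c with c ≠ a. -/
theorem eichler_form {F : Type*} [Field F] [StarRing F] {m : ℕ} {a : Fin m} (ha : a.rev ≠ a)
    {v : Fin m → F} (hv : herm v v = 0) (hva : v a = 1) :
    (eichler a v).conjTranspose * J F m * eichler a v = J F m := by
  ext r c
  rw [conjTranspose_mul_J_mul_apply]
  have hJ : ∀ r c, (J F m) r c = if c = r.rev then 1 else 0 := fun r c => rfl
  have e1 : ∀ r c : Fin m, c.rev = r ↔ c = r.rev := fun r c => by
    constructor <;> rintro rfl <;> simp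
  by_cases hr : r = a <;> by_cases hc : c = a
  · subst hr hc
    rw [eichler_col_self, hv, hJ, if_neg ha.symm]
  · subst hr
    rw [eichler_col_self, eichler_col_of_ne hc, herm_sub_right, herm_single_right,
      herm_single_right, hJ]
    by_cases h : c = r.rev
    · subst h
      simp [hva]
    · simp [h, hva]
  · subst hc
    rw [eichler_col_self, eichler_col_of_ne hr, herm_sub_left, herm_single_left,
      herm_single_left, hJ]
    by_cases h : r = c.rev
    · subst h
      simp [hva]
    · have h' : ¬ c = r.rev := fun h' => h (by rw [h']; simp)
      simp [h, hva, h']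
  · rw [eichler_col_of_ne hc, eichler_col_of_ne hr, herm_sub_left, herm_sub_right, herm_sub_right,
      herm_single_left, herm_single_left, herm_single_left, herm_single_left, hJ]
    have h1 : r.rev ≠ a.rev := fun h => hr (Fin.rev_injective h)
    simp only [Fin.rev_rev, Pi.single_eq_of_ne h1, Pi.single_eq_of_ne (Ne.symm hc),
      Pi.single_eq_of_ne (Ne.symm ha)]
    by_cases h : c = r.rev
    · subst h
      simp
    · simp [h]

/-! ### The action of invertible matrices on vectors. -/

theorem matrix_mulVec_single {F : Type*} [Field F] {m : ℕ} (M : Matrix (Fin m) (Fin m) F)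
    (a : Fin m) : M.mulVec (Pi.single a 1) = M.col a := by
  ext r
  simp [Matrix.col]

theorem mulVec_inv_mulVec {F : Type*} [Field F] {m : ℕ} (g : GL (Fin m) F) (v : Fin m → F) :
    (g : Matrix (Fin m) (Fin m) F).mulVec (((g⁻¹ : GL (Fin m) F) :
      Matrix (Fin m) (Fin m) F).mulVec v) = v := by
  rw [Matrix.mulVec_mulVec, Units.mul_inv, Matrix.one_mulVec]

theorem inv_mulVec_mulVec {F : Type*} [Field F] {m : ℕ} (g : GL (Fin m) F) (v : Fin m → F) :
    ((g⁻¹ : GL (Fin m) F) : Matrix (Fin m) (Fin m) F).mulVec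
      ((g : Matrix (Fin m) (Fin m) F).mulVec v) = v := by
  rw [Matrix.mulVec_mulVec, Units.inv_mul, Matrix.one_mulVec]

theorem mulVec_ne_zero {F : Type*} [Field F] {m : ℕ} (g : GL (Fin m) F) {v : Fin m → F}
    (hv : v ≠ 0) : (g : Matrix (Fin m) (Fin m) F).mulVec v ≠ 0 := fun h => hv (by
  rw [← inv_mulVec_mulVec g v, h, Matrix.mulVec_zero])

/-- `GL` acts transitively on nonzero vectors. -/
theorem exists_gl_mulVec_eq {F : Type*} [Field F] {m : ℕ} {v w : Fin m → F} (hv : v ≠ 0)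
    (hw : w ≠ 0) : ∃ g : GL (Fin m) F, (g : Matrix (Fin m) (Fin m) F).mulVec v = w := by
  obtain ⟨f, hf⟩ := Submodule.exists_linearEquiv_restrict_eq
    ((LinearEquiv.toSpanNonzeroSingleton F _ v hv).symm ≪≫ₗ
      LinearEquiv.toSpanNonzeroSingleton F _ w hw)
  refine ⟨⟨LinearMap.toMatrix' f.toLinearMap, LinearMap.toMatrix' f.symm.toLinearMap, ?_, ?_⟩, ?_⟩
  · rw [← LinearMap.toMatrix'_comp]
    simp
  · rw [← LinearMap.toMatrix'_comp]
    simp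
  · show (LinearMap.toMatrix' f.toLinearMap).mulVec v = w
    rw [LinearMap.toMatrix'_mulVec]
    have := hf ⟨v, Submodule.mem_span_singleton_self v⟩
    have e : (LinearEquiv.toSpanNonzeroSingleton F _ v hv).symm
        ⟨v, Submodule.mem_span_singleton_self v⟩ = 1 :=
      LinearEquiv.coord_self F _ v hv
    simp only [LinearEquiv.trans_apply, e] at this
    simpa using this.symm

/-! ### Block decomposition of vectors -/

theorem ext3 {F : Type*} {n i j : ℕ} (h : i + j = n) {v w : Fin (2 * n) → F}
    (h1 : ∀ a, v (fst3 h a) = w (fst3 h a)) (h2 : ∀ a, v (mid3 h a) = w (mid3 h a))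
    (h3 : ∀ a, v (lst3 h a) = w (lst3 h a)) : v = w := by
  ext r
  rcases cases3 h r with ⟨a, rfl⟩ | ⟨a, rfl⟩ | ⟨a, rfl⟩
  · exact h1 a
  · exact h2 a
  · exact h3 a

theorem sum3 {M : Type*} [AddCommMonoid M] {n i j : ℕ} (h : i + j = n) (f : Fin (2 * n) → M) :
    ∑ r, f r = ∑ a, f (fst3 h a) + (∑ a, f (mid3 h a) + ∑ a, f (lst3 h a)) := by
  rw [← (eqv3 h).sum_comp, Fintype.sum_sum_type, Fintype.sum_sum_type]
  rfl

theorem diag3_mulVec_fst3 {F : Type*} [Field F] {n i j : ℕ} (h : i + j = n)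
    (X : Matrix (Fin i) (Fin i) F) (Y : Matrix (Fin (2 * j)) (Fin (2 * j)) F)
    (Z : Matrix (Fin i) (Fin i) F) (v : Fin (2 * n) → F) (a : Fin i) :
    (diag3 h X Y Z).mulVec v (fst3 h a) = X.mulVec (v ∘ fst3 h) a := by
  simp only [Matrix.mulVec, dotProduct]
  rw [sum3 h]
  simp [diag3, fst3, mid3, lst3]

theorem diag3_mulVec_mid3 {F : Type*} [Field F] {n i j : ℕ} (h : i + j = n)
    (X : Matrix (Fin i) (Fin i) F) (Y : Matrix (Fin (2 * j)) (Fin (2 * j)) F)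
    (Z : Matrix (Fin i) (Fin i) F) (v : Fin (2 * n) → F) (a : Fin (2 * j)) :
    (diag3 h X Y Z).mulVec v (mid3 h a) = Y.mulVec (v ∘ mid3 h) a := by
  simp only [Matrix.mulVec, dotProduct]
  rw [sum3 h]
  simp [diag3, fst3, mid3, lst3]

theorem diag3_mulVec_lst3 {F : Type*} [Field F] {n i j : ℕ} (h : i + j = n)
    (X : Matrix (Fin i) (Fin i) F) (Y : Matrix (Fin (2 * j)) (Fin (2 * j)) F)
    (Z : Matrix (Fin i) (Fin i) F) (v : Fin (2 * n) → F) (a : Fin i) :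
    (diag3 h X Y Z).mulVec v (lst3 h a) = Z.mulVec (v ∘ lst3 h) a := by
  simp only [Matrix.mulVec, dotProduct]
  rw [sum3 h]
  simp [diag3, fst3, mid3, lst3]

theorem fst3_ne_mid3 {n i j : ℕ} (h : i + j = n) (a : Fin i) (b : Fin (2 * j)) :
    fst3 h a ≠ mid3 h b := by simp [fst3, mid3]

theorem fst3_ne_lst3 {n i j : ℕ} (h : i + j = n) (a b : Fin i) :
    fst3 h a ≠ lst3 h b := by simp [fst3, lst3]

theorem mid3_ne_lst3 {n i j : ℕ} (h : i + j = n) (a : Fin (2 * j)) (b : Fin i) :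
    mid3 h a ≠ lst3 h b := by simp [mid3, lst3]

theorem lst3_injective {n i j : ℕ} (h : i + j = n) : Function.Injective (lst3 h) :=
  (eqv3 h).injective.comp (Sum.inr_injective.comp Sum.inr_injective)

theorem single_comp_fst3 {F : Type*} [Field F] {n i j : ℕ} (h : i + j = n) (a : Fin i) :
    (Pi.single (fst3 h a) (1 : F) : Fin (2 * n) → F) ∘ fst3 h = Pi.single a 1 := by
  ext b
  simp [Pi.single_apply, (fst3_injective h).eq_iff]

/-! ### Orbits of the parabolic subgroup on isotropic vectors -/

/-- First cell: nonzero vectors of the isotropic subspace V spanned by the first block. The Levi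
factor GL(i) is already transitive on them. -/
theorem par_trans_fst {F : Type*} [Field F] [StarRing F] {n i j : ℕ} (h : i + j = n)
    (a : Fin i) {v : Fin (2 * n) → F} (h1 : v ∘ fst3 h ≠ 0) (h2 : v ∘ mid3 h = 0)
    (h3 : v ∘ lst3 h = 0) : ∃ p ∈ parU F h,
      ((p : GL (Fin (2 * n)) F) : Matrix _ _ F).mulVec (Pi.single (fst3 h a) 1) = v := by
  obtain ⟨g, hg⟩ := exists_gl_mulVec_eq (v := Pi.single a (1 : F)) (by simp) h1
  refine ⟨leviGrp h g 1, leviGrp_mem h g 1, ext3 h (fun b => ?_) (fun b => ?_) (fun b => ?_)⟩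
  · exact (diag3_mulVec_fst3 h _ _ _ _ b).trans (by rw [single_comp_fst3, hg]; rfl)
  · refine (diag3_mulVec_mid3 h _ _ _ _ b).trans ?_
    rw [show (Pi.single (fst3 h a) (1 : F) : Fin (2 * n) → F) ∘ mid3 h = 0 from
      funext fun c => by simp [fst3_ne_mid3], Matrix.mulVec_zero]
    exact (congrFun h2 b).symm
  · refine (diag3_mulVec_lst3 h _ _ _ _ b).trans ?_
    rw [show (Pi.single (fst3 h a) (1 : F) : Fin (2 * n) → F) ∘ lst3 h = 0 from
      funext fun c => by simp [fst3_ne_lst3], Matrix.mulVec_zero]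
    exact (congrFun h3 b).symm

theorem rev_ne_self {m : ℕ} (a : Fin (2 * m)) : a.rev ≠ a := by
  intro h
  have := congrArg Fin.val h
  simp at this
  omega

theorem herm_inv_mulVec {F : Type*} [Field F] [StarRing F] {m : ℕ} (g : U F m) (v : Fin m → F) :
    herm ((((g : GL (Fin m) F)⁻¹ : GL (Fin m) F) : Matrix (Fin m) (Fin m) F).mulVec v)
      ((((g : GL (Fin m) F)⁻¹ : GL (Fin m) F) : Matrix (Fin m) (Fin m) F).mulVec v) = herm v v :=
  herm_mulVec g⁻¹ v v

theorem J_conj_mul {F : Type*} [Field F] [StarRing F] {m : ℕ} (X Y : Matrix (Fin m) (Fin m) F) :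
    J F m * X.conjTranspose * J F m * (J F m * Y.conjTranspose * J F m) =
      J F m * (Y * X).conjTranspose * J F m := by
  calc _ = J F m * X.conjTranspose * (J F m * J F m) * Y.conjTranspose * J F m := by
        simp only [Matrix.mul_assoc]
    _ = _ := by rw [J_mul_J, Matrix.conjTranspose_mul]; simp only [Matrix.mul_one, Matrix.mul_assoc]

/-- The automorphism `g ↦ J (g*)⁻¹ J` of the general linear group. -/
def dualGL {F : Type*} [Field F] [StarRing F] {m : ℕ} (g : GL (Fin m) F) : GL (Fin m) F where
  val := J F m * ((g⁻¹ : GL (Fin m) F) : Matrix (Fin m) (Fin m) F).conjTranspose * J F m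
  inv := J F m * (g : Matrix (Fin m) (Fin m) F).conjTranspose * J F m
  val_inv := by rw [J_conj_mul, Units.mul_inv, Matrix.conjTranspose_one, Matrix.mul_one, J_mul_J]
  inv_val := by rw [J_conj_mul, Units.inv_mul, Matrix.conjTranspose_one, Matrix.mul_one, J_mul_J]

theorem dualGL_inv {F : Type*} [Field F] [StarRing F] {m : ℕ} (g : GL (Fin m) F) :
    (((dualGL g)⁻¹ : GL (Fin m) F) : Matrix (Fin m) (Fin m) F) =
      J F m * (g : Matrix (Fin m) (Fin m) F).conjTranspose * J F m := rfl

/-- Third cell: isotropic vectors outside V^⊥, which is the set of vectors with vanishing last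
block. A Levi element brings the last block to a basis vector, and an Eichler transformation in the
parabolic does the rest. -/
theorem par_trans_lst {F : Type*} [Field F] [StarRing F] {n i j : ℕ} (h : i + j = n)
    (a : Fin i) {v : Fin (2 * n) → F} (hv : herm v v = 0) (h3 : v ∘ lst3 h ≠ 0) :
    ∃ p ∈ parU F h,
      ((p : GL (Fin (2 * n)) F) : Matrix _ _ F).mulVec (Pi.single (lst3 h a) 1) = v := by
  obtain ⟨b, hb⟩ := exists_gl_mulVec_eq (v := Pi.single a (1 : F)) (by simp) h3
  -- The Levi factor acts on the last block through g ↦ J (g*)⁻¹ J, so `dualGL b` is chosen to act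
  -- there as b.
  have hlev (w : Fin (2 * n) → F) (c : Fin i) : (((leviGrp h (dualGL b) 1 : U F (2 * n)) :
      GL (Fin (2 * n)) F) : Matrix _ _ F).mulVec w (lst3 h c) =
        (b : Matrix (Fin i) (Fin i) F).mulVec (w ∘ lst3 h) c :=
    (diag3_mulVec_lst3 h _ _ _ w c).trans (by rw [dualGL_inv, J_conj_J])
  set l := leviGrp h (dualGL b) (1 : U F (2 * j)) with hl
  set v' := (((l : GL (Fin (2 * n)) F)⁻¹ : GL (Fin (2 * n)) F) :
    Matrix (Fin (2 * n)) (Fin (2 * n)) F).mulVec v with hv'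
  have hlv : ((l : GL (Fin (2 * n)) F) : Matrix _ _ F).mulVec v' = v := mulVec_inv_mulVec _ _
  have h3' : v' ∘ lst3 h = Pi.single a 1 := by
    rw [← inv_mulVec_mulVec b (v' ∘ lst3 h), ← inv_mulVec_mulVec b (Pi.single a 1), hb]
    congr 1
    ext c
    rw [← hlev, hlv]
    rfl
  have hiso : herm v' v' = 0 := by rw [hv', herm_inv_mulVec, hv]
  have hva : v' (lst3 h a) = 1 := by
    have := congrFun h3' a
    simpa using this
  refine ⟨l * unitaryOfForm _ (eichler_form (rev_ne_self _) hiso hva),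
    mul_mem (leviGrp_mem h _ _) ?_, ?_⟩
  -- The Eichler matrix differs from the identity only in one column, whose index is in the last
  -- block, and one row, whose index is in the first block; both are harmless for block
  -- triangularity.
  · intro r c hrc
    show eichler (lst3 h a) v' r c = 0
    have hc : c ≠ lst3 h a := by
      rintro rfl
      rw [lab3_lst3] at hrc
      exact absurd (lab3_le_two h r) (not_le.2 hrc)
    have hr : r ≠ (lst3 h a).rev := by
      rintro rfl
      rw [rev_lst3, lab3_fst3] at hrc
      exact absurd hrc (Nat.not_lt_zero _)
    have hcr : r ≠ c := by
      rintro rfl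
      exact lt_irrefl _ hrc
    simp [eichler, hc, hr, hcr]
  · show (((l : GL (Fin (2 * n)) F) : Matrix (Fin (2 * n)) (Fin (2 * n)) F) *
      eichler (lst3 h a) v').mulVec _ = v
    rw [← Matrix.mulVec_mulVec, matrix_mulVec_single, eichler_col_self, hlv]

theorem herm_of_comp_lst3 {F : Type*} [Field F] [StarRing F] {n i j : ℕ} (h : i + j = n)
    {v : Fin (2 * n) → F} (h3 : v ∘ lst3 h = 0) : herm v v = herm (v ∘ mid3 h) (v ∘ mid3 h) := by
  have e (a : Fin i) : v (lst3 h a) = 0 := congrFun h3 a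
  rw [herm, sum3 h]
  simp [rev_fst3, rev_mid3, e, herm]

/-- Second cell: vectors of V^⊥ outside V. The middle block is normalised by the unitary Levi
factor, and the remaining first block is absorbed by an Eichler transformation. -/
theorem par_trans_mid {F : Type*} [Field F] [StarRing F] {n i j : ℕ} (h : i + j = n)
    (a : Fin (2 * j)) {v : Fin (2 * n) → F} (hv : herm v v = 0) (h3 : v ∘ lst3 h = 0)
    {b : U F (2 * j)} (hb : ((b : GL (Fin (2 * j)) F) : Matrix _ _ F).mulVec (Pi.single a 1) =
      v ∘ mid3 h) :
    ∃ p ∈ parU F h,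
      ((p : GL (Fin (2 * n)) F) : Matrix _ _ F).mulVec (Pi.single (mid3 h a) 1) = v := by
  have hlev (w : Fin (2 * n) → F) (c : Fin (2 * j)) : (((leviGrp h 1 b : U F (2 * n)) :
      GL (Fin (2 * n)) F) : Matrix _ _ F).mulVec w (mid3 h c) =
        ((b : GL (Fin (2 * j)) F) : Matrix _ _ F).mulVec (w ∘ mid3 h) c :=
    diag3_mulVec_mid3 h _ _ _ w c
  have hlev' (w : Fin (2 * n) → F) (c : Fin i) : (((leviGrp h 1 b : U F (2 * n)) :
      GL (Fin (2 * n)) F) : Matrix _ _ F).mulVec w (lst3 h c) = (w ∘ lst3 h) c :=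
    (diag3_mulVec_lst3 h _ _ _ w c).trans (by simp [J_mul_J])
  set l := leviGrp h (1 : GL (Fin i) F) b with hl
  set v' := (((l : GL (Fin (2 * n)) F)⁻¹ : GL (Fin (2 * n)) F) :
    Matrix (Fin (2 * n)) (Fin (2 * n)) F).mulVec v with hv'
  have hlv : ((l : GL (Fin (2 * n)) F) : Matrix _ _ F).mulVec v' = v := mulVec_inv_mulVec _ _
  have h2' : v' ∘ mid3 h = Pi.single a 1 := by
    rw [← inv_mulVec_mulVec (b : GL (Fin (2 * j)) F) (v' ∘ mid3 h),
      ← inv_mulVec_mulVec (b : GL (Fin (2 * j)) F) (Pi.single a 1), hb]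
    congr 1
    ext c
    rw [← hlev, hlv]
    rfl
  have h3' (c : Fin i) : v' (lst3 h c) = 0 := by
    have := hlev' v' c
    rw [hlv] at this
    exact this.symm.trans (congrFun h3 c)
  have hiso : herm v' v' = 0 := by rw [hv', herm_inv_mulVec, hv]
  have hva : v' (mid3 h a) = 1 := by
    have := congrFun h2' a
    simpa using this
  refine ⟨l * unitaryOfForm _ (eichler_form (rev_ne_self _) hiso hva),
    mul_mem (leviGrp_mem h _ _) ?_, ?_⟩
  · intro r c hrc
    show eichler (mid3 h a) v' r c = 0
    have hcr : r ≠ c := by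
      rintro rfl
      exact lt_irrefl _ hrc
    by_cases hc : c = mid3 h a
    · subst hc
      rw [lab3_mid3] at hrc
      rcases cases3 h r with ⟨d, rfl⟩ | ⟨d, rfl⟩ | ⟨d, rfl⟩
      · simp [lab3_fst3] at hrc
      · simp [lab3_mid3] at hrc
      · simp [eichler, h3']
    -- In this row, the entries in columns of the first block are conjugates, up to sign, of
    -- last-block coordinates of v', and these vanish.
    · by_cases hr : r = (mid3 h a).rev
      · subst hr
        rw [rev_mid3, lab3_mid3] at hrc
        rcases cases3 h c with ⟨d, rfl⟩ | ⟨d, rfl⟩ | ⟨d, rfl⟩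
        · simp [eichler, hc, hcr, rev_fst3, h3']
        · simp [lab3_mid3] at hrc
        · simp [lab3_lst3] at hrc
      · simp [eichler, hc, hr, hcr]
  · show (((l : GL (Fin (2 * n)) F) : Matrix (Fin (2 * n)) (Fin (2 * n)) F) *
      eichler (mid3 h a) v').mulVec _ = v
    rw [← Matrix.mulVec_mulVec, matrix_mulVec_single, eichler_col_self, hlv]

/-! ### Permutation matrices in the unitary group -/

/-- The permutation matrix `e_c ↦ e_{σ c}` of a permutation commuting with the reversal. -/
def permU (F : Type*) [Field F] [StarRing F] {m : ℕ} (σ : Equiv.Perm (Fin m))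
    (hσ : ∀ x, σ x.rev = (σ x).rev) : U F m :=
  unitaryOfForm (Matrix.of fun r c => (Pi.single (σ c) 1 : Fin m → F) r) (by
    ext r c
    rw [conjTranspose_mul_J_mul_apply]
    have e (c : Fin m) : (Matrix.of fun r c => (Pi.single (σ c) 1 : Fin m → F) r).col c =
      Pi.single (σ c) 1 := rfl
    rw [e, e, herm_single_left]
    simp [J, Pi.single_apply, ← hσ, eq_comm])

theorem permU_mulVec {F : Type*} [Field F] [StarRing F] {m : ℕ} (σ : Equiv.Perm (Fin m))
    (hσ : ∀ x, σ x.rev = (σ x).rev) (c : Fin m) :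
    ((permU F σ hσ : GL (Fin m) F) : Matrix (Fin m) (Fin m) F).mulVec (Pi.single c 1) =
      Pi.single (σ c) 1 := by
  rw [matrix_mulVec_single]
  rfl

theorem adU_inv_eq {F : Type*} [Field F] [StarRing F] {m : ℕ} (g : U F m) {X : uLie F m}
    {Y : Matrix (Fin m) (Fin m) F} (h : ((g : GL (Fin m) F) : Matrix (Fin m) (Fin m) F) * Y =
      (X : Matrix (Fin m) (Fin m) F) * ((g : GL (Fin m) F) : Matrix (Fin m) (Fin m) F)) :
    (adU g⁻¹ X : Matrix (Fin m) (Fin m) F) = Y := by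
  show (((g : GL (Fin m) F)⁻¹ : GL (Fin m) F) : Matrix (Fin m) (Fin m) F) * X *
    ((((g : GL (Fin m) F)⁻¹)⁻¹ : GL (Fin m) F) : Matrix (Fin m) (Fin m) F) = Y
  rw [inv_inv, Matrix.mul_assoc, ← h, ← Matrix.mul_assoc, Units.inv_mul, Matrix.one_mul]

theorem adU_permU_inv {F : Type*} [Field F] [StarRing F] {m : ℕ} (σ : Equiv.Perm (Fin m))
    (hσ : ∀ x, σ x.rev = (σ x).rev) (X : uLie F m) :
    (adU (permU F σ hσ)⁻¹ X : Matrix (Fin m) (Fin m) F) =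
      (X : Matrix (Fin m) (Fin m) F).submatrix σ σ := by
  refine adU_inv_eq _ ?_
  ext r c
  have e (r c : Fin m) : ((permU F σ hσ : GL (Fin m) F) : Matrix (Fin m) (Fin m) F) r c =
    (Pi.single (σ c) 1 : Fin m → F) r := rfl
  rw [Matrix.mul_apply, Matrix.mul_apply, Finset.sum_eq_single (σ.symm r),
    Finset.sum_eq_single (σ c)]
  · simp [e]
  · intro b _ hb
    simp [e, hb]
  · simp
  · intro b _ hb
    rw [e, Pi.single_eq_of_ne, zero_mul]
    rintro rfl
    simp at hb
  · simp

/-- The permutation exchanging the first and the last index. -/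
def swapEnds (n : ℕ) : Equiv.Perm (Fin (2 * (1 + n))) :=
  Equiv.swap (fst3 rfl (0 : Fin 1)) (lst3 rfl (0 : Fin 1))

theorem swapEnds_rev (n : ℕ) (x : Fin (2 * (1 + n))) :
    swapEnds n x.rev = (swapEnds n x).rev := by
  have e1 : (fst3 (rfl : 1 + n = 1 + n) (0 : Fin 1)).rev = lst3 rfl 0 := rev_fst3 _ _
  have e2 : (lst3 (rfl : 1 + n = 1 + n) (0 : Fin 1)).rev = fst3 rfl 0 := rev_lst3 _ _
  unfold swapEnds
  by_cases h1 : x = fst3 rfl (0 : Fin 1)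
  · rw [h1, e1, Equiv.swap_apply_left, Equiv.swap_apply_right, e2]
  by_cases h2 : x = lst3 rfl (0 : Fin 1)
  · rw [h2, e2, Equiv.swap_apply_left, Equiv.swap_apply_right, e1]
  rw [Equiv.swap_apply_of_ne_of_ne h1 h2, Equiv.swap_apply_of_ne_of_ne]
  · exact fun h => h2 (by rw [← e1, ← h, Fin.rev_rev])
  · exact fun h => h1 (by rw [← e2, ← h, Fin.rev_rev])

/-- The unitary group acts transitively on nonzero isotropic vectors. -/
theorem exists_unitary_mulVec_eq {F : Type*} [Field F] [StarRing F] {n : ℕ}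
    {v : Fin (2 * (1 + n)) → F} (hv0 : v ≠ 0) (hv : herm v v = 0) :
    ∃ g : U F (2 * (1 + n)), ((g : GL (Fin (2 * (1 + n))) F) : Matrix _ _ F).mulVec
      (Pi.single (fst3 (rfl : 1 + n = 1 + n) (0 : Fin 1)) 1) = v := by
  -- With an empty middle block V is maximal isotropic and V^⊥ = V, so only the first and third
  -- cells remain; swapping the two end vectors joins them.
  have h : (1 + n) + 0 = 1 + n := rfl
  have i0 : 0 < 1 + n := by omega
  have j0 : n < 1 + n := by omega
  have e1 : fst3 (rfl : 1 + n = 1 + n) (0 : Fin 1) = fst3 h ⟨0, i0⟩ := by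
    ext
    simp [fst3, eqv3]
  have e2 : lst3 (rfl : 1 + n = 1 + n) (0 : Fin 1) = lst3 h ⟨n, j0⟩ := by
    ext
    simp [lst3, eqv3]
    omega
  by_cases h3 : v ∘ lst3 h = 0
  · have h2 : v ∘ mid3 h = 0 := funext fun c => absurd c.2 (by simp)
    obtain ⟨p, -, hp⟩ := par_trans_fst h ⟨0, i0⟩ (v := v) (fun h1 => hv0 (ext3 h
      (congrFun h1) (congrFun h2) (congrFun h3))) h2 h3
    exact ⟨p, by rw [e1, hp]⟩
  · obtain ⟨p, -, hp⟩ := par_trans_lst h ⟨n, j0⟩ hv h3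
    refine ⟨p * permU F (swapEnds n) (swapEnds_rev n), ?_⟩
    show (((p : GL (Fin (2 * (1 + n))) F) :
      Matrix (Fin (2 * (1 + n))) (Fin (2 * (1 + n))) F) *
      ((permU F (swapEnds n) (swapEnds_rev n) : GL (Fin (2 * (1 + n))) F) :
        Matrix (Fin (2 * (1 + n))) (Fin (2 * (1 + n))) F)).mulVec _ = v
    rw [← Matrix.mulVec_mulVec, permU_mulVec, swapEnds, Equiv.swap_apply_left, e2, hp]

/-! ### Coset sums as sums over orbits -/

theorem card_mul_cosetSum {G : Type*} [Group G] [Fintype G] (P : Subgroup G) {D : G → ℝ}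
    (hD : ∀ g, ∀ p ∈ P, D (g * p) = D g) : (Nat.card P : ℝ) * cosetSum P D = ∑ g, D g := by
  classical
  have := Fintype.ofFinite (G ⧸ P)
  rw [cosetSum, finsum_eq_sum_of_fintype,
    ← Finset.sum_fiberwise (g := fun g : G => (g : G ⧸ P)), Finset.mul_sum]
  refine Finset.sum_congr rfl fun x _ => ?_
  have hcard : (Finset.univ.filter fun g : G => (g : G ⧸ P) = x).card = Nat.card P := by
    have := QuotientGroup.card_preimage_mk P {x}
    rw [show Nat.card ({x} : Set (G ⧸ P)) = 1 from Nat.card_unique, mul_one] at this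
    rw [← this, Nat.card_eq_fintype_card, Fintype.card_subtype]
    simp
  rw [← hcard, ← nsmul_eq_mul, ← Finset.sum_const]
  refine Finset.sum_congr rfl fun g hg => ?_
  obtain rfl := (Finset.mem_filter.1 hg).2
  obtain ⟨p, hp⟩ := QuotientGroup.mk_out_eq_mul P g
  rw [hp, hD _ _ p.2]

theorem sum_mul_cosetSum {G X : Type*} [Group G] [Finite G] [Fintype X] (P : Subgroup G)
    (w : X → ℝ) (k : X → G → ℝ) :
    ∑ x, w x * cosetSum P (k x) = cosetSum P fun g => ∑ x, w x * k x g := by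
  have := Fintype.ofFinite (G ⧸ P)
  simp only [cosetSum, finsum_eq_sum_of_fintype, Finset.mul_sum]
  exact Finset.sum_comm

/-- All fibres of `ev` over `S` have the same size m, so a sum over G is m times a sum over S, while
P has order m |T|. In the applications T is the set of nonzero multiples of one vector, which allows
summing over vectors rather than lines. -/
theorem card_mul_cosetSum_orbit {G V : Type*} [Group G] [Fintype G] (P : Subgroup G) (ev : G → V)
    (hact : ∀ k g g', ev g = ev g' → ev (k * g) = ev (k * g')) {S T : Finset V}
    (hS : ∀ v, v ∈ S ↔ ∃ g, ev g = v) (hT : T ⊆ S) (hP : ∀ g, g ∈ P ↔ ev g ∈ T) {Dh : V → ℝ}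
    (hD : ∀ g, ∀ p ∈ P, Dh (ev (g * p)) = Dh (ev g)) :
    (T.card : ℝ) * cosetSum P (fun g => Dh (ev g)) = ∑ v ∈ S, Dh v := by
  classical
  set m := (Finset.univ.filter fun g => ev g = ev 1).card with hm
  have hfib (v : V) (hv : v ∈ S) : (Finset.univ.filter fun g => ev g = v).card = m := by
    obtain ⟨k, rfl⟩ := (hS v).1 hv
    refine Finset.card_bij (fun g _ => k⁻¹ * g) (fun g hg => ?_) (fun g _ g' _ e => ?_)
      (fun g hg => ⟨k * g, ?_, ?_⟩)
    · simp only [Finset.mem_filter, Finset.mem_univ, true_and] at hg ⊢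
      rw [hact _ _ _ hg, inv_mul_cancel]
    · exact mul_left_cancel e
    · simp only [Finset.mem_filter, Finset.mem_univ, true_and] at hg ⊢
      rw [hact _ _ _ hg, mul_one]
    · rw [inv_mul_cancel_left]
  have hm0 : (m : ℝ) ≠ 0 := by
    rw [hm]
    exact Nat.cast_ne_zero.2 (Finset.card_ne_zero.2 ⟨1, by simp⟩)
  have h1 : ∑ g, Dh (ev g) = m * ∑ v ∈ S, Dh v := by
    rw [← Finset.sum_fiberwise_of_maps_to (s := Finset.univ) (t := S) (g := ev)
      (fun g _ => (hS _).2 ⟨g, rfl⟩), Finset.mul_sum]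
    refine Finset.sum_congr rfl fun v hv => ?_
    rw [← hfib v hv, ← nsmul_eq_mul, ← Finset.sum_const]
    refine Finset.sum_congr rfl fun g hg => ?_
    rw [(Finset.mem_filter.1 hg).2]
  have h2 : (Nat.card P : ℝ) = m * T.card := by
    have : Nat.card P = (Finset.univ.filter fun g => ev g ∈ T).card := by
      rw [Nat.card_eq_fintype_card, Fintype.card_subtype]
      congr 1
      ext g
      simp [hP]
    have hf := Finset.card_eq_sum_card_fiberwise (f := ev) (t := T)
      (s := Finset.univ.filter fun g => ev g ∈ T) (fun g hg => by simpa using hg)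
    rw [this, hf, Nat.cast_sum, mul_comm, ← nsmul_eq_mul, ← Finset.sum_const]
    refine Finset.sum_congr rfl fun v hv => ?_
    rw [← hfib v (hT hv), Finset.filter_filter]
    congr 2
    ext g
    simp only [Finset.mem_filter, Finset.mem_univ, true_and]
    exact ⟨fun h => h.2, fun h => ⟨h ▸ hv, h⟩⟩
  have h3 := card_mul_cosetSum P (D := fun g => Dh (ev g)) hD
  rw [h1, h2, mul_assoc] at h3
  exact mul_left_cancel₀ hm0 h3

open Classical in
/-- The nonzero multiples of a basis vector. -/
def lineOf (F : Type*) [Field F] [Fintype F] {m : ℕ} (a : Fin m) : Finset (Fin m → F) :=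
  (Finset.univ.filter fun c : F => c ≠ 0).image fun c => Pi.single a c

theorem card_lineOf (F : Type*) [Field F] [Fintype F] {m : ℕ} (a : Fin m) :
    (lineOf F a).card = Fintype.card F - 1 := by
  classical
  rw [lineOf, Finset.card_image_of_injective _ (Pi.single_injective a), Finset.filter_ne']
  simp [Finset.card_univ]

theorem mem_lineOf {F : Type*} [Field F] [Fintype F] {m : ℕ} {a : Fin m} {v : Fin m → F} :
    v ∈ lineOf F a ↔ v ≠ 0 ∧ ∀ r, r ≠ a → v r = 0 := by
  classical
  simp only [lineOf, Finset.mem_image, Finset.mem_filter, Finset.mem_univ, true_and]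
  constructor
  · rintro ⟨c, hc, rfl⟩
    exact ⟨by simpa using hc, fun r hr => by simp [hr]⟩
  · rintro ⟨hv, h⟩
    have e : Pi.single a (v a) = v := by
      ext r
      by_cases hr : r = a
      · subst hr; simp
      · simp [hr, h r hr]
    exact ⟨v a, fun h0 => hv (by rw [← e, h0, Pi.single_zero]), e⟩

open Classical in
/-- The nonzero isotropic vectors. -/
def isoVec (F : Type*) [Field F] [StarRing F] [Fintype F] (m : ℕ) : Finset (Fin m → F) :=
  Finset.univ.filter fun v => v ≠ 0 ∧ herm v v = 0

theorem mem_isoVec {F : Type*} [Field F] [StarRing F] [Fintype F] {m : ℕ} {v : Fin m → F} :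
    v ∈ isoVec F m ↔ v ≠ 0 ∧ herm v v = 0 := by
  simp [isoVec]

open Classical in
/-- The nonzero vectors. -/
def nzVec (F : Type*) [Field F] [Fintype F] (m : ℕ) : Finset (Fin m → F) :=
  Finset.univ.filter fun v => v ≠ 0

theorem mem_nzVec {F : Type*} [Field F] [Fintype F] {m : ℕ} {v : Fin m → F} :
    v ∈ nzVec F m ↔ v ≠ 0 := by
  simp [nzVec]

/-! ### Coset sums over lines -/

theorem cases2 {i j : ℕ} (x : Fin (i + j)) : (∃ a, x = fst2 i j a) ∨ (∃ a, x = snd2 i j a) := by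
  obtain ⟨y, rfl⟩ := finSumFinEquiv.surjective x
  rcases y with a | a
  · exact Or.inl ⟨a, rfl⟩
  · exact Or.inr ⟨a, rfl⟩

theorem lab2_fst2 {i j : ℕ} (a : Fin i) : lab2 i j (fst2 i j a) = 0 := by
  simp only [lab2, fst2, Equiv.symm_apply_apply, Sum.elim_inl]

theorem lab2_snd2 {i j : ℕ} (a : Fin j) : lab2 i j (snd2 i j a) = 1 := by
  simp only [lab2, snd2, Equiv.symm_apply_apply, Sum.elim_inr]

theorem snd2_ne_fst2 {i j : ℕ} (a : Fin i) (b : Fin j) : snd2 i j b ≠ fst2 i j a := by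
  intro h
  have := congrArg Fin.val h
  simp [fst2, snd2] at this
  omega

theorem blockTriangular_lab2_iff {F : Type*} [Field F] {n : ℕ}
    {M : Matrix (Fin (1 + n)) (Fin (1 + n)) F} :
    M.BlockTriangular (lab2 1 n) ↔ ∀ r, M (snd2 1 n r) (fst2 1 n 0) = 0 := by
  constructor
  · intro h r
    exact h (by rw [lab2_fst2, lab2_snd2]; exact Nat.zero_lt_one)
  · intro h r c hrc
    rcases cases2 r with ⟨a, rfl⟩ | ⟨a, rfl⟩ <;> rcases cases2 c with ⟨b, rfl⟩ | ⟨b, rfl⟩ <;>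
    simp only [lab2_fst2, lab2_snd2] at hrc
    · omega
    · omega
    · rw [Fin.eq_zero b, h]
    · omega

theorem mem_parGl_iff {F : Type*} [Field F] [Fintype F] {n : ℕ} (g : GL (Fin (1 + n)) F) :
    g ∈ parGl F 1 n ↔ (g : Matrix _ _ F).mulVec (Pi.single (fst2 1 n 0) 1) ∈
      lineOf F (fst2 1 n (0 : Fin 1)) := by
  refine blockTriangular_lab2_iff.trans ?_
  rw [mem_lineOf, matrix_mulVec_single]
  constructor
  · intro h
    refine ⟨?_, fun r hr => ?_⟩
    · rw [← matrix_mulVec_single]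
      exact mulVec_ne_zero g (by simp)
    · rcases cases2 r with ⟨a, rfl⟩ | ⟨a, rfl⟩
      · exact absurd (by rw [Fin.eq_zero a]) hr
      · exact h a
  · intro h r
    exact h.2 _ (snd2_ne_fst2 _ _)

theorem card_mul_cosetSum_parGl {F : Type*} [Field F] [Fintype F] (n : ℕ) :
    ((Fintype.card F - 1 : ℕ) : ℝ) * cosetSum (parGl F 1 n) (fun _ => 1) =
      (nzVec F (1 + n)).card := by
  have := card_mul_cosetSum_orbit (parGl F 1 n)
    (fun g => (g : Matrix _ _ F).mulVec (Pi.single (fst2 1 n 0) 1))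
    (fun k g g' h => by
      simp only [Units.val_mul, ← Matrix.mulVec_mulVec]
      exact congrArg _ h)
    (S := nzVec F (1 + n)) (T := lineOf F (fst2 1 n (0 : Fin 1)))
    (fun v => by
      rw [mem_nzVec]
      constructor
      · intro hv
        exact exists_gl_mulVec_eq (by simp) hv
      · rintro ⟨g, rfl⟩
        exact mulVec_ne_zero g (by simp))
    (fun v hv => mem_nzVec.2 (mem_lineOf.1 hv).1) mem_parGl_iff (Dh := fun _ => 1)
    (fun _ _ _ => rfl)
  rw [card_lineOf] at this
  simpa using this

/-- A unitary matrix that preserves the line of the first basis vector preserves its orthogonal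
complement too, hence the whole flag. -/
theorem mem_parU_iff {F : Type*} [Field F] [StarRing F] [Fintype F] {n : ℕ}
    (g : U F (2 * (1 + n))) :
    g ∈ parU F (rfl : 1 + n = 1 + n) ↔
      ((g : GL (Fin (2 * (1 + n))) F) :
        Matrix (Fin (2 * (1 + n))) (Fin (2 * (1 + n))) F).mulVec
        (Pi.single (fst3 (rfl : 1 + n = 1 + n) (0 : Fin 1)) 1) ∈
      lineOf F (fst3 (rfl : 1 + n = 1 + n) (0 : Fin 1)) := by
  rw [mem_lineOf]
  constructor
  · intro h
    refine ⟨mulVec_ne_zero _ (by simp), fun r hr => ?_⟩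
    rw [matrix_mulVec_single]
    refine h (i := r) ?_
    rw [lab3_fst3]
    rcases cases3 rfl r with ⟨a, rfl⟩ | ⟨a, rfl⟩ | ⟨a, rfl⟩
    · exact absurd (by rw [Fin.eq_zero a]) hr
    · simp [lab3_mid3]
    · simp [lab3_lst3]
  · rintro ⟨h0, h⟩
    set v := ((g : GL (Fin (2 * (1 + n))) F) :
        Matrix (Fin (2 * (1 + n))) (Fin (2 * (1 + n))) F).mulVec
        (Pi.single (fst3 (rfl : 1 + n = 1 + n) (0 : Fin 1)) 1) with hv
    set a0 := fst3 (rfl : 1 + n = 1 + n) (0 : Fin 1) with ha0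
    have hva : v a0 ≠ 0 := fun h1 => h0 (funext fun r => by
      by_cases hr : r = a0
      · rw [hr, h1]; rfl
      · exact h r hr)
    have hva' : v = Pi.single a0 (v a0) := by
      ext r
      by_cases hr : r = a0
      · rw [hr]; simp
      · simp [hr, h r hr]
    intro r c hrc
    by_cases hc : c = a0
    · subst hc
      have hr : r ≠ a0 := by
        rintro rfl
        exact lt_irrefl _ hrc
      have := h r hr
      rw [hv, matrix_mulVec_single] at this
      exact this
    · rcases cases3 rfl c with ⟨b, rfl⟩ | ⟨b, rfl⟩ | ⟨b, rfl⟩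
      · exact absurd (by rw [Fin.eq_zero b]) hc
      · rcases cases3 rfl r with ⟨a, rfl⟩ | ⟨a, rfl⟩ | ⟨a, rfl⟩
        · simp [lab3_fst3] at hrc
        · simp [lab3_mid3] at hrc
        -- Columns a0 and `mid3 b` of g stay orthogonal. As column a0 is a nonzero multiple of the
        -- first basis vector, their product is a nonzero scalar times the last entry of the other
        -- column.
        · have hherm := herm_mulVec g (Pi.single a0 1)
            (Pi.single (mid3 (rfl : 1 + n = 1 + n) b) 1)
          rw [← hv, hva', herm_single_left, herm_single_left, ha0, rev_fst3,
            Pi.single_eq_of_ne (mid3_ne_lst3 _ _ _).symm, mul_zero, matrix_mulVec_single] at hherm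
          rw [Fin.eq_zero a]
          exact (mul_eq_zero.1 hherm).resolve_left (by simpa using hva)
      · rw [lab3_lst3] at hrc
        exact absurd hrc (not_lt.2 (lab3_le_two rfl r))

/-- Cosets are isotropic lines, each with |F| - 1 nonzero vectors. -/
theorem card_mul_cosetSum_parU {F : Type*} [Field F] [StarRing F] [Fintype F] (n : ℕ)
    {Dh : (Fin (2 * (1 + n)) → F) → ℝ} {D : U F (2 * (1 + n)) → ℝ}
    (hDh : ∀ g, D g = Dh (((g : GL (Fin (2 * (1 + n))) F) :
        Matrix (Fin (2 * (1 + n))) (Fin (2 * (1 + n))) F).mulVec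
        (Pi.single (fst3 (rfl : 1 + n = 1 + n) (0 : Fin 1)) 1)))
    (hD : ∀ g, ∀ p ∈ parU F (rfl : 1 + n = 1 + n), D (g * p) = D g) :
    ((Fintype.card F - 1 : ℕ) : ℝ) * cosetSum (parU F (rfl : 1 + n = 1 + n)) D =
      ∑ v ∈ isoVec F (2 * (1 + n)), Dh v := by
  have := card_mul_cosetSum_orbit (parU F (rfl : 1 + n = 1 + n))
    (fun g => ((g : GL (Fin (2 * (1 + n))) F) :
        Matrix (Fin (2 * (1 + n))) (Fin (2 * (1 + n))) F).mulVec
      (Pi.single (fst3 (rfl : 1 + n = 1 + n) (0 : Fin 1)) 1))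
    (fun k g g' h => by
      simp only [Subgroup.coe_mul, Units.val_mul, ← Matrix.mulVec_mulVec]
      exact congrArg _ h)
    (S := isoVec F (2 * (1 + n))) (T := lineOf F (fst3 (rfl : 1 + n = 1 + n) (0 : Fin 1)))
    (fun v => by
      rw [mem_isoVec]
      constructor
      · rintro ⟨hv0, hv⟩
        exact exists_unitary_mulVec_eq hv0 hv
      · rintro ⟨g, rfl⟩
        refine ⟨mulVec_ne_zero _ (by simp), ?_⟩
        rw [herm_mulVec, herm_single_left, rev_fst3,
          Pi.single_eq_of_ne (fst3_ne_lst3 _ _ _).symm, mul_zero])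
    (fun v hv => by
      obtain ⟨hv0, hv⟩ := mem_lineOf.1 hv
      refine mem_isoVec.2 ⟨hv0, ?_⟩
      have e : v = Pi.single (fst3 (rfl : 1 + n = 1 + n) (0 : Fin 1)) (v (fst3 rfl 0)) := by
        ext r
        by_cases hr : r = fst3 rfl 0
        · rw [hr]; simp
        · simp [hr, hv r hr]
      rw [e, herm_single_left, rev_fst3, Pi.single_eq_of_ne (fst3_ne_lst3 _ _ _).symm, mul_zero])
    mem_parU_iff (Dh := Dh) (fun g p hp => by rw [← hDh, ← hDh, hD g p hp])
  rw [card_lineOf] at this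
  rw [← this]
  congr 2
  funext g
  exact hDh g

/-! ### Harmonicity in terms of densities -/

open Classical in
/-- The function on `𝔤𝔩(1 + n)` that evaluates `f` on the lower right block of the matrices whose
first column vanishes. -/
def colRes {F : Type*} [Field F] {n : ℕ} (f : Matrix (Fin n) (Fin n) F → ℝ)
    (X : Matrix (Fin (1 + n)) (Fin (1 + n)) F) : ℝ :=
  if ∀ r, X r (fst2 1 n 0) = 0 then f (X.submatrix (snd2 1 n) (snd2 1 n)) else 0

open Classical in
/-- The function on `𝔤𝔩(1 + n)` that evaluates `f` on the lower right block of the matrices whose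
first row vanishes. -/
def rowRes {F : Type*} [Field F] {n : ℕ} (f : Matrix (Fin n) (Fin n) F → ℝ)
    (X : Matrix (Fin (1 + n)) (Fin (1 + n)) F) : ℝ :=
  if ∀ c, X (fst2 1 n 0) c = 0 then f (X.submatrix (snd2 1 n) (snd2 1 n)) else 0

open Classical in
/-- The function on `𝔲(2 + 2n)` that evaluates `f` on the middle block of the matrices whose
first column vanishes. -/
def lineRes {F : Type*} [Field F] [StarRing F] {n : ℕ} (f : uLie F (2 * n) → ℝ)
    (W : uLie F (2 * (1 + n))) : ℝ :=
  if ∀ r, (W : Matrix (Fin (2 * (1 + n))) (Fin (2 * (1 + n))) F) r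
    (fst3 (rfl : 1 + n = 1 + n) (0 : Fin 1)) = 0 then f (midU rfl W) else 0

theorem orbInd_zero_apply {F : Type*} [Field F] (M : Matrix (Fin 1) (Fin 1) F) [Decidable (M = 0)] :
    (orbInd (glConj F 1) (Quotient.mk _ 0)).1 M = if M = 0 then 1 else 0 := by
  classical
  have : Quotient.mk (glConj F 1) M = Quotient.mk _ 0 ↔ M = 0 := by
    constructor
    · intro h
      obtain ⟨g, hg⟩ := Quotient.exact h.symm
      rw [← hg]
      simp
    · rintro rfl
      rfl
  simp only [orbInd, this]

/-- Block triangularity clears the first column below the corner, and the indicator of 0 clears the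
corner. -/
theorem extGl_x1 {F : Type*} [Field F] {n : ℕ} (f : CGl F n) :
    extGl F 1 n (extMul (glConj F 1) (glConj F n) (orbInd (glConj F 1) (Quotient.mk _ 0) ⊗ₜ f)).1 =
      colRes f.1 := by
  classical
  funext X
  unfold extGl colRes
  simp only [extMul_tmul, orbInd_zero_apply, blockTriangular_lab2_iff]
  by_cases h : ∀ r, X (snd2 1 n r) (fst2 1 n 0) = 0
  · rw [if_pos h]
    by_cases h0 : X.submatrix (fst2 1 n) (fst2 1 n) = 0
    · rw [if_pos h0, if_pos, one_mul]
      intro r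
      rcases cases2 r with ⟨a, rfl⟩ | ⟨a, rfl⟩
      · rw [Fin.eq_zero a]
        exact congrFun (congrFun h0 0) 0
      · exact h a
    · rw [if_neg h0, if_neg, zero_mul]
      intro h1
      refine h0 (Matrix.ext fun a b => ?_)
      rw [Fin.eq_zero b]
      exact h1 _
  · rw [if_neg h, if_neg fun h1 => h fun r => h1 _]

/-- The relation X* J + J X = 0 turns a vanishing first column into a vanishing last row. -/
theorem blockTriangular_of_col_eq_zero {F : Type*} [Field F] [StarRing F] {n : ℕ}
    {W : uLie F (2 * (1 + n))}
    (h : ∀ r, (W : Matrix (Fin (2 * (1 + n))) (Fin (2 * (1 + n))) F) r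
      (fst3 (rfl : 1 + n = 1 + n) (0 : Fin 1)) = 0) :
    (W : Matrix (Fin (2 * (1 + n))) (Fin (2 * (1 + n))) F).BlockTriangular
      (lab3 (rfl : 1 + n = 1 + n)) := by
  intro r c hrc
  rcases cases3 rfl c with ⟨b, rfl⟩ | ⟨b, rfl⟩ | ⟨b, rfl⟩
  · rw [Fin.eq_zero b]
    exact h r
  · rcases cases3 rfl r with ⟨a, rfl⟩ | ⟨a, rfl⟩ | ⟨a, rfl⟩
    · simp [lab3_fst3] at hrc
    · simp [lab3_mid3] at hrc
    · have := (mem_uLie_iff _).1 W.2 (fst3 (rfl : 1 + n = 1 + n) (0 : Fin 1)) (mid3 rfl b)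
      rw [h, star_zero, zero_add, rev_fst3] at this
      rw [Fin.eq_zero a]
      exact this
  · rw [lab3_lst3] at hrc
    exact absurd hrc (not_lt.2 (lab3_le_two rfl r))

theorem extU_x1 {F : Type*} [Field F] [StarRing F] {n : ℕ} (f : CU F (2 * n)) :
    extU F (rfl : 1 + n = 1 + n) (extMul (glConj F 1) (uConj F (2 * n))
      (orbInd (glConj F 1) (Quotient.mk _ 0) ⊗ₜ f)).1 = lineRes f.1 := by
  classical
  funext W
  unfold extU lineRes
  simp only [extMul_tmul, orbInd_zero_apply]
  by_cases h : ∀ r, (W : Matrix (Fin (2 * (1 + n))) (Fin (2 * (1 + n))) F) r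
      (fst3 (rfl : 1 + n = 1 + n) (0 : Fin 1)) = 0
  · rw [if_pos h, if_pos (blockTriangular_of_col_eq_zero h), if_pos, one_mul]
    refine Matrix.ext fun a b => ?_
    rw [Fin.eq_zero b]
    exact h _
  · rw [if_neg h]
    by_cases hB : (W : Matrix (Fin (2 * (1 + n))) (Fin (2 * (1 + n))) F).BlockTriangular
      (lab3 (rfl : 1 + n = 1 + n))
    · rw [if_pos hB, if_neg, zero_mul]
      refine fun h1 => h fun r => ?_
      rcases cases3 rfl r with ⟨a, rfl⟩ | ⟨a, rfl⟩ | ⟨a, rfl⟩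
      · rw [Fin.eq_zero a]
        exact congrFun (congrFun h1 0) 0
      · exact hB (by simp [lab3_fst3, lab3_mid3])
      · exact hB (by simp [lab3_fst3, lab3_lst3])
    · rw [if_neg hB]

theorem nablaA_x1 {F : Type*} [Field F] [Finite F] {n : ℕ} (f : CGl F n) :
    nablaA F (x1 F ⊗ₜ[ℝ] DirectSum.lof ℝ ℕ (fun n => CGl F n) n f) =
      DirectSum.lof ℝ ℕ (fun n => CGl F n) (1 + n) (indGl F 1 n (extMul (glConj F 1) (glConj F n)
        (orbInd (glConj F 1) (Quotient.mk _ 0) ⊗ₜ f))) := by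
  simp [nablaA, x1, DirectSum.toModule_lof]

theorem nablaB_x1 {F : Type*} [Field F] [Finite F] [StarRing F] {n : ℕ} (f : CU F (2 * n)) :
    nablaB F (x1 F ⊗ₜ[ℝ] DirectSum.lof ℝ ℕ (fun n => CU F (2 * n)) n f) =
      DirectSum.lof ℝ ℕ (fun n => CU F (2 * n)) (1 + n) (indU F (rfl : 1 + n = 1 + n)
        (extMul (glConj F 1) (uConj F (2 * n))
          (orbInd (glConj F 1) (Quotient.mk _ 0) ⊗ₜ f))) := by
  simp [nablaB, x1, DirectSum.toModule_lof]

theorem indU_x1_apply {F : Type*} [Field F] [Finite F] [StarRing F] {n : ℕ} (f : CU F (2 * n))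
    (W : uLie F (2 * (1 + n))) :
    (indU F (rfl : 1 + n = 1 + n) (extMul (glConj F 1) (uConj F (2 * n))
      (orbInd (glConj F 1) (Quotient.mk _ 0) ⊗ₜ f))).1 W =
        cosetSum (parU F (rfl : 1 + n = 1 + n)) fun g => lineRes f.1 (adU g⁻¹ W) := by
  rw [← extU_x1]
  rfl

theorem lineRes_conj {F : Type*} [Field F] [StarRing F] {n : ℕ} (f : CU F (2 * n))
    {p : U F (2 * (1 + n))} (hp : p ∈ parU F (rfl : 1 + n = 1 + n)) (W : uLie F (2 * (1 + n))) :
    lineRes f.1 (adU p W) = lineRes f.1 W := by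
  rw [← extU_x1, extU_conj _ _ _ p hp]

/-- Conjugation by an element of the general linear group. -/
def glConjEquiv {F : Type*} [Field F] {n : ℕ} (g : GL (Fin n) F) :
    Matrix (Fin n) (Fin n) F ≃ Matrix (Fin n) (Fin n) F where
  toFun X := ((g⁻¹ : GL (Fin n) F) : Matrix (Fin n) (Fin n) F) * X * g
  invFun X := (g : Matrix (Fin n) (Fin n) F) * X * (g⁻¹ : GL (Fin n) F)
  left_inv X := by
    simp only [Matrix.mul_assoc, Units.mul_inv, Matrix.mul_one]
    simp only [← Matrix.mul_assoc, Units.mul_inv, Matrix.one_mul]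
  right_inv X := by
    simp only [Matrix.mul_assoc, Units.inv_mul, Matrix.mul_one]
    simp only [← Matrix.mul_assoc, Units.inv_mul, Matrix.one_mul]

/-- The adjoint action of an element of the unitary group. -/
def adUEquiv {F : Type*} [Field F] [StarRing F] {m : ℕ} (g : U F m) : uLie F m ≃ uLie F m where
  toFun := adU g
  invFun := adU g⁻¹
  left_inv X := by rw [← adU_mul, inv_mul_cancel, adU_one]
  right_inv X := by rw [← adU_mul, mul_inv_cancel, adU_one]

/-- The density is conjugation invariant, so every coset in the parabolic induction contributes the
same amount; the number of cosets is the number of lines. -/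
theorem weightA_harm {F : Type*} [Field F] [Fintype F] {φ : A F →ₗ[ℝ] ℝ} (hφ : φ ∈ HarmA F)
    {n : ℕ} (f : CGl F n) :
    ((Fintype.card F - 1 : ℕ) : ℝ) * ∑ X, (weightA φ n).1 X * f.1 X =
      (nzVec F (1 + n)).card * ∑ X, (weightA φ (1 + n)).1 X * colRes f.1 X := by
  rw [← weightA_apply, hφ.2, nablaA_x1, weightA_apply]
  have e (X : Matrix (Fin (1 + n)) (Fin (1 + n)) F) :
      (indGl F 1 n (extMul (glConj F 1) (glConj F n)
        (orbInd (glConj F 1) (Quotient.mk _ 0) ⊗ₜ f))).1 X =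
      cosetSum (parGl F 1 n) fun g => colRes f.1 (glConjEquiv g X) := by
    rw [← extGl_x1]
    rfl
  simp only [e]
  rw [sum_mul_cosetSum]
  have e2 (g : GL (Fin (1 + n)) F) :
      ∑ X, (weightA φ (1 + n)).1 X * colRes f.1 (glConjEquiv g X) =
        (∑ X, (weightA φ (1 + n)).1 X * colRes f.1 X) * 1 := by
    rw [mul_one]
    refine Eq.trans ?_ ((glConjEquiv g).sum_comp fun X =>
      (weightA φ (1 + n)).1 X * colRes f.1 X)
    refine Finset.sum_congr rfl fun X _ => ?_
    rw [(weightA φ (1 + n)).2 X (glConjEquiv g X) ⟨g⁻¹, by rw [inv_inv]; rfl⟩]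
  simp only [e2]
  rw [cosetSum_smul, mul_left_comm, card_mul_cosetSum_parGl, mul_comm]

/-- Transposition exchanges the row and column conditions and fixes all invariant functions, because
a matrix is conjugate to its transpose. This form serves the isotropic vectors outside V^⊥. -/
theorem weightA_harm_row {F : Type*} [Field F] [Fintype F] {φ : A F →ₗ[ℝ] ℝ} (hφ : φ ∈ HarmA F)
    {n : ℕ} (f : CGl F n) :
    ((Fintype.card F - 1 : ℕ) : ℝ) * ∑ X, (weightA φ n).1 X * f.1 X =
      (nzVec F (1 + n)).card * ∑ X, (weightA φ (1 + n)).1 X * rowRes f.1 X := by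
  rw [weightA_harm hφ]
  congr 1
  refine Eq.trans ((Equiv.sum_comp (Function.Involutive.toPerm Matrix.transpose
    Matrix.transpose_transpose) fun X =>
      (weightA φ (1 + n)).1 X * colRes f.1 X).symm) ?_
  refine Finset.sum_congr rfl fun X _ => ?_
  change (weightA φ (1 + n)).1 X.transpose * colRes f.1 X.transpose = _
  rw [← (weightA φ (1 + n)).2 _ _ (glConj_transpose X)]
  congr 1
  simp only [colRes, rowRes, Matrix.transpose_apply]
  congr 1
  rw [← Matrix.transpose_submatrix]
  exact (f.2 _ _ (glConj_transpose _)).symm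

/-- As for `weightA_harm`, with isotropic lines in place of all lines. -/
theorem weightB_harm {F : Type*} [Field F] [StarRing F] [Fintype F] {ψ : B F →ₗ[ℝ] ℝ}
    (hψ : ψ ∈ HarmB F) {n : ℕ} (f : CU F (2 * n)) :
    ((Fintype.card F - 1 : ℕ) : ℝ) * ∑ Y, (weightB ψ n).1 Y * f.1 Y =
      (isoVec F (2 * (1 + n))).card * ∑ Y, (weightB ψ (1 + n)).1 Y * lineRes f.1 Y := by
  rw [← weightB_apply, hψ.2, nablaB_x1, weightB_apply]
  simp only [indU_x1_apply]
  rw [sum_mul_cosetSum]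
  have e2 (g : U F (2 * (1 + n))) :
      ∑ X, (weightB ψ (1 + n)).1 X * lineRes f.1 (adU g⁻¹ X) =
        (∑ X, (weightB ψ (1 + n)).1 X * lineRes f.1 X) * 1 := by
    rw [mul_one]
    refine Eq.trans ?_ ((adUEquiv g⁻¹).sum_comp fun X =>
      (weightB ψ (1 + n)).1 X * lineRes f.1 X)
    refine Finset.sum_congr rfl fun X _ => ?_
    rw [(weightB ψ (1 + n)).2 X (adUEquiv g⁻¹ X) ⟨g⁻¹, rfl⟩]
    rfl
  simp only [e2]
  rw [cosetSum_smul, mul_left_comm, card_mul_cosetSum_parU n (Dh := fun _ => 1) (fun _ => rfl)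
    (fun _ _ _ => rfl), Finset.sum_const, nsmul_eq_mul, mul_one, mul_comm]

/-! ### Parabolic restriction as a sum over the Lie algebra -/

theorem levi_fst_fst {F : Type*} [Field F] [StarRing F] {n i j : ℕ} (h : i + j = n)
    (X : Matrix (Fin i) (Fin i) F) (Y : uLie F (2 * j)) (a b : Fin i) :
    (levi h X Y : Matrix (Fin (2 * n)) (Fin (2 * n)) F) (fst3 h a) (fst3 h b) = X a b := by
  simp [levi, diag3, fst3]

theorem levi_mid_mid {F : Type*} [Field F] [StarRing F] {n i j : ℕ} (h : i + j = n)
    (X : Matrix (Fin i) (Fin i) F) (Y : uLie F (2 * j)) (a b : Fin (2 * j)) :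
    (levi h X Y : Matrix (Fin (2 * n)) (Fin (2 * n)) F) (mid3 h a) (mid3 h b) = Y.1 a b := by
  simp [levi, diag3, mid3]

theorem levi_lst_lst {F : Type*} [Field F] [StarRing F] {n i j : ℕ} (h : i + j = n)
    (X : Matrix (Fin i) (Fin i) F) (Y : uLie F (2 * j)) (a b : Fin i) :
    (levi h X Y : Matrix (Fin (2 * n)) (Fin (2 * n)) F) (lst3 h a) (lst3 h b) =
      -star (X b.rev a.rev) := by
  simp [levi, diag3, lst3, mul_J_apply, J_mul_apply]

theorem levi_of_lab_ne {F : Type*} [Field F] [StarRing F] {n i j : ℕ} (h : i + j = n)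
    (X : Matrix (Fin i) (Fin i) F) (Y : uLie F (2 * j)) {r c : Fin (2 * n)}
    (hrc : lab3 h r ≠ lab3 h c) :
    (levi h X Y : Matrix (Fin (2 * n)) (Fin (2 * n)) F) r c = 0 := by
  rcases cases3 h r with ⟨a, rfl⟩ | ⟨a, rfl⟩ | ⟨a, rfl⟩ <;>
  rcases cases3 h c with ⟨b, rfl⟩ | ⟨b, rfl⟩ | ⟨b, rfl⟩ <;>
  simp [lab3_fst3, lab3_mid3, lab3_lst3] at hrc <;>
  simp [levi, diag3, fst3, mid3, lst3]

theorem sub_levi_mem_nilU {F : Type*} [Field F] [StarRing F] {n i j : ℕ} (h : i + j = n)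
    {W : uLie F (2 * n)}
    (hW : (W : Matrix (Fin (2 * n)) (Fin (2 * n)) F).BlockTriangular (lab3 h)) :
    W - levi h ((W : Matrix (Fin (2 * n)) (Fin (2 * n)) F).submatrix (fst3 h) (fst3 h))
      (midU h W) ∈ nilU F h := by
  intro r c hrc
  show W.1 r c - (levi h _ _).1 r c = 0
  rcases hrc.lt_or_eq with hlt | heq
  · rw [hW hlt, levi_of_lab_ne h _ _ hlt.ne', sub_zero]
  · rcases cases3 h r with ⟨a, rfl⟩ | ⟨a, rfl⟩ | ⟨a, rfl⟩ <;>
    rcases cases3 h c with ⟨b, rfl⟩ | ⟨b, rfl⟩ | ⟨b, rfl⟩ <;>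
    simp [lab3_fst3, lab3_mid3, lab3_lst3] at heq
    · rw [levi_fst_fst]
      simp
    · rw [levi_mid_mid]
      simp [midU]
    · rw [levi_lst_lst, sub_neg_eq_add]
      have := (mem_uLie_iff _).1 W.2 (fst3 h a.rev) (lst3 h b)
      rw [rev_fst3, rev_lst3, Fin.rev_rev] at this
      rw [add_comm]
      exact this

theorem blockTriangular_levi_add {F : Type*} [Field F] [StarRing F] {n i j : ℕ} (h : i + j = n)
    (X : Matrix (Fin i) (Fin i) F) (Y : uLie F (2 * j)) (Z : nilU F h) :
    ((levi h X Y + Z.1 : uLie F (2 * n)) : Matrix (Fin (2 * n)) (Fin (2 * n)) F).BlockTriangular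
      (lab3 h) := by
  intro r c hrc
  show (levi h X Y).1 r c + Z.1.1 r c = 0
  rw [levi_of_lab_ne h X Y hrc.ne', Z.2 r c hrc.le, add_zero]

theorem levi_add_submatrix {F : Type*} [Field F] [StarRing F] {n i j : ℕ} (h : i + j = n)
    (X : Matrix (Fin i) (Fin i) F) (Y : uLie F (2 * j)) (Z : nilU F h) :
    ((levi h X Y + Z.1 : uLie F (2 * n)) : Matrix (Fin (2 * n)) (Fin (2 * n)) F).submatrix
      (fst3 h) (fst3 h) = X := by
  ext a b
  show (levi h X Y).1 _ _ + Z.1.1 _ _ = _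
  rw [levi_fst_fst, Z.2 _ _ (by simp [lab3_fst3]), add_zero]

theorem midU_levi_add {F : Type*} [Field F] [StarRing F] {n i j : ℕ} (h : i + j = n)
    (X : Matrix (Fin i) (Fin i) F) (Y : uLie F (2 * j)) (Z : nilU F h) :
    midU h (levi h X Y + Z.1) = Y := by
  refine Subtype.ext (Matrix.ext fun a b => ?_)
  show (levi h X Y).1 _ _ + Z.1.1 _ _ = _
  rw [levi_mid_mid, Z.2 _ _ (by simp [lab3_mid3]), add_zero]

/-- The parabolic subalgebra is the direct sum of the Levi subalgebra and the nilradical, and `extU`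
vanishes off it and depends only on the Levi part. -/
theorem sum_extU_mul {F : Type*} [Field F] [StarRing F] [Fintype F] {n i j : ℕ} (h : i + j = n)
    (Φ : Matrix (Fin i) (Fin i) F × uLie F (2 * j) → ℝ) (k : uLie F (2 * n) → ℝ) :
    ∑ W, extU F h Φ W * k W = ∑ X, ∑ Y, Φ (X, Y) * ∑ Z : nilU F h, k (levi h X Y + Z.1) := by
  simp only [Finset.mul_sum]
  rw [← Fintype.sum_prod_type', ← Fintype.sum_prod_type']
  symm
  refine Fintype.sum_of_injective (fun x : (Matrix (Fin i) (Fin i) F × uLie F (2 * j)) ×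
    nilU F h => levi h x.1.1 x.1.2 + x.2.1) ?_ _ _ (fun W hW => ?_) (fun x => ?_)
  · rintro ⟨⟨X, Y⟩, Z⟩ ⟨⟨X', Y'⟩, Z'⟩ e
    simp only at e
    have hX : X = X' := by rw [← levi_add_submatrix h X Y Z, e, levi_add_submatrix]
    have hY : Y = Y' := by rw [← midU_levi_add h X Y Z, e, midU_levi_add]
    subst hX hY
    have hZ := add_left_cancel e
    rw [Subtype.ext hZ]
  · have : ¬ (W : Matrix (Fin (2 * n)) (Fin (2 * n)) F).BlockTriangular (lab3 h) := by
      intro hB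
      exact hW ⟨((_, _), ⟨_, sub_levi_mem_nilU h hB⟩), add_sub_cancel _ _⟩
    rw [extU, if_neg this, zero_mul]
  · rw [extU, if_pos (blockTriangular_levi_add h _ _ _), levi_add_submatrix, midU_levi_add]

theorem card_nilU_ne_zero {F : Type*} [Field F] [StarRing F] [Fintype F] {n i j : ℕ}
    (h : i + j = n) : (Nat.card (nilU F h) : ℝ) ≠ 0 :=
  Nat.cast_ne_zero.2 Nat.card_pos.ne'

theorem card_mul_resUFun {F : Type*} [Field F] [StarRing F] [Fintype F] {n i j : ℕ}
    (h : i + j = n) (k : uLie F (2 * n) → ℝ) (X : Matrix (Fin i) (Fin i) F) (Y : uLie F (2 * j)) :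
    (Nat.card (nilU F h) : ℝ) * resUFun F h k (X, Y) = ∑ Z : nilU F h, k (levi h X Y + Z.1) := by
  rw [resUFun, mul_inv_cancel_left₀ (card_nilU_ne_zero h), finsum_eq_sum_of_fintype]

/-- The product density `(X, Y) ↦ u X * v Y`. -/
def prodFun {F : Type*} [Field F] [StarRing F] {i j : ℕ} (u : CGl F i) (v : CU F (2 * j)) :
    InvFun ((glConj F i).prod (uConj F (2 * j))) :=
  extMul _ _ (u ⊗ₜ v)

/-- Writes the pairing as a sum over the full Lie algebra, where the whole unitary group acts by
substitution. -/
theorem card_mul_resPair {F : Type*} [Field F] [StarRing F] [Fintype F] {n i j : ℕ}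
    (h : i + j = n) (u : CGl F i) (v : CU F (2 * j)) (k : uLie F (2 * n) → ℝ) :
    (Nat.card (nilU F h) : ℝ) * resPair h u v k = ∑ W, extU F h (prodFun u v).1 W * k W := by
  rw [sum_extU_mul, resPair, Finset.mul_sum]
  refine Finset.sum_congr rfl fun X _ => ?_
  rw [Finset.mul_sum]
  refine Finset.sum_congr rfl fun Y _ => ?_
  rw [mul_left_comm, card_mul_resUFun]
  rfl

/-! ### Restriction of an induced function as a sum over isotropic vectors -/

/-- The contribution of the double coset of `g` to the restriction of an induced function. -/
def mackeyTerm {F : Type*} [Field F] [StarRing F] [Fintype F] {n i j : ℕ} (h : i + j = 1 + n)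
    (u : CGl F i) (v : CU F (2 * j)) (f : CU F (2 * n)) (g : U F (2 * (1 + n))) : ℝ :=
  ∑ W, extU F h (prodFun u v).1 W * lineRes f.1 (adU g⁻¹ W)

theorem mackeyTerm_mul_left {F : Type*} [Field F] [StarRing F] [Fintype F] {n i j : ℕ}
    (h : i + j = 1 + n) (u : CGl F i) (v : CU F (2 * j)) (f : CU F (2 * n))
    {p : U F (2 * (1 + n))} (hp : p ∈ parU F h) (g : U F (2 * (1 + n))) :
    mackeyTerm h u v f (p * g) = mackeyTerm h u v f g := by
  unfold mackeyTerm
  refine Eq.trans ?_ ((adUEquiv p⁻¹).sum_comp fun W =>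
    extU F h (prodFun u v).1 W * lineRes f.1 (adU g⁻¹ W))
  refine Finset.sum_congr rfl fun W _ => ?_
  change _ = extU F h (prodFun u v).1 (adU p⁻¹ W) * lineRes f.1 (adU g⁻¹ (adU p⁻¹ W))
  rw [extU_conj F h _ _ (inv_mem hp), mul_inv_rev, adU_mul]

theorem mackeyTerm_mul_right {F : Type*} [Field F] [StarRing F] [Fintype F] {n i j : ℕ}
    (h : i + j = 1 + n) (u : CGl F i) (v : CU F (2 * j)) (f : CU F (2 * n))
    {p : U F (2 * (1 + n))} (hp : p ∈ parU F (rfl : 1 + n = 1 + n)) (g : U F (2 * (1 + n))) :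
    mackeyTerm h u v f (g * p) = mackeyTerm h u v f g := by
  unfold mackeyTerm
  refine Finset.sum_congr rfl fun W _ => ?_
  rw [mul_inv_rev, adU_mul, lineRes_conj f (inv_mem hp)]

/-- The first basis vector of the hermitian space. -/
def baseVec (F : Type*) [Field F] (n : ℕ) : Fin (2 * (1 + n)) → F :=
  Pi.single (fst3 (rfl : 1 + n = 1 + n) (0 : Fin 1)) 1

/-- The contribution of an isotropic vector to the restriction of an induced function. -/
def mackeyVec {F : Type*} [Field F] [StarRing F] [Fintype F] {n i j : ℕ} (h : i + j = 1 + n)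
    (u : CGl F i) (v : CU F (2 * j)) (f : CU F (2 * n)) (x : Fin (2 * (1 + n)) → F) : ℝ :=
  -- The default 0 plays no role: the vectors summed over are isotropic and nonzero, hence all in
  -- the orbit of `baseVec`.
  Function.extend (fun g : U F (2 * (1 + n)) => ((g : GL (Fin (2 * (1 + n))) F) :
    Matrix (Fin (2 * (1 + n))) (Fin (2 * (1 + n))) F).mulVec (baseVec F n))
    (mackeyTerm h u v f) (fun _ => 0) x

/-- Two group elements with the same image of `baseVec` differ on the right by an element of the
parabolic, under which `mackeyTerm` is invariant. -/
theorem mackeyVec_mulVec {F : Type*} [Field F] [StarRing F] [Fintype F] {n i j : ℕ}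
    (h : i + j = 1 + n) (u : CGl F i) (v : CU F (2 * j)) (f : CU F (2 * n))
    (g : U F (2 * (1 + n))) :
    mackeyVec h u v f (((g : GL (Fin (2 * (1 + n))) F) :
      Matrix (Fin (2 * (1 + n))) (Fin (2 * (1 + n))) F).mulVec (baseVec F n)) =
        mackeyTerm h u v f g := by
  refine Function.FactorsThrough.extend_apply (f := fun g : U F (2 * (1 + n)) =>
    ((g : GL (Fin (2 * (1 + n))) F) :
      Matrix (Fin (2 * (1 + n))) (Fin (2 * (1 + n))) F).mulVec (baseVec F n)) ?_ (fun _ => 0) g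
  intro g g' hgg
  have e : ((g⁻¹ * g' : U F (2 * (1 + n))) : GL (Fin (2 * (1 + n))) F).1.mulVec (baseVec F n) =
      baseVec F n := by
    show (((g : GL (Fin (2 * (1 + n))) F)⁻¹ : GL (Fin (2 * (1 + n))) F).1 *
      (g' : GL (Fin (2 * (1 + n))) F).1).mulVec (baseVec F n) = _
    rw [← Matrix.mulVec_mulVec]
    exact (congrArg _ hgg.symm).trans (inv_mulVec_mulVec _ _)
  have hp : g⁻¹ * g' ∈ parU F (rfl : 1 + n = 1 + n) := by
    rw [mem_parU_iff]
    change ((g⁻¹ * g' : U F (2 * (1 + n))) : GL (Fin (2 * (1 + n))) F).1.mulVec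
      (baseVec F n) ∈ _
    rw [e, mem_lineOf]
    exact ⟨by simp [baseVec], fun r hr => by simp [baseVec, hr]⟩
  have := mackeyTerm_mul_right h u v f hp g
  rw [mul_inv_cancel_left] at this
  exact this.symm

/-- Left invariance makes the contribution constant on the orbits of the restricting parabolic, so
one representative per cell suffices. -/
theorem mackeyVec_par_mulVec {F : Type*} [Field F] [StarRing F] [Fintype F] {n i j : ℕ}
    (h : i + j = 1 + n) (u : CGl F i) (v : CU F (2 * j)) (f : CU F (2 * n))
    {p : U F (2 * (1 + n))} (hp : p ∈ parU F h) (g : U F (2 * (1 + n))) :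
    mackeyVec h u v f (((p : GL (Fin (2 * (1 + n))) F) :
      Matrix (Fin (2 * (1 + n))) (Fin (2 * (1 + n))) F).mulVec (((g : GL (Fin (2 * (1 + n))) F) :
      Matrix (Fin (2 * (1 + n))) (Fin (2 * (1 + n))) F).mulVec (baseVec F n))) =
        mackeyTerm h u v f g := by
  rw [← mackeyTerm_mul_left h u v f hp, ← mackeyVec_mulVec, Matrix.mulVec_mulVec]
  rfl

/-- Interchanging the sum over the Lie algebra with the sum over cosets replaces the restriction of
an induced function by a sum over isotropic vectors. -/
theorem resPair_indU {F : Type*} [Field F] [StarRing F] [Fintype F] {n i j : ℕ}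
    (h : i + j = 1 + n) (u : CGl F i) (v : CU F (2 * j)) (f : CU F (2 * n)) :
    ((Fintype.card F - 1 : ℕ) : ℝ) * (Nat.card (nilU F h) * resPair h u v
      (indU F (rfl : 1 + n = 1 + n) (extMul (glConj F 1) (uConj F (2 * n))
        (orbInd (glConj F 1) (Quotient.mk _ 0) ⊗ₜ f))).1) =
      ∑ x ∈ isoVec F (2 * (1 + n)), mackeyVec h u v f x := by
  rw [card_mul_resPair]
  simp only [indU_x1_apply]
  rw [sum_mul_cosetSum, ← card_mul_cosetSum_parU n (D := mackeyTerm h u v f)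
    (fun g => (mackeyVec_mulVec h u v f g).symm)
    (fun g p hp => mackeyTerm_mul_right h u v f hp g)]
  rfl

/-! ### Averages over the nilradical -/

theorem card_mul_sum_comp {K L : Type*} [AddGroup K] [AddGroup L] [Fintype K] [Fintype L]
    (e : K →+ L) (he : Function.Surjective e) (f : L → ℝ) :
    (Nat.card L : ℝ) * ∑ k, f (e k) = Nat.card K * ∑ l, f l := by
  classical
  set c := (Finset.univ.filter fun k => e k = 0).card with hc
  have hfib (l : L) : (Finset.univ.filter fun k => e k = l).card = c :=
    AddMonoidHom.card_fiber_eq_of_mem_range e (he l) (he 0)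
  have h1 : ∑ k, f (e k) = c * ∑ l, f l := by
    rw [← Finset.sum_fiberwise (g := e), Finset.mul_sum]
    refine Finset.sum_congr rfl fun l _ => ?_
    rw [← hfib l, ← nsmul_eq_mul, ← Finset.sum_const]
    exact Finset.sum_congr rfl fun k hk => by rw [(Finset.mem_filter.1 hk).2]
  have h2 : Nat.card K = c * Nat.card L := by
    rw [Nat.card_eq_fintype_card, Nat.card_eq_fintype_card, ← Finset.card_univ,
      Finset.card_eq_sum_card_fiberwise (f := e) (t := Finset.univ) (fun _ _ => by simp),
      Finset.sum_congr rfl fun l _ => hfib l, Finset.sum_const, Finset.card_univ, smul_eq_mul,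
      mul_comm]
  rw [h1, h2]
  push_cast
  ring

/-- The elements of the nilradical whose column `a` vanishes. -/
def colKer (F : Type*) [Field F] [StarRing F] {n i j : ℕ} (h : i + j = n) (a : Fin (2 * n)) :
    AddSubgroup (nilU F h) where
  carrier := {Z | ∀ r, Z.1.1 r a = 0}
  zero_mem' := fun _ => rfl
  add_mem' := fun {Z Z'} hZ hZ' r => by
    show Z.1.1 r a + Z'.1.1 r a = 0
    rw [hZ r, hZ' r, add_zero]
  neg_mem' := fun {Z} hZ r => by
    show -Z.1.1 r a = 0
    rw [hZ r, neg_zero]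

instance {F : Type*} [Field F] [StarRing F] [Fintype F] {n i j : ℕ} (h : i + j = n)
    (a : Fin (2 * n)) : Fintype (colKer F h a) :=
  Fintype.ofFinite _

/-- The middle block, for `2 + 2n = 1 + 2n + 1`, after permuting the basis. -/
def permMid {F : Type*} [Field F] [StarRing F] {n : ℕ} (σ : Equiv.Perm (Fin (2 * (1 + n))))
    (hσ : ∀ x, σ x.rev = (σ x).rev) (W : uLie F (2 * (1 + n))) : uLie F (2 * n) :=
  midU rfl (adU (permU F σ hσ)⁻¹ W)

theorem permMid_apply {F : Type*} [Field F] [StarRing F] {n : ℕ}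
    (σ : Equiv.Perm (Fin (2 * (1 + n)))) (hσ : ∀ x, σ x.rev = (σ x).rev)
    (W : uLie F (2 * (1 + n))) (r c : Fin (2 * n)) :
    (permMid σ hσ W).1 r c = W.1 (σ (mid3 rfl r)) (σ (mid3 rfl c)) :=
  congrFun (congrFun (adU_permU_inv σ hσ W) (mid3 rfl r)) (mid3 rfl c)

theorem permMid_add {F : Type*} [Field F] [StarRing F] {n : ℕ}
    (σ : Equiv.Perm (Fin (2 * (1 + n)))) (hσ : ∀ x, σ x.rev = (σ x).rev)
    (W W' : uLie F (2 * (1 + n))) :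
    permMid σ hσ (W + W') = permMid σ hσ W + permMid σ hσ W' := by
  refine Subtype.ext (Matrix.ext fun r c => ?_)
  show _ = (permMid σ hσ W).1 r c + (permMid σ hσ W').1 r c
  rw [permMid_apply, permMid_apply, permMid_apply]
  rfl

theorem lineRes_permU {F : Type*} [Field F] [StarRing F] {n : ℕ}
    (σ : Equiv.Perm (Fin (2 * (1 + n)))) (hσ : ∀ x, σ x.rev = (σ x).rev)
    (f : uLie F (2 * n) → ℝ) (W : uLie F (2 * (1 + n)))
    [Decidable (∀ r, W.1 r (σ (fst3 rfl (0 : Fin 1))) = 0)] :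
    lineRes f (adU (permU F σ hσ)⁻¹ W) =
      if ∀ r, W.1 r (σ (fst3 rfl (0 : Fin 1))) = 0 then f (permMid σ hσ W) else 0 := by
  unfold lineRes
  have : (∀ r, (adU (permU F σ hσ)⁻¹ W).1 r (fst3 rfl (0 : Fin 1)) = 0) ↔
      ∀ r, W.1 r (σ (fst3 rfl (0 : Fin 1))) = 0 := by
    rw [adU_permU_inv]
    exact ⟨fun h r => by simpa using h (σ.symm r), fun h r => h (σ r)⟩
  simp only [this]
  rfl

/-- The middle block, as a map of nilradicals. -/
def nilMid {F : Type*} [Field F] [StarRing F] {n i j i' j' : ℕ} (h : i + j = 1 + n)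
    (h' : i' + j' = n) (σ : Equiv.Perm (Fin (2 * (1 + n)))) (hσ : ∀ x, σ x.rev = (σ x).rev)
    (hlab : ∀ x, lab3 h (σ (mid3 rfl x)) = lab3 h' x) (a : Fin (2 * (1 + n))) :
    colKer F h a →+ nilU F h' where
  toFun Z := ⟨permMid σ hσ Z.1.1, fun r c hrc => by
    rw [permMid_apply]
    exact Z.1.2 _ _ (by rw [hlab, hlab]; exact hrc)⟩
  map_zero' := by
    refine Subtype.ext (Subtype.ext (Matrix.ext fun r c => ?_))
    exact permMid_apply σ hσ _ r c
  map_add' Z Z' := Subtype.ext (permMid_add σ hσ _ _)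

/-- A preimage is obtained by bordering Z' with zeros and permuting the basis by σ; `hlab` keeps the
result strictly block triangular. -/
theorem nilMid_surjective {F : Type*} [Field F] [StarRing F] {n i j i' j' : ℕ} (h : i + j = 1 + n)
    (h' : i' + j' = n) (σ : Equiv.Perm (Fin (2 * (1 + n)))) (hσ : ∀ x, σ x.rev = (σ x).rev)
    (hlab : ∀ x, lab3 h (σ (mid3 rfl x)) = lab3 h' x) :
    Function.Surjective (nilMid (F := F) h h' σ hσ hlab (σ (fst3 rfl (0 : Fin 1)))) := by
  intro Z'
  set L : uLie F (2 * (1 + n)) := levi rfl (0 : Matrix (Fin 1) (Fin 1) F) Z'.1 with hL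
  set Z := adU (permU F σ hσ) L with hZ
  have hZL : adU (permU F σ hσ)⁻¹ Z = L := by rw [hZ, ← adU_mul, inv_mul_cancel, adU_one]
  have hent (x y : Fin (2 * (1 + n))) : Z.1 (σ x) (σ y) = L.1 x y := by
    rw [← hZL, adU_permU_inv]
    rfl
  have hL0 (x y : Fin (2 * (1 + n)))
      (hxy : ∀ a b, x = mid3 rfl a → y = mid3 rfl b → Z'.1.1 a b = 0) : L.1 x y = 0 := by
    by_cases hl : lab3 (rfl : 1 + n = 1 + n) x = lab3 (rfl : 1 + n = 1 + n) y
    · rcases cases3 rfl x with ⟨a, rfl⟩ | ⟨a, rfl⟩ | ⟨a, rfl⟩ <;>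
      rcases cases3 rfl y with ⟨b, rfl⟩ | ⟨b, rfl⟩ | ⟨b, rfl⟩ <;>
      simp only [lab3_fst3, lab3_mid3, lab3_lst3] at hl
      · rw [hL, levi_fst_fst]; rfl
      · omega
      · omega
      · omega
      · rw [hL, levi_mid_mid]
        exact hxy a b rfl rfl
      · omega
      · omega
      · omega
      · rw [hL, levi_lst_lst]; simp
    · exact levi_of_lab_ne _ _ _ hl
  have hmem : Z ∈ nilU F h := by
    intro r c hrc
    obtain ⟨x, rfl⟩ := σ.surjective r
    obtain ⟨y, rfl⟩ := σ.surjective c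
    rw [hent]
    refine hL0 x y ?_
    rintro a b rfl rfl
    rw [hlab, hlab] at hrc
    exact Z'.2 a b hrc
  refine ⟨⟨⟨Z, hmem⟩, fun r => ?_⟩, ?_⟩
  · obtain ⟨x, rfl⟩ := σ.surjective r
    show Z.1 _ _ = 0
    rw [hent]
    exact hL0 _ _ fun a b _ hb => absurd hb (fst3_ne_mid3 _ _ _)
  · refine Subtype.ext (Subtype.ext (Matrix.ext fun r c => ?_))
    show (permMid σ hσ Z).1 r c = _
    rw [permMid_apply, hent, hL, levi_mid_mid]

/-- The Levi subalgebra and the nilradical have disjoint supports, so no cancellation occurs between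
them. -/
theorem levi_add_col_iff {F : Type*} [Field F] [StarRing F] {n i j : ℕ} (h : i + j = n)
    (X : Matrix (Fin i) (Fin i) F) (Y : uLie F (2 * j)) (Z : nilU F h) (a : Fin (2 * n)) :
    (∀ r, (levi h X Y + Z.1 : uLie F (2 * n)).1 r a = 0) ↔
      (∀ r, (levi h X Y).1 r a = 0) ∧ Z ∈ colKer F h a := by
  constructor
  · intro hr
    have h1 : ∀ r, (levi h X Y).1 r a = 0 := by
      intro r
      by_cases hl : lab3 h r = lab3 h a
      · have := hr r
        change (levi h X Y).1 r a + Z.1.1 r a = 0 at this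
        rwa [Z.2 r a hl.ge, add_zero] at this
      · exact levi_of_lab_ne h X Y hl
    refine ⟨h1, fun r => ?_⟩
    have := hr r
    change (levi h X Y).1 r a + Z.1.1 r a = 0 at this
    rwa [h1, zero_add] at this
  · rintro ⟨h1, h2⟩ r
    show (levi h X Y).1 r a + Z.1.1 r a = 0
    rw [h1, h2 r, add_zero]

-- The contribution of one cell, at the representative σ. The vanishing of a column splits into a
-- condition on the Levi part and membership of Z in `colKer`; since `nilMid` maps `colKer` onto the
-- smaller nilradical with equal fibres, the sum over Z is a restriction of f in degree n. The maps
-- `rX` and `rY` delete the line from the Levi blocks.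
open Classical in
theorem mackeyTerm_permU {F : Type*} [Field F] [StarRing F] [Fintype F] {n i j i' j' : ℕ}
    (h : i + j = 1 + n) (h' : i' + j' = n) (u : CGl F i) (v : CU F (2 * j)) (f : CU F (2 * n))
    (σ : Equiv.Perm (Fin (2 * (1 + n)))) (hσ : ∀ x, σ x.rev = (σ x).rev)
    (hlab : ∀ x, lab3 h (σ (mid3 rfl x)) = lab3 h' x)
    (rX : Matrix (Fin i) (Fin i) F → Matrix (Fin i') (Fin i') F)
    (rY : uLie F (2 * j) → uLie F (2 * j'))
    (hr : ∀ X Y, permMid σ hσ (levi h X Y) = levi h' (rX X) (rY Y)) :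
    mackeyTerm h u v f (permU F σ hσ) =
      Nat.card (colKer F h (σ (fst3 rfl (0 : Fin 1)))) * ∑ X, ∑ Y, u.1 X * v.1 Y *
        if ∀ r, (levi h X Y).1 r (σ (fst3 rfl (0 : Fin 1))) = 0 then
          resUFun F h' f.1 (rX X, rY Y) else 0 := by
  unfold mackeyTerm
  rw [sum_extU_mul, Finset.mul_sum]
  refine Finset.sum_congr rfl fun X _ => ?_
  rw [Finset.mul_sum]
  refine Finset.sum_congr rfl fun Y _ => ?_
  rw [mul_left_comm]
  congr 1
  simp only [lineRes_permU, levi_add_col_iff]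
  by_cases hc : ∀ r, (levi h X Y).1 r (σ (fst3 rfl (0 : Fin 1))) = 0
  · rw [if_pos hc]
    simp only [hc, implies_true, true_and]
    rw [← mul_right_inj' (card_nilU_ne_zero (F := F) h'), mul_left_comm, card_mul_resUFun,
      ← card_mul_sum_comp _ (nilMid_surjective (F := F) h h' σ hσ hlab)
        (fun Z => f.1 (levi h' (rX X) (rY Y) + Z.1))]
    congr 1
    rw [← Finset.sum_filter]
    symm
    refine Finset.sum_bij (fun Z _ => Z.1) (fun Z _ => ?_) (fun Z _ Z' _ e => Subtype.ext e)
      (fun Z hZ => ⟨⟨Z, (Finset.mem_filter.1 hZ).2⟩, Finset.mem_univ _, rfl⟩) (fun Z _ => ?_)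
    · exact Finset.mem_filter.2 ⟨Finset.mem_univ _, Z.2⟩
    · rw [permMid_add, hr]
      rfl
  · rw [if_neg hc, mul_zero]
    simp [hc]

/-! ### Columns of elements of the nilradical -/

/-- The vectors that occur as columns with index `a` of elements of the nilradical. -/
def colImage (F : Type*) [Field F] [StarRing F] {n i j : ℕ} (h : i + j = n) (a : Fin (2 * n)) :
    AddSubgroup (Fin (2 * n) → F) where
  carrier := {x | (∀ r, lab3 h a ≤ lab3 h r → x r = 0) ∧ star (x a.rev) + x a.rev = 0}
  zero_mem' := ⟨fun _ _ => rfl, by simp⟩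
  add_mem' := fun {x y} hx hy => ⟨fun r hr => by simp [hx.1 r hr, hy.1 r hr], by
    simp only [Pi.add_apply, star_add]
    rw [add_add_add_comm, hx.2, hy.2, add_zero]⟩
  neg_mem' := fun {x} hx => ⟨fun r hr => by simp [hx.1 r hr], by
    simp only [Pi.neg_apply, star_neg]
    rw [← neg_add, hx.2, neg_zero]⟩

/-- The column `a` of an element of the nilradical. -/
def colHom (F : Type*) [Field F] [StarRing F] {n i j : ℕ} (h : i + j = n) (a : Fin (2 * n)) :
    nilU F h →+ colImage F h a where
  toFun Z := ⟨fun r => Z.1.1 r a, fun r hr => Z.2 r a hr, by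
    have := (mem_uLie_iff _).1 Z.1.2 a a
    exact this⟩
  map_zero' := rfl
  map_add' _ _ := rfl

theorem lab3_rev {n i j : ℕ} (h : i + j = n) (r : Fin (2 * n)) :
    lab3 h r.rev = 2 - lab3 h r := by
  rcases cases3 h r with ⟨a, rfl⟩ | ⟨a, rfl⟩ | ⟨a, rfl⟩
  · rw [rev_fst3, lab3_fst3, lab3_lst3]
  · rw [rev_mid3, lab3_mid3, lab3_mid3]
  · rw [rev_lst3, lab3_fst3, lab3_lst3]

/-- A column determines its mirror row in the Lie algebra. They meet only in the entry (a.rev, a),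
which produces the extra condition in `colImage`; otherwise the column is free. -/
theorem colHom_surjective {F : Type*} [Field F] [StarRing F] {n i j : ℕ} (h : i + j = n)
    (a : Fin (2 * n)) : Function.Surjective (colHom F h a) := by
  rintro ⟨x, hx, hxa⟩
  let N : Matrix (Fin (2 * n)) (Fin (2 * n)) F := Matrix.of fun r c =>
    if c = a then x r else if r = a.rev then -star (x c.rev) else 0
  have hN (r c : Fin (2 * n)) : N r c =
    if c = a then x r else if r = a.rev then -star (x c.rev) else 0 := rfl
  have e (r : Fin (2 * n)) : r.rev = a ↔ r = a.rev := by
    constructor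
    · rintro rfl; simp
    · rintro rfl; simp
  have e' (r : Fin (2 * n)) : r.rev = a.rev ↔ r = a := Fin.rev_injective.eq_iff
  have hu : N ∈ uLie F (2 * n) := by
    rw [mem_uLie_iff]
    intro r c
    rw [hN, hN]
    by_cases hr : r = a <;> by_cases hc : c = a
    · subst hr hc
      simpa using hxa
    · subst hr
      simp [hc]
    · subst hc
      simp [hr]
    · simp [hr, hc, e']
  have hn : (⟨N, hu⟩ : uLie F (2 * n)) ∈ nilU F h := by
    intro r c hrc
    show N r c = 0
    rw [hN]
    by_cases hc : c = a
    · subst hc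
      rw [if_pos rfl, hx r hrc]
    · rw [if_neg hc]
      by_cases hr : r = a.rev
      · subst hr
        rw [if_pos rfl, hx, star_zero, neg_zero]
        rw [lab3_rev] at hrc ⊢
        have := lab3_le_two h a
        have := lab3_le_two h c
        omega
      · rw [if_neg hr]
  refine ⟨⟨⟨N, hu⟩, hn⟩, Subtype.ext (funext fun r => ?_)⟩
  show N r a = x r
  rw [hN, if_pos rfl]

theorem ker_colHom {F : Type*} [Field F] [StarRing F] {n i j : ℕ} (h : i + j = n)
    (a : Fin (2 * n)) : (colHom F h a).ker = colKer F h a := by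
  ext Z
  rw [AddMonoidHom.mem_ker, Subtype.ext_iff, funext_iff]
  exact Iff.rfl

theorem card_nilU_eq {F : Type*} [Field F] [StarRing F] [Fintype F] {n i j : ℕ} (h : i + j = n)
    (a : Fin (2 * n)) :
    Nat.card (nilU F h) = Nat.card (colImage F h a) * Nat.card (colKer F h a) := by
  have e := Nat.card_congr (QuotientAddGroup.quotientKerEquivOfSurjective _
    (colHom_surjective (F := F) h a)).toEquiv
  have e2 := AddSubgroup.card_eq_card_quotient_mul_card_addSubgroup (colHom F h a).ker
  rw [e2, e, ker_colHom]

/-! ### Counting isotropic vectors -/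

theorem star_herm {F : Type*} [Field F] [StarRing F] {m : ℕ} (v w : Fin m → F) :
    star (herm v w) = herm w v := by
  rw [herm, herm, star_sum]
  refine (Equiv.sum_comp Fin.revPerm _).symm.trans ?_
  refine Finset.sum_congr rfl fun r _ => ?_
  simp [mul_comm]

theorem herm_of_lst3_eq_single {F : Type*} [Field F] [StarRing F] {n i j : ℕ} (h : i + j = n)
    {a : Fin i} {x : Fin (2 * n) → F} (hx : x ∘ lst3 h = Pi.single a 1) :
    herm x x = star (x (lst3 h a).rev) + x (lst3 h a).rev + herm (x ∘ mid3 h) (x ∘ mid3 h) := by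
  have e (b : Fin i) : x (lst3 h b) = (Pi.single a 1 : Fin i → F) b := congrFun hx b
  rw [herm, sum3 h, rev_lst3]
  simp only [rev_fst3, rev_mid3, rev_lst3, e]
  have e1 : ∑ b : Fin i, star (x (fst3 h b)) * (Pi.single a 1 : Fin i → F) b.rev =
      star (x (fst3 h a.rev)) := by
    rw [Finset.sum_eq_single a.rev]
    · simp
    · intro b _ hb
      rw [Pi.single_eq_of_ne, mul_zero]
      rintro rfl
      simp at hb
    · simp
  have e2 : ∑ b : Fin i, star ((Pi.single a 1 : Fin i → F) b) * x (fst3 h b.rev) =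
      x (fst3 h a.rev) := by
    rw [Finset.sum_eq_single a]
    · simp
    · intro b _ hb
      simp [hb]
    · simp
  rw [e1, e2]
  simp only [herm, Function.comp_apply]
  ring

/-- With last block e_a, isotropy reads t + star t = -(form of the middle block), where t is the
coordinate at `(lst3 h a).rev`. Adding half of that form to t turns this into the skew condition of
`colImage`. This is where 2 must be invertible. -/
theorem card_isoVec_lst_eq_single {F : Type*} [Field F] [StarRing F] (h2 : (2 : F) ≠ 0)
    {n i j : ℕ} (h : i + j = n) (a : Fin i) :
    Nat.card {x : Fin (2 * n) → F // herm x x = 0 ∧ x ∘ lst3 h = Pi.single a 1} =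
      Nat.card (colImage F h (lst3 h a)) := by
  let q (x : Fin (2 * n) → F) : F := herm (x ∘ mid3 h) (x ∘ mid3 h) / 2
  have hq (x : Fin (2 * n) → F) : star (q x) = q x := by
    simp only [q, star_div₀, star_herm, star_ofNat]
  have hq2 (x : Fin (2 * n) → F) : herm (x ∘ mid3 h) (x ∘ mid3 h) = q x + q x := by
    simp only [q]
    field_simp
    norm_num
  have hrev : (lst3 h a).rev = fst3 h a.rev := rev_lst3 h a
  have hne : fst3 h a.rev ≠ lst3 h a := fst3_ne_lst3 h _ _
  have hmid (x : Fin (2 * n) → F) (c d : F) :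
      (x + Pi.single (lst3 h a) c + Pi.single (fst3 h a.rev) d) ∘ mid3 h = x ∘ mid3 h := by
    ext b
    simp [mid3_ne_lst3, (fst3_ne_mid3 h _ b).symm]
  have hqq (x : Fin (2 * n) → F) (c d : F) :
      q (x + Pi.single (lst3 h a) c + Pi.single (fst3 h a.rev) d) = q x := by
    simp only [q, hmid]
  refine Nat.card_congr
    { toFun := fun x => ⟨x.1 + Pi.single (lst3 h a) (-1) + Pi.single (fst3 h a.rev) (q x.1), ?_, ?_⟩
      invFun := fun w => ⟨w.1 + Pi.single (lst3 h a) 1 + Pi.single (fst3 h a.rev) (-q w.1), ?_, ?_⟩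
      left_inv := fun x => Subtype.ext ?_
      right_inv := fun w => Subtype.ext ?_ }
  · intro r hr
    rw [lab3_lst3] at hr
    rcases cases3 h r with ⟨b, rfl⟩ | ⟨b, rfl⟩ | ⟨b, rfl⟩
    · simp [lab3_fst3] at hr
    · simp [lab3_mid3] at hr
    · have := congrFun x.2.2 b
      simp only [Function.comp_apply] at this
      simp only [Pi.add_apply, this, Pi.single_eq_of_ne (fst3_ne_lst3 h a.rev b).symm, add_zero]
      by_cases hb : b = a
      · subst hb; simp
      · simp [hb, (lst3_injective h).ne hb]
  · have := x.2.1
    rw [herm_of_lst3_eq_single h x.2.2, hrev, hq2] at this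
    rw [hrev]
    simp only [Pi.add_apply, Pi.single_eq_of_ne hne, Pi.single_eq_same, add_zero, star_add, hq]
    linear_combination this
  · have hl : (w.1 + Pi.single (lst3 h a) 1 + Pi.single (fst3 h a.rev) (-q w.1)) ∘ lst3 h =
        Pi.single a 1 := by
      ext b
      have hw : w.1 (lst3 h b) = 0 := w.2.1 _ (by rw [lab3_lst3, lab3_lst3])
      simp only [Function.comp_apply, Pi.add_apply, hw, zero_add,
        Pi.single_eq_of_ne (fst3_ne_lst3 h a.rev b).symm, add_zero]
      simp [Pi.single_apply, (lst3_injective h).eq_iff]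
    rw [herm_of_lst3_eq_single h hl, hmid, hq2, hrev]
    have := w.2.2
    rw [hrev] at this
    simp only [Pi.add_apply, Pi.single_eq_of_ne hne, Pi.single_eq_same, add_zero, star_add, hq,
      star_neg]
    linear_combination this
  · ext b
    have hw : w.1 (lst3 h b) = 0 := w.2.1 _ (by rw [lab3_lst3, lab3_lst3])
    simp only [Function.comp_apply, Pi.add_apply, hw, zero_add,
      Pi.single_eq_of_ne (fst3_ne_lst3 h a.rev b).symm, add_zero]
    simp [Pi.single_apply, (lst3_injective h).eq_iff]
  · simp only [hqq]
    simp only [Pi.single_neg]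
    abel
  · simp only [hqq]
    simp only [Pi.single_neg]
    abel

/-- The Levi factor permutes the nonzero last blocks transitively and preserves the form, so all
fibres have the size found for e_a. -/
theorem card_isoVec_lst_eq {F : Type*} [Field F] [StarRing F] (h2 : (2 : F) ≠ 0)
    {n i j : ℕ} (h : i + j = n) (a : Fin i) {z : Fin i → F} (hz : z ≠ 0) :
    Nat.card {x : Fin (2 * n) → F // herm x x = 0 ∧ x ∘ lst3 h = z} =
      Nat.card (colImage F h (lst3 h a)) := by
  rw [← card_isoVec_lst_eq_single h2 h a]
  obtain ⟨b, hb⟩ := exists_gl_mulVec_eq (v := Pi.single a (1 : F)) (by simp) hz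
  set l := leviGrp h (dualGL b) (1 : U F (2 * j)) with hl
  have hlev (w : Fin (2 * n) → F) : ((l : GL (Fin (2 * n)) F) :
      Matrix (Fin (2 * n)) (Fin (2 * n)) F).mulVec w ∘ lst3 h =
        (b : Matrix (Fin i) (Fin i) F).mulVec (w ∘ lst3 h) :=
    funext fun c => (diag3_mulVec_lst3 h _ _ _ w c).trans (by rw [dualGL_inv, J_conj_J])
  refine Nat.card_congr
    { toFun := fun x => ⟨(((l : GL (Fin (2 * n)) F)⁻¹ : GL (Fin (2 * n)) F) :
        Matrix (Fin (2 * n)) (Fin (2 * n)) F).mulVec x.1, ?_, ?_⟩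
      invFun := fun x => ⟨((l : GL (Fin (2 * n)) F) :
        Matrix (Fin (2 * n)) (Fin (2 * n)) F).mulVec x.1, ?_, ?_⟩
      left_inv := fun x => Subtype.ext (mulVec_inv_mulVec _ _)
      right_inv := fun x => Subtype.ext (inv_mulVec_mulVec _ _) }
  · rw [herm_inv_mulVec, x.2.1]
  · have e : (b : Matrix (Fin i) (Fin i) F).mulVec
        ((((l : GL (Fin (2 * n)) F)⁻¹ : GL (Fin (2 * n)) F) :
          Matrix (Fin (2 * n)) (Fin (2 * n)) F).mulVec x.1 ∘ lst3 h) =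
        (b : Matrix (Fin i) (Fin i) F).mulVec (Pi.single a 1) := by
      rw [hb, ← hlev, mulVec_inv_mulVec]
      exact x.2.2
    rw [← inv_mulVec_mulVec b (_ ∘ lst3 h), e, inv_mulVec_mulVec]
  · rw [herm_mulVec, x.2.1]
  · rw [hlev, x.2.2, hb]

open Classical in
theorem card_filter_lst {F : Type*} [Field F] [StarRing F] [Fintype F] (h2 : (2 : F) ≠ 0)
    {n i j : ℕ} (h : i + j = n) (a : Fin i) :
    ((isoVec F (2 * n)).filter fun x => x ∘ lst3 h ≠ 0).card =
      (nzVec F i).card * Nat.card (colImage F h (lst3 h a)) := by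
  rw [Finset.card_eq_sum_card_fiberwise (f := fun x => x ∘ lst3 h) (t := nzVec F i)
    (fun x hx => by simpa [mem_nzVec] using (Finset.mem_filter.1 hx).2)]
  refine (Finset.sum_congr rfl fun z hz => ?_).trans
    ((Finset.sum_const _).trans (smul_eq_mul _ _))
  rw [mem_nzVec] at hz
  rw [← card_isoVec_lst_eq h2 h a hz, Nat.card_eq_fintype_card, Fintype.card_subtype,
    Finset.filter_filter, isoVec, Finset.filter_filter]
  congr 1
  ext x
  simp only [Finset.mem_filter, Finset.mem_univ, true_and]
  constructor
  · rintro ⟨⟨-, hx⟩, -, rfl⟩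
    exact ⟨hx, rfl⟩
  · rintro ⟨hx, rfl⟩
    refine ⟨⟨?_, hx⟩, hz, rfl⟩
    rintro rfl
    exact hz rfl

/-- The extension by zero of a vector on the middle block. -/
def midExt {F : Type*} [Field F] {n i j : ℕ} (h : i + j = n) (y : Fin (2 * j) → F)
    (r : Fin (2 * n)) : F :=
  Sum.elim (fun _ => 0) (Sum.elim y (fun _ => 0)) ((eqv3 h).symm r)

theorem midExt_mid3 {F : Type*} [Field F] {n i j : ℕ} (h : i + j = n) (y : Fin (2 * j) → F)
    (a : Fin (2 * j)) : midExt h y (mid3 h a) = y a := by simp [midExt, mid3]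

theorem midExt_lst3 {F : Type*} [Field F] {n i j : ℕ} (h : i + j = n) (y : Fin (2 * j) → F)
    (a : Fin i) : midExt h y (lst3 h a) = 0 := by simp [midExt, lst3]

/-- Both sides count vectors supported on the first block: the reversal of a middle index is again a
middle index, so the skew condition in `colImage` is void. -/
theorem card_mid_eq {F : Type*} [Field F] [StarRing F] {n i j : ℕ} (h : i + j = n)
    (a : Fin (2 * j)) (y : Fin (2 * j) → F) :
    Nat.card {x : Fin (2 * n) → F // x ∘ lst3 h = 0 ∧ x ∘ mid3 h = y} =
      Nat.card (colImage F h (mid3 h a)) := by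
  refine Nat.card_congr
    { toFun := fun x => ⟨x.1 - midExt h y, ?_⟩
      invFun := fun w => ⟨w.1 + midExt h y, ?_⟩
      left_inv := fun x => Subtype.ext (sub_add_cancel _ _)
      right_inv := fun w => Subtype.ext (add_sub_cancel_right _ _) }
  · have hx : ∀ r, 1 ≤ lab3 h r → (x.1 - midExt h y) r = 0 := by
      intro r hr
      rcases cases3 h r with ⟨b, rfl⟩ | ⟨b, rfl⟩ | ⟨b, rfl⟩
      · simp [lab3_fst3] at hr
      · have := congrFun x.2.2 b
        simp only [Function.comp_apply] at this
        simp [midExt_mid3, this]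
      · have := congrFun x.2.1 b
        simp only [Function.comp_apply] at this
        simp [midExt_lst3, this]
    refine ⟨fun r hr => hx r (by rwa [lab3_mid3] at hr), ?_⟩
    rw [rev_mid3, hx _ (lab3_mid3 h _).ge]
    simp
  · constructor
    · ext b
      have : w.1 (lst3 h b) = 0 := w.2.1 _ (by rw [lab3_mid3, lab3_lst3]; norm_num)
      simp [midExt_lst3, this]
    · ext b
      have : w.1 (mid3 h b) = 0 := w.2.1 _ (by rw [lab3_mid3, lab3_mid3])
      simp [midExt_mid3, this]

open Classical in
theorem card_filter_mid {F : Type*} [Field F] [StarRing F] [Fintype F] {n i j : ℕ}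
    (h : i + j = n) (a : Fin (2 * j)) :
    ((isoVec F (2 * n)).filter fun x => x ∘ lst3 h = 0 ∧ x ∘ mid3 h ≠ 0).card =
      (isoVec F (2 * j)).card * Nat.card (colImage F h (mid3 h a)) := by
  rw [Finset.card_eq_sum_card_fiberwise (f := fun x => x ∘ mid3 h) (t := isoVec F (2 * j))
    (fun x hx => by
      rw [Finset.mem_coe, Finset.mem_filter, mem_isoVec] at hx
      rw [Finset.mem_coe, mem_isoVec]
      exact ⟨hx.2.2, by rw [← herm_of_comp_lst3 h hx.2.1, hx.1.2]⟩)]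
  refine (Finset.sum_congr rfl fun y hy => ?_).trans
    ((Finset.sum_const _).trans (smul_eq_mul _ _))
  rw [mem_isoVec] at hy
  rw [← card_mid_eq h a y, Nat.card_eq_fintype_card, Fintype.card_subtype,
    Finset.filter_filter, isoVec, Finset.filter_filter]
  congr 1
  ext x
  simp only [Finset.mem_filter, Finset.mem_univ, true_and]
  constructor
  · rintro ⟨-, ⟨hx, -⟩, rfl⟩
    exact ⟨hx, rfl⟩
  · rintro ⟨hx, rfl⟩
    refine ⟨⟨?_, ?_⟩, ⟨hx, hy.1⟩, rfl⟩
    · rintro rfl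
      exact hy.1 rfl
    · rw [herm_of_comp_lst3 h hx, hy.2]

-- Here `colImage` is trivial; the factor is kept so that the three counts have the shape required
-- by `sum_mackey_algebra`.
open Classical in
theorem card_filter_fst {F : Type*} [Field F] [StarRing F] [Fintype F] {n i j : ℕ}
    (h : i + j = n) (a : Fin i) :
    ((isoVec F (2 * n)).filter fun x => x ∘ lst3 h = 0 ∧ x ∘ mid3 h = 0).card =
      (nzVec F i).card * Nat.card (colImage F h (fst3 h a)) := by
  have h1 : Nat.card (colImage F h (fst3 h a)) = 1 := by
    rw [Nat.card_eq_one_iff_unique]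
    refine ⟨⟨fun x y => Subtype.ext (funext fun r => ?_)⟩, ⟨0⟩⟩
    rw [x.2.1 r (by rw [lab3_fst3]; exact Nat.zero_le _),
      y.2.1 r (by rw [lab3_fst3]; exact Nat.zero_le _)]
  rw [h1, mul_one]
  refine Finset.card_bij (fun x _ => x ∘ fst3 h) (fun x hx => ?_) (fun x hx y hy e => ?_)
    (fun z hz => ?_)
  · rw [Finset.mem_filter, mem_isoVec] at hx
    rw [mem_nzVec]
    exact fun h0 => hx.1.1 (ext3 h (congrFun h0) (congrFun hx.2.2) (congrFun hx.2.1))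
  · rw [Finset.mem_filter] at hx hy
    exact ext3 h (congrFun e) (congrFun (hx.2.2.trans hy.2.2.symm))
      (congrFun (hx.2.1.trans hy.2.1.symm))
  · rw [mem_nzVec] at hz
    let x (r : Fin (2 * n)) : F := Sum.elim z (fun _ => 0) ((eqv3 h).symm r)
    have e1 : x ∘ fst3 h = z := by
      ext b
      simp [x, fst3]
    have e2 : x ∘ mid3 h = 0 := by
      ext b
      simp [x, mid3]
    have e3 : x ∘ lst3 h = 0 := by
      ext b
      simp [x, lst3]
    refine ⟨x, ?_, e1⟩
    rw [Finset.mem_filter, mem_isoVec]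
    refine ⟨⟨?_, ?_⟩, e3, e2⟩
    · intro h0
      rw [h0] at e1
      exact hz e1.symm
    · rw [herm_of_comp_lst3 h e3, e2]
      simp [herm]

/-! ### The three contributions to the restriction of an induced function -/

/-- The restriction of `f`, as a function of the linear component. -/
def sliceX {F : Type*} [Field F] [Finite F] [StarRing F] {n i j : ℕ} (h : i + j = n)
    (f : CU F (2 * n)) (Y : uLie F (2 * j)) : CGl F i :=
  ⟨fun X => resUFun F h f.1 (X, Y), fun X X' hX =>
    (resU F h f).2 (X, Y) (X', Y) ⟨hX, (uConj F (2 * j)).refl Y⟩⟩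

/-- The restriction of `f`, as a function of the unitary component. -/
def sliceY {F : Type*} [Field F] [Finite F] [StarRing F] {n i j : ℕ} (h : i + j = n)
    (f : CU F (2 * n)) (X : Matrix (Fin i) (Fin i) F) : CU F (2 * j) :=
  ⟨fun Y => resUFun F h f.1 (X, Y), fun Y Y' hY =>
    (resU F h f).2 (X, Y) (X, Y') ⟨(glConj F i).refl X, hY⟩⟩

/-- Only the first two diagonal blocks need checking: the last one is determined by the first
through the Lie algebra relation, and the off-diagonal blocks vanish by `hlab`. -/
theorem permMid_levi {F : Type*} [Field F] [StarRing F] {n i j i' j' : ℕ} (h : i + j = 1 + n)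
    (h' : i' + j' = n) (σ : Equiv.Perm (Fin (2 * (1 + n)))) (hσ : ∀ x, σ x.rev = (σ x).rev)
    (hlab : ∀ x, lab3 h (σ (mid3 rfl x)) = lab3 h' x)
    {X : Matrix (Fin i) (Fin i) F} {Y : uLie F (2 * j)} {X' : Matrix (Fin i') (Fin i') F}
    {Y' : uLie F (2 * j')}
    (hX : ∀ a b, (levi h X Y).1 (σ (mid3 rfl (fst3 h' a))) (σ (mid3 rfl (fst3 h' b))) = X' a b)
    (hY : ∀ a b, (levi h X Y).1 (σ (mid3 rfl (mid3 h' a))) (σ (mid3 rfl (mid3 h' b))) = Y'.1 a b) :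
    permMid σ hσ (levi h X Y) = levi h' X' Y' := by
  refine Subtype.ext (Matrix.ext fun r c => ?_)
  by_cases hl : lab3 h' r = lab3 h' c
  · rcases cases3 h' r with ⟨a, rfl⟩ | ⟨a, rfl⟩ | ⟨a, rfl⟩ <;>
    rcases cases3 h' c with ⟨b, rfl⟩ | ⟨b, rfl⟩ | ⟨b, rfl⟩ <;>
    simp only [lab3_fst3, lab3_mid3, lab3_lst3] at hl
    · rw [permMid_apply, hX, levi_fst_fst]
    · omega
    · omega
    · omega
    · rw [permMid_apply, hY, levi_mid_mid]
    · omega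
    · omega
    · omega
    · have e := (mem_uLie_iff _).1 (permMid σ hσ (levi h X Y)).2 (fst3 h' a.rev) (lst3 h' b)
      rw [rev_fst3, rev_lst3, Fin.rev_rev] at e
      rw [eq_neg_of_add_eq_zero_right e, permMid_apply, hX, levi_lst_lst]
  · rw [permMid_apply, levi_of_lab_ne h X Y (by rwa [hlab, hlab]), levi_of_lab_ne h' X' Y' hl]

theorem levi_col_fst_iff {F : Type*} [Field F] [StarRing F] {n i j : ℕ} (h : i + j = n)
    (X : Matrix (Fin i) (Fin i) F) (Y : uLie F (2 * j)) (c : Fin i) :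
    (∀ r, (levi h X Y).1 r (fst3 h c) = 0) ↔ ∀ r, X r c = 0 := by
  constructor
  · intro hr r
    rw [← levi_fst_fst h X Y, hr]
  · intro hr r
    rcases cases3 h r with ⟨a, rfl⟩ | ⟨a, rfl⟩ | ⟨a, rfl⟩
    · rw [levi_fst_fst, hr]
    · exact levi_of_lab_ne h X Y (by simp [lab3_fst3, lab3_mid3])
    · exact levi_of_lab_ne h X Y (by simp [lab3_fst3, lab3_lst3])

theorem levi_col_mid_iff {F : Type*} [Field F] [StarRing F] {n i j : ℕ} (h : i + j = n)
    (X : Matrix (Fin i) (Fin i) F) (Y : uLie F (2 * j)) (c : Fin (2 * j)) :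
    (∀ r, (levi h X Y).1 r (mid3 h c) = 0) ↔ ∀ r, Y.1 r c = 0 := by
  constructor
  · intro hr r
    rw [← levi_mid_mid h X Y, hr]
  · intro hr r
    rcases cases3 h r with ⟨a, rfl⟩ | ⟨a, rfl⟩ | ⟨a, rfl⟩
    · exact levi_of_lab_ne h X Y (by simp [lab3_fst3, lab3_mid3])
    · rw [levi_mid_mid, hr]
    · exact levi_of_lab_ne h X Y (by simp [lab3_mid3, lab3_lst3])

/-- The last block is -J X* J, so its columns are reversed conjugate rows of X up to sign. This is
why the cell outside V^⊥ involves rows. -/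
theorem levi_col_lst_iff {F : Type*} [Field F] [StarRing F] {n i j : ℕ} (h : i + j = n)
    (X : Matrix (Fin i) (Fin i) F) (Y : uLie F (2 * j)) (c : Fin i) :
    (∀ r, (levi h X Y).1 r (lst3 h c.rev) = 0) ↔ ∀ r, X c r = 0 := by
  constructor
  · intro hr r
    have := hr (lst3 h r.rev)
    rw [levi_lst_lst, Fin.rev_rev, Fin.rev_rev] at this
    simpa using this
  · intro hr r
    rcases cases3 h r with ⟨a, rfl⟩ | ⟨a, rfl⟩ | ⟨a, rfl⟩
    · exact levi_of_lab_ne h X Y (by simp [lab3_fst3, lab3_lst3])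
    · exact levi_of_lab_ne h X Y (by simp [lab3_mid3, lab3_lst3])
    · rw [levi_lst_lst, Fin.rev_rev, hr]
      simp

theorem mackeyVec_eq {F : Type*} [Field F] [StarRing F] [Fintype F] {n i j : ℕ}
    (h : i + j = 1 + n) (u : CGl F i) (v : CU F (2 * j)) (f : CU F (2 * n))
    (σ : Equiv.Perm (Fin (2 * (1 + n)))) (hσ : ∀ x, σ x.rev = (σ x).rev)
    {a : Fin (2 * (1 + n))} (ha : σ (fst3 rfl (0 : Fin 1)) = a) {x : Fin (2 * (1 + n)) → F}
    (hx : ∃ p ∈ parU F h, ((p : GL (Fin (2 * (1 + n))) F) :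
      Matrix (Fin (2 * (1 + n))) (Fin (2 * (1 + n))) F).mulVec (Pi.single a 1) = x) :
    mackeyVec h u v f x = mackeyTerm h u v f (permU F σ hσ) := by
  obtain ⟨p, hp, rfl⟩ := hx
  rw [← ha, ← mackeyVec_par_mulVec h u v f hp, baseVec, permU_mulVec]

/-- N is the size of a cell, M the number of vectors in its block, I and K the orders of `colImage`
and `colKer`, U the order of the nilradical, c = |F| - 1, S the Levi sum and R the smaller pairing.
The relation `hS` is harmonicity; the factors I and K match on both sides. -/
theorem sum_mackey_algebra {N M I K U c S R : ℝ} (hN : N = M * I) (hU : U = I * K)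
    (hS : M * S = c * R) : N * (K * S) = c * (U * R) := by
  rw [hN, hU]
  linear_combination I * K * hS

theorem mul_sum_sum_mul {X Y : Type*} [Fintype X] [Fintype Y] (u : X → ℝ) (v : Y → ℝ)
    (k : X → Y → ℝ) (M : ℝ) :
    M * ∑ x, ∑ y, u x * v y * k x y = ∑ y, v y * (M * ∑ x, u x * k x y) := by
  rw [Finset.sum_comm]
  simp only [Finset.mul_sum]
  exact Finset.sum_congr rfl fun y _ => Finset.sum_congr rfl fun x _ => by ring

theorem sum_sum_mul_congr {X X' Y : Type*} [Fintype X] [Fintype X'] [Fintype Y] {u : X → ℝ}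
    {u' : X' → ℝ} {v : Y → ℝ} {k : X → Y → ℝ} {k' : X' → Y → ℝ} {M c : ℝ}
    (hk : ∀ y, M * ∑ x, u x * k x y = c * ∑ x, u' x * k' x y) :
    M * ∑ x, ∑ y, u x * v y * k x y = c * ∑ x, ∑ y, u' x * v y * k' x y := by
  rw [mul_sum_sum_mul, mul_sum_sum_mul]
  exact Finset.sum_congr rfl fun y _ => by rw [hk]

/-! ### Compatibility of the block decompositions before and after deleting the end indices. -/

section

variable {n i j : ℕ}

theorem idx_fst (h : (1 + i) + j = 1 + n) :
    fst3 (rfl : 1 + n = 1 + n) (0 : Fin 1) = fst3 h (fst2 1 i 0) := by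
  ext
  simp [fst3, eqv3, fst2]

theorem idx_mid_fst (h : (1 + i) + j = 1 + n) (h' : i + j = n) (a : Fin i) :
    mid3 (rfl : 1 + n = 1 + n) (fst3 h' a) = fst3 h (snd2 1 i a) := by
  ext
  simp [fst3, mid3, eqv3, snd2]

theorem idx_mid_mid (h : (1 + i) + j = 1 + n) (h' : i + j = n) (a : Fin (2 * j)) :
    mid3 (rfl : 1 + n = 1 + n) (mid3 h' a) = mid3 h a := by
  ext
  simp [mid3, eqv3]
  omega

theorem idx_mid_lst (h : (1 + i) + j = 1 + n) (h' : i + j = n) (a : Fin i) :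
    mid3 (rfl : 1 + n = 1 + n) (lst3 h' a) = lst3 h (snd2 1 i a.rev).rev := by
  rw [← rev_fst3, ← idx_mid_fst h h', rev_mid3, rev_fst3, Fin.rev_rev]

theorem lab3_mid (h : (1 + i) + j = 1 + n) (h' : i + j = n) (x : Fin (2 * n)) :
    lab3 h (mid3 (rfl : 1 + n = 1 + n) x) = lab3 h' x := by
  rcases cases3 h' x with ⟨a, rfl⟩ | ⟨a, rfl⟩ | ⟨a, rfl⟩
  · rw [idx_mid_fst h h', lab3_fst3, lab3_fst3]
  · rw [idx_mid_mid h h', lab3_mid3, lab3_mid3]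
  · rw [idx_mid_lst h h', lab3_lst3, lab3_lst3]

end

-- Cell inside V, represented by the identity. The line is spanned by the first vector of the linear
-- block, and the column form of harmonicity of φ, applied to each slice `sliceX`, lowers i by one.
open Classical in
theorem sum_mackeyVec_fst {F : Type*} [Field F] [StarRing F] [Fintype F] {n i j : ℕ}
    (h : (1 + i) + j = 1 + n) (h' : i + j = n) {φ : A F →ₗ[ℝ] ℝ} (hφ : φ ∈ HarmA F)
    (v : CU F (2 * j)) (f : CU F (2 * n)) :
    ∑ x ∈ (isoVec F (2 * (1 + n))).filter fun x => x ∘ lst3 h = 0 ∧ x ∘ mid3 h = 0,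
      mackeyVec h (weightA φ (1 + i)) v f x =
    ((Fintype.card F - 1 : ℕ) : ℝ) * (Nat.card (nilU F h) * resPair h' (weightA φ i) v f.1) := by
  have ha := idx_fst h
  have hc (x) (hx : x ∈ (isoVec F (2 * (1 + n))).filter
      fun x => x ∘ lst3 h = 0 ∧ x ∘ mid3 h = 0) :
      mackeyVec h (weightA φ (1 + i)) v f x =
        mackeyTerm h (weightA φ (1 + i)) v f (permU F (Equiv.refl _) fun _ => rfl) := by
    rw [Finset.mem_filter, mem_isoVec] at hx
    refine mackeyVec_eq h _ v f _ _ ha (par_trans_fst h _ (fun h1 => hx.1.1 ?_) hx.2.2 hx.2.1)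
    exact ext3 h (congrFun h1) (congrFun hx.2.2) (congrFun hx.2.1)
  rw [Finset.sum_congr rfl hc, Finset.sum_const, nsmul_eq_mul,
    mackeyTerm_permU h h' _ v f (Equiv.refl _) (fun _ => rfl) (lab3_mid h h')
      (fun X => X.submatrix (snd2 1 i) (snd2 1 i)) id (fun X Y => permMid_levi h h' _ _
        (lab3_mid h h') (fun a b => by
          simp only [Equiv.refl_apply, idx_mid_fst h h', levi_fst_fst, Matrix.submatrix_apply])
        (fun a b => by
          simp only [Equiv.refl_apply, idx_mid_mid h h', levi_mid_mid, id_eq]))]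
  simp only [Equiv.refl_apply, ha, levi_col_fst_iff, id_eq]
  refine sum_mackey_algebra (M := (nzVec F (1 + i)).card)
    (I := Nat.card (colImage F h (fst3 h (fst2 1 i 0)))) ?_ ?_ ?_
  · rw [card_filter_fst h (fst2 1 i 0), Nat.cast_mul]
  · rw [card_nilU_eq h (fst3 h (fst2 1 i 0)), Nat.cast_mul]
  · refine sum_sum_mul_congr fun Y => Eq.trans (congrArg _ (Finset.sum_congr rfl fun X _ => ?_))
      (weightA_harm hφ (sliceX h' f Y)).symm
    unfold colRes
    congr

theorem swapEnds_mid {n : ℕ} (x : Fin (2 * n)) :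
    swapEnds n (mid3 rfl x) = mid3 (rfl : 1 + n = 1 + n) x :=
  Equiv.swap_apply_of_ne_of_ne (fst3_ne_mid3 _ _ _).symm (mid3_ne_lst3 _ _ _)

-- Cell outside V^⊥, represented by the swap of the two ends. It deletes the same pair of indices as
-- the cell inside V, but the condition falls on a row of X, so the row form of harmonicity gives
-- the same value.
open Classical in
theorem sum_mackeyVec_lst {F : Type*} [Field F] [StarRing F] [Fintype F] (h2 : (2 : F) ≠ 0)
    {n i j : ℕ} (h : (1 + i) + j = 1 + n) (h' : i + j = n) {φ : A F →ₗ[ℝ] ℝ} (hφ : φ ∈ HarmA F)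
    (v : CU F (2 * j)) (f : CU F (2 * n)) :
    ∑ x ∈ (isoVec F (2 * (1 + n))).filter fun x => x ∘ lst3 h ≠ 0,
      mackeyVec h (weightA φ (1 + i)) v f x =
    ((Fintype.card F - 1 : ℕ) : ℝ) * (Nat.card (nilU F h) * resPair h' (weightA φ i) v f.1) := by
  have ha : swapEnds n (fst3 rfl (0 : Fin 1)) = lst3 h (fst2 1 i 0).rev := by
    rw [swapEnds, Equiv.swap_apply_left, ← rev_fst3, ← idx_fst h, rev_fst3]
    rfl
  have hlab (x : Fin (2 * n)) : lab3 h (swapEnds n (mid3 rfl x)) = lab3 h' x := by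
    rw [swapEnds_mid, lab3_mid h h']
  have hc (x) (hx : x ∈ (isoVec F (2 * (1 + n))).filter fun x => x ∘ lst3 h ≠ 0) :
      mackeyVec h (weightA φ (1 + i)) v f x =
        mackeyTerm h (weightA φ (1 + i)) v f (permU F (swapEnds n) (swapEnds_rev n)) := by
    rw [Finset.mem_filter, mem_isoVec] at hx
    exact mackeyVec_eq h _ v f _ _ ha (par_trans_lst h _ hx.1.2 hx.2)
  rw [Finset.sum_congr rfl hc, Finset.sum_const, nsmul_eq_mul,
    mackeyTerm_permU h h' _ v f (swapEnds n) (swapEnds_rev n) hlab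
      (fun X => X.submatrix (snd2 1 i) (snd2 1 i)) id (fun X Y => permMid_levi h h' _ _
        hlab (fun a b => by
          rw [swapEnds_mid, swapEnds_mid, idx_mid_fst h h', idx_mid_fst h h', levi_fst_fst]
          rfl)
        (fun a b => by
          rw [swapEnds_mid, swapEnds_mid, idx_mid_mid h h', idx_mid_mid h h', levi_mid_mid]
          rfl))]
  simp only [ha, levi_col_lst_iff, id_eq]
  refine sum_mackey_algebra (M := (nzVec F (1 + i)).card)
    (I := Nat.card (colImage F h (lst3 h (fst2 1 i 0).rev))) ?_ ?_ ?_
  · rw [card_filter_lst h2 h (fst2 1 i 0).rev, Nat.cast_mul]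
  · rw [card_nilU_eq h (lst3 h (fst2 1 i 0).rev), Nat.cast_mul]
  · refine sum_sum_mul_congr fun Y => Eq.trans (congrArg _ (Finset.sum_congr rfl fun X _ => ?_))
      (weightA_harm_row hφ (sliceX h' f Y)).symm
    unfold rowRes
    congr

/-! ### The cell of vectors in V^⊥ outside V. -/

/-- The inclusion `i + 2j + i → i + (2 + 2j) + i` avoiding the ends of the middle block. -/
def skipMid {n i j : ℕ} (h : i + (1 + j) = 1 + n) (h' : i + j = n) (x : Fin (2 * n)) :
    Fin (2 * (1 + n)) :=
  Sum.elim (fst3 h) (Sum.elim (fun b => mid3 h (mid3 rfl b)) (lst3 h)) ((eqv3 h').symm x)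

theorem skipMid_fst {n i j : ℕ} (h : i + (1 + j) = 1 + n) (h' : i + j = n) (a : Fin i) :
    skipMid h h' (fst3 h' a) = fst3 h a := by simp [skipMid, fst3]

theorem skipMid_mid {n i j : ℕ} (h : i + (1 + j) = 1 + n) (h' : i + j = n) (b : Fin (2 * j)) :
    skipMid h h' (mid3 h' b) = mid3 h (mid3 rfl b) := by simp [skipMid, mid3]

theorem skipMid_lst {n i j : ℕ} (h : i + (1 + j) = 1 + n) (h' : i + j = n) (a : Fin i) :
    skipMid h h' (lst3 h' a) = lst3 h a := by simp [skipMid, lst3]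

/-- The underlying function of `midPerm`. -/
def midPermFun {n i j : ℕ} (h : i + (1 + j) = 1 + n) (h' : i + j = n)
    (x : Fin (2 * (1 + n))) : Fin (2 * (1 + n)) :=
  Sum.elim (fun a : Fin 1 => mid3 h (fst3 rfl a)) (Sum.elim (skipMid h h')
    (fun a : Fin 1 => mid3 h (lst3 rfl a))) ((eqv3 (rfl : 1 + n = 1 + n)).symm x)

theorem midPermFun_fst {n i j : ℕ} (h : i + (1 + j) = 1 + n) (h' : i + j = n) (a : Fin 1) :
    midPermFun h h' (fst3 rfl a) = mid3 h (fst3 rfl a) := by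
  simp only [midPermFun, fst3, Equiv.symm_apply_apply, Sum.elim_inl]

theorem midPermFun_mid {n i j : ℕ} (h : i + (1 + j) = 1 + n) (h' : i + j = n) (x : Fin (2 * n)) :
    midPermFun h h' (mid3 rfl x) = skipMid h h' x := by
  simp only [midPermFun, mid3, Equiv.symm_apply_apply, Sum.elim_inl, Sum.elim_inr]

theorem midPermFun_lst {n i j : ℕ} (h : i + (1 + j) = 1 + n) (h' : i + j = n) (a : Fin 1) :
    midPermFun h h' (lst3 rfl a) = mid3 h (lst3 rfl a) := by
  simp only [midPermFun, lst3, Equiv.symm_apply_apply, Sum.elim_inr]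

theorem midPermFun_surjective {n i j : ℕ} (h : i + (1 + j) = 1 + n) (h' : i + j = n) :
    Function.Surjective (midPermFun h h') := by
  intro x
  rcases cases3 h x with ⟨a, rfl⟩ | ⟨b, rfl⟩ | ⟨a, rfl⟩
  · exact ⟨mid3 rfl (fst3 h' a), by rw [midPermFun_mid, skipMid_fst]⟩
  · rcases cases3 rfl b with ⟨a, rfl⟩ | ⟨a, rfl⟩ | ⟨a, rfl⟩
    · exact ⟨fst3 rfl a, midPermFun_fst h h' a⟩
    · exact ⟨mid3 rfl (mid3 h' a), by rw [midPermFun_mid, skipMid_mid]⟩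
    · exact ⟨lst3 rfl a, midPermFun_lst h h' a⟩
  · exact ⟨mid3 rfl (lst3 h' a), by rw [midPermFun_mid, skipMid_lst]⟩

/-- The permutation moving the first and the last index to the two ends of the middle block. -/
def midPerm {n i j : ℕ} (h : i + (1 + j) = 1 + n) (h' : i + j = n) :
    Equiv.Perm (Fin (2 * (1 + n))) :=
  Equiv.ofBijective (midPermFun h h')
    (Finite.surjective_iff_bijective.1 (midPermFun_surjective h h'))

theorem skipMid_rev {n i j : ℕ} (h : i + (1 + j) = 1 + n) (h' : i + j = n) (x : Fin (2 * n)) :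
    skipMid h h' x.rev = (skipMid h h' x).rev := by
  rcases cases3 h' x with ⟨a, rfl⟩ | ⟨a, rfl⟩ | ⟨a, rfl⟩
  · rw [rev_fst3, skipMid_lst, skipMid_fst, rev_fst3]
  · rw [rev_mid3, skipMid_mid, skipMid_mid, rev_mid3, rev_mid3]
  · rw [rev_lst3, skipMid_lst, skipMid_fst, rev_lst3]

theorem midPerm_rev {n i j : ℕ} (h : i + (1 + j) = 1 + n) (h' : i + j = n)
    (x : Fin (2 * (1 + n))) : midPerm h h' x.rev = (midPerm h h' x).rev := by
  show midPermFun h h' x.rev = (midPermFun h h' x).rev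
  rcases cases3 rfl x with ⟨a, rfl⟩ | ⟨a, rfl⟩ | ⟨a, rfl⟩
  · rw [rev_fst3, midPermFun_lst, midPermFun_fst, rev_mid3, rev_fst3]
  · rw [rev_mid3, midPermFun_mid, midPermFun_mid, skipMid_rev]
  · rw [rev_lst3, midPermFun_lst, midPermFun_fst, rev_mid3, rev_lst3]

theorem midPerm_mid {n i j : ℕ} (h : i + (1 + j) = 1 + n) (h' : i + j = n) (x : Fin (2 * n)) :
    midPerm h h' (mid3 rfl x) = skipMid h h' x :=
  midPermFun_mid h h' x

theorem lab3_skipMid {n i j : ℕ} (h : i + (1 + j) = 1 + n) (h' : i + j = n) (x : Fin (2 * n)) :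
    lab3 h (skipMid h h' x) = lab3 h' x := by
  rcases cases3 h' x with ⟨a, rfl⟩ | ⟨a, rfl⟩ | ⟨a, rfl⟩
  · rw [skipMid_fst, lab3_fst3, lab3_fst3]
  · rw [skipMid_mid, lab3_mid3, lab3_mid3]
  · rw [skipMid_lst, lab3_lst3, lab3_lst3]

-- The representative moves the line to the start of the middle block, so the vanishing column is
-- one of Y. Harmonicity of ψ, applied to each slice `sliceY`, lowers j by one.
open Classical in
theorem sum_mackeyVec_mid {F : Type*} [Field F] [StarRing F] [Fintype F] {n i j : ℕ}
    (h : i + (1 + j) = 1 + n) (h' : i + j = n) (u : CGl F i) {ψ : B F →ₗ[ℝ] ℝ} (hψ : ψ ∈ HarmB F)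
    (f : CU F (2 * n)) :
    ∑ x ∈ (isoVec F (2 * (1 + n))).filter fun x => x ∘ lst3 h = 0 ∧ x ∘ mid3 h ≠ 0,
      mackeyVec h u (weightB ψ (1 + j)) f x =
    ((Fintype.card F - 1 : ℕ) : ℝ) * (Nat.card (nilU F h) * resPair h' u (weightB ψ j) f.1) := by
  have ha : midPerm h h' (fst3 rfl (0 : Fin 1)) = mid3 h (fst3 rfl 0) := midPermFun_fst h h' 0
  have hlab (x : Fin (2 * n)) : lab3 h (midPerm h h' (mid3 rfl x)) = lab3 h' x := by
    rw [midPerm_mid, lab3_skipMid]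
  have hc (x) (hx : x ∈ (isoVec F (2 * (1 + n))).filter
      fun x => x ∘ lst3 h = 0 ∧ x ∘ mid3 h ≠ 0) :
      mackeyVec h u (weightB ψ (1 + j)) f x =
        mackeyTerm h u (weightB ψ (1 + j)) f (permU F (midPerm h h') (midPerm_rev h h')) := by
    rw [Finset.mem_filter, mem_isoVec] at hx
    obtain ⟨b, hb⟩ := exists_unitary_mulVec_eq hx.2.2
      (by rw [← herm_of_comp_lst3 h hx.2.1, hx.1.2])
    exact mackeyVec_eq h _ _ f _ _ ha (par_trans_mid h _ hx.1.2 hx.2.1 hb)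
  rw [Finset.sum_congr rfl hc, Finset.sum_const, nsmul_eq_mul,
    mackeyTerm_permU h h' u _ f (midPerm h h') (midPerm_rev h h') hlab
      id (midU rfl) (fun X Y => permMid_levi h h' _ _
        hlab (fun a b => by
          simp only [midPerm_mid, skipMid_fst, levi_fst_fst, id_eq])
        (fun a b => by
          simp only [midPerm_mid, skipMid_mid, levi_mid_mid]
          rfl))]
  simp only [ha, levi_col_mid_iff, id_eq]
  refine sum_mackey_algebra (M := (isoVec F (2 * (1 + j))).card)
    (I := Nat.card (colImage F h (mid3 h (fst3 rfl (0 : Fin 1))))) ?_ ?_ ?_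
  · rw [card_filter_mid h (fst3 rfl (0 : Fin 1)), Nat.cast_mul]
  · rw [card_nilU_eq h (mid3 h (fst3 rfl (0 : Fin 1))), Nat.cast_mul]
  · rw [resPair, Finset.mul_sum, Finset.mul_sum]
    refine Finset.sum_congr rfl fun X _ => ?_
    have := weightB_harm hψ (sliceY h' f X)
    calc _ = u.1 X * ((isoVec F (2 * (1 + j))).card *
          ∑ Y, (weightB ψ (1 + j)).1 Y * lineRes (sliceY h' f X).1 Y) := by
          rw [mul_left_comm, Finset.mul_sum (a := u.1 X)]
          congr 1
          refine Finset.sum_congr rfl fun Y _ => ?_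
          simp only [lineRes, sliceY]
          ring
      _ = _ := by
          rw [← this, mul_left_comm, Finset.mul_sum (a := u.1 X)]
          congr 1
          refine Finset.sum_congr rfl fun Y _ => ?_
          simp only [sliceY]
          ring

/-! ### The Mackey formula and harmonicity -/

/-- Parabolic induction of `χ₀ ⊗ f` to `𝔲(2(1 + n))`: multiplication by `x₁`. -/
def x1Mul {F : Type*} [Field F] [Finite F] [StarRing F] {n : ℕ} (f : CU F (2 * n)) :
    CU F (2 * (1 + n)) :=
  indU F (rfl : 1 + n = 1 + n)
    (extMul (glConj F 1) (uConj F (2 * n)) (orbInd (glConj F 1) (Quotient.mk _ 0) ⊗ₜ f))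

/-- The homogeneous component of bidegree `(i, j)` of `φ ⊗ ψ`, applied to the parabolic
restriction of `f`, with value `0` if `i + j` is not the degree of `f`. -/
def pairing {F : Type*} [Field F] [Fintype F] [StarRing F] (φ : A F →ₗ[ℝ] ℝ) (ψ : B F →ₗ[ℝ] ℝ)
    {n : ℕ} (f : CU F (2 * n)) (i j : ℕ) : ℝ :=
  if h : i + j = n then resPair h (weightA φ i) (weightB ψ j) f.1 else 0

theorem sum_eq_sum_filter_three {α : Type*} (s : Finset α) (f : α → ℝ) (p r : α → Prop)
    [DecidablePred p] [DecidablePred r] :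
    ∑ x ∈ s, f x = ∑ x ∈ s.filter (fun x => p x ∧ r x), f x +
      ∑ x ∈ s.filter (fun x => p x ∧ ¬ r x), f x + ∑ x ∈ s.filter (fun x => ¬ p x), f x := by
  rw [← Finset.sum_filter_add_sum_filter_not s p,
    ← Finset.sum_filter_add_sum_filter_not (s.filter p) r, Finset.filter_filter,
    Finset.filter_filter]

-- The isotropic vectors are split into the three cells. The cells inside V and outside V^⊥ give the
-- same value, whence the factor 2. The conditions i = 0 and j = 0 guard against truncated
-- subtraction and correspond to empty cells.
open Classical in
theorem mackey {F : Type*} [Field F] [Fintype F] [StarRing F] (h2 : (2 : F) ≠ 0)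
    {φ : A F →ₗ[ℝ] ℝ} (hφ : φ ∈ HarmA F) {ψ : B F →ₗ[ℝ] ℝ} (hψ : ψ ∈ HarmB F) {n : ℕ}
    (f : CU F (2 * n)) {i j : ℕ} (h : i + j = 1 + n) :
    pairing φ ψ (x1Mul f) i j =
      2 * (if i = 0 then 0 else pairing φ ψ f (i - 1) j) +
        if j = 0 then 0 else pairing φ ψ f i (j - 1) := by
  have hc : ((Fintype.card F - 1 : ℕ) : ℝ) ≠ 0 := by
    have := Fintype.one_lt_card (α := F)
    exact_mod_cast (by omega : Fintype.card F - 1 ≠ 0)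
  have hn : (Nat.card (nilU F h) : ℝ) ≠ 0 := card_nilU_ne_zero h
  refine mul_left_cancel₀ hn (mul_left_cancel₀ hc ?_)
  rw [pairing, dif_pos h, x1Mul, resPair_indU,
    sum_eq_sum_filter_three _ _ (fun x => x ∘ lst3 h = 0) (fun x => x ∘ mid3 h = 0)]
  have e1 : ∑ x ∈ (isoVec F (2 * (1 + n))).filter fun x => x ∘ lst3 h = 0 ∧ x ∘ mid3 h = 0,
      mackeyVec h (weightA φ i) (weightB ψ j) f x = ((Fintype.card F - 1 : ℕ) : ℝ) *
        (Nat.card (nilU F h) * if i = 0 then 0 else pairing φ ψ f (i - 1) j) := by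
    obtain rfl | ⟨i, rfl⟩ : i = 0 ∨ ∃ i', i = 1 + i' :=
      i.eq_zero_or_pos.imp_right fun hi => ⟨i - 1, by omega⟩
    -- For i = 0 the first block is empty, so a vector of this cell would be zero.
    · rw [if_pos rfl, mul_zero, mul_zero, Finset.filter_eq_empty_iff.2, Finset.sum_empty]
      rintro x hx ⟨hl, hm⟩
      exact (mem_isoVec.1 hx).1 (ext3 h (fun a => a.elim0) (congrFun hm) (congrFun hl))
    · have h' : i + j = n := by omega
      rw [if_neg (by omega), Nat.add_sub_cancel_left, pairing, dif_pos h',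
        sum_mackeyVec_fst h h' hφ]
  have e2 : ∑ x ∈ (isoVec F (2 * (1 + n))).filter fun x => ¬ x ∘ lst3 h = 0,
      mackeyVec h (weightA φ i) (weightB ψ j) f x = ((Fintype.card F - 1 : ℕ) : ℝ) *
        (Nat.card (nilU F h) * if i = 0 then 0 else pairing φ ψ f (i - 1) j) := by
    obtain rfl | ⟨i, rfl⟩ : i = 0 ∨ ∃ i', i = 1 + i' :=
      i.eq_zero_or_pos.imp_right fun hi => ⟨i - 1, by omega⟩
    · rw [if_pos rfl, mul_zero, mul_zero, Finset.filter_eq_empty_iff.2, Finset.sum_empty]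
      exact fun x _ hx => hx (funext fun a => a.elim0)
    · have h' : i + j = n := by omega
      rw [if_neg (by omega), Nat.add_sub_cancel_left, pairing, dif_pos h',
        ← sum_mackeyVec_lst h2 h h' hφ]
  have e3 : ∑ x ∈ (isoVec F (2 * (1 + n))).filter fun x => x ∘ lst3 h = 0 ∧ ¬ x ∘ mid3 h = 0,
      mackeyVec h (weightA φ i) (weightB ψ j) f x = ((Fintype.card F - 1 : ℕ) : ℝ) *
        (Nat.card (nilU F h) * if j = 0 then 0 else pairing φ ψ f i (j - 1)) := by
    obtain rfl | ⟨j, rfl⟩ : j = 0 ∨ ∃ j', j = 1 + j' :=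
      j.eq_zero_or_pos.imp_right fun hj => ⟨j - 1, by omega⟩
    · rw [if_pos rfl, Finset.filter_eq_empty_iff.2, Finset.sum_empty, mul_zero, mul_zero]
      exact fun x _ hx => hx.2 (funext fun a => a.elim0)
    · have h' : i + j = n := by omega
      rw [if_neg (by omega), Nat.add_sub_cancel_left, pairing, dif_pos h',
        ← sum_mackeyVec_mid h h' _ hψ]
  rw [e1, e2, e3]
  ring

/-- Each bidegree (i, j) of degree n is reached from (i + 1, j) with coefficient 2s and from (i, j +
1) with coefficient t, relative to its own weight; the boundary terms are 0. -/
theorem sum_antidiagonal_shift (s t : ℝ) (n : ℕ) (g : ℕ → ℕ → ℝ) :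
    ∑ p ∈ Finset.HasAntidiagonal.antidiagonal (1 + n), s ^ p.1 * t ^ p.2 *
      (2 * (if p.1 = 0 then 0 else g (p.1 - 1) p.2) +
        if p.2 = 0 then 0 else g p.1 (p.2 - 1)) =
    (2 * s + t) * ∑ p ∈ Finset.HasAntidiagonal.antidiagonal n, s ^ p.1 * t ^ p.2 * g p.1 p.2 := by
  simp only [mul_add, Finset.sum_add_distrib, add_mul]
  rw [add_comm 1 n]
  refine congrArg₂ (· + ·) ?_ ?_
  · rw [Finset.Nat.sum_antidiagonal_succ]
    simp only [if_pos, mul_zero, zero_add, Nat.succ_ne_zero, if_false, Nat.add_sub_cancel,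
      Finset.mul_sum]
    exact Finset.sum_congr rfl fun p _ => by ring
  · rw [Finset.Nat.sum_antidiagonal_succ']
    simp only [if_pos, mul_zero, zero_add, Nat.succ_ne_zero, if_false, Nat.add_sub_cancel,
      Finset.mul_sum]
    exact Finset.sum_congr rfl fun p _ => by ring

theorem mix_harmonic {F : Type*} [Field F] [Fintype F] [StarRing F] (h2 : (2 : F) ≠ 0) (s : ℝ)
    {φ : A F →ₗ[ℝ] ℝ} (hφ : φ ∈ HarmA F) {ψ : B F →ₗ[ℝ] ℝ} (hψ : ψ ∈ HarmB F) (b : B F) :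
    mix s φ ψ b = mix s φ ψ (nablaB F (x1 F ⊗ₜ[ℝ] b)) := by
  suffices mix s φ ψ = mix s φ ψ ∘ₗ nablaB F ∘ₗ TensorProduct.mk ℝ (A F) (B F) (x1 F) from
    LinearMap.congr_fun this b
  refine DirectSum.linearMap_ext ℝ fun n => LinearMap.ext fun f => ?_
  show mix s φ ψ (DirectSum.lof ℝ ℕ (fun n => CU F (2 * n)) n f) =
    mix s φ ψ (nablaB F (x1 F ⊗ₜ[ℝ] DirectSum.lof ℝ ℕ (fun n => CU F (2 * n)) n f))
  rw [nablaB_x1, mix_lof, mix_lof]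
  have := sum_antidiagonal_shift s (1 - 2 * s) n (pairing φ ψ f)
  -- The weight 1 - 2s on B is exactly what makes 2s + t equal to 1.
  rw [add_sub_cancel, one_mul] at this
  refine this.symm.trans (Finset.sum_congr rfl fun p hp => ?_)
  rw [← mackey h2 hφ hψ f (Finset.HasAntidiagonal.mem_antidiagonal.1 hp)]
  rfl

theorem mix_mem_HarmB {F : Type*} [Field F] [Fintype F] [StarRing F] (h2 : (2 : F) ≠ 0) {s : ℝ}
    (hs0 : 0 ≤ s) (hs1 : s ≤ 1 / 2) {φ : A F →ₗ[ℝ] ℝ} (hφ : φ ∈ HarmA F) {ψ : B F →ₗ[ℝ] ℝ}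
    (hψ : ψ ∈ HarmB F) : mix s φ ψ ∈ HarmB F :=
  ⟨mix_orbInd_nonneg hs0 hs1 hφ hψ, mix_harmonic h2 s hφ hψ⟩

theorem two_ne_zero_of_odd_card {F : Type*} [Field F] [Fintype F] (h : Odd (Fintype.card F)) :
    (2 : F) ≠ 0 := by
  refine Ring.two_ne_zero fun h2 => ?_
  rw [FiniteField.even_card_iff_char_two] at h2
  exact Nat.not_even_iff_odd.2 h (Nat.even_iff.2 h2)

end Mixing

end

theorem mainTheorem5 {F : Type*} [Field F] [Finite F] [StarRing F] (q : ℕ) (hq : Odd q)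
    (hF : Nat.card F = q ^ 2) (hstar : ∀ x : F, star x = x ^ q)
    (s : ℝ) (hs0 : 0 ≤ s) (hs1 : s ≤ 1 / 2) :
    (∀ φ ∈ Mixing.HarmA F, ∀ ψ ∈ Mixing.HarmB F, Mixing.mix s φ ψ ∈ Mixing.HarmB F) ∧
    (∀ φ ∈ Mixing.HarmA0 F, ∀ ψ ∈ Mixing.HarmB0 F, Mixing.mix s φ ψ ∈ Mixing.HarmB0 F) := by
  have := Fintype.ofFinite F
  have h2 : (2 : F) ≠ 0 := Mixing.two_ne_zero_of_odd_card <| by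
    rw [← Nat.card_eq_fintype_card, hF]
    exact hq.pow
  exact ⟨fun φ hφ ψ hψ => Mixing.mix_mem_HarmB h2 hs0 hs1 hφ hψ,
    fun φ hφ ψ hψ => ⟨Mixing.mix_mem_HarmB h2 hs0 hs1 hφ.1 hψ.1,
      Mixing.mix_orbInd_eq_zero s hφ hψ⟩⟩
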